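/- Let $n\ge 3$, $m>0$, $R_0=(m/2)^{1/(n-2)}$, and let $M=\{x\in\mathbb R^n:\ |x|\ge R_0\}$ carry the Riemannian Schwarzschild metric $$g_{Sch}=\Big(1+\frac{m}{2|x|^{n-2}}\Big)^{\frac4{n-2}}\delta ,$$ where $\delta$ is the Euclidean metric, with horizon $\partial M=\{|x|=R_0\}$. For $\rho>0$ let $B_\rho$ be the set of points of $M$ at Schwarzschild distance at most $\rho$ from $\partial M$. For a nonempty closed embedded smooth minimal hypersurface $\Gamma$ of the unit sphere $\mathbb S^{n-1}\subset\mathbb R^n$ put $\Sigma_\Gamma=\{\lambda y:\ y\in\Gamma,\ \lambda>0\}\cap M$, and let $|\cdot|$ denote the $(n-2)$-dimensional Euclidean volume of hypersurfaces of $\mathbb S^{n-1}$. A minimal cone is a set of the form $\Sigma_{\Gamma'}$ with $\Gamma'$ a nonempty closed embedded smooth minimal hypersurface of $\mathbb S^{n-1}$. Let $\Sigma$ be a nonempty properly embedded smooth free boundary minimal hypersurface of $(M,g_{Sch})$, that is, $\Sigma$ is closed in $M$, $\partial\Sigma=\Sigma\cap\partial M$, the mean curvature of $\Sigma$ with respect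 to $g_{Sch}$ vanishes, and $\Sigma$ meets $\partial M$ orthogonally along $\partial\Sigma$. Let $\Gamma$ be a nonempty closed embedded smooth minimal hypersurface of $\mathbb S^{n-1}$ and suppose that the $\Gamma$-density at infinity $$\Theta_\Gamma(\Sigma)=\lim_{\rho\to+\infty}\frac{vol(\Sigma\cap B_\rho)}{vol(\Sigma_\Gamma\cap B_\rho)}$$ exists and is finite, where $vol$ is the $(n-1)$-dimensional volume with respect to $g_{Sch}$. Then, with $area$ the $(n-2)$-dimensional area with respect to $g_{Sch}$, $$area(\partial\Sigma)\le 2m\,|\Gamma|\,\Theta_\Gamma(\Sigma).$$ Moreover, equality holds if and only if $\Sigma$ is a minimal cone, and in that case $$|\Gamma|\,\Theta_\Gamma(\Sigma)=|R_0^{-1}\partial\Sigma| ,$$ where $R_0^{-1}\partial\Sigma\subset\mathbb S^{n-1}$ is the dilation of $\partial\Sigma$ into the unit sphere. -/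

import Mathlib

open MeasureTheory Filter Topology
open scoped ContDiff ENNReal Pointwise

noncomputable section

namespace Schwarzschild

/-- Euclidean space `ℝⁿ`. -/
abbrev Eucl (n : ℕ) := EuclideanSpace ℝ (Fin n)

/-! ### The Riemannian Schwarzschild space -/

/-- The radius `R₀ = (m / 2) ^ (1 / (n - 2))` of the horizon, in isotropic coordinates. -/
def horizonRadius (n : ℕ) (m : ℝ) : ℝ := (m / 2) ^ (1 / ((n : ℝ) - 2))

/-- The manifold with boundary `M = {x ∈ ℝⁿ : |x| ≥ R₀}`. -/
def space (n : ℕ) (m : ℝ) : Set (Eucl n) := {x | horizonRadius n m ≤ ‖x‖}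

/-- The horizon `∂M = S₀ = {x ∈ ℝⁿ : |x| = R₀}`. -/
def horizon (n : ℕ) (m : ℝ) : Set (Eucl n) := {x | ‖x‖ = horizonRadius n m}

/-- The conformal factor `f(x) = (1 + m / (2 |x| ^ (n - 2))) ^ (2 / (n - 2))`. -/
def confFactor (n : ℕ) (m : ℝ) (x : Eucl n) : ℝ :=
  (1 + m / (2 * ‖x‖ ^ (n - 2))) ^ (2 / ((n : ℝ) - 2))

/-- The Schwarzschild metric `g = (1 + m / (2 |x| ^ (n - 2))) ^ (4 / (n - 2)) δ = f² δ`. -/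
def metric (n : ℕ) (m : ℝ) (x v w : Eucl n) : ℝ := confFactor n m x ^ 2 * inner ℝ v w

/-- The Schwarzschild length of a curve `γ : [0, 1] → M`. -/
def curveLength (n : ℕ) (m : ℝ) (γ : ℝ → Eucl n) : ℝ :=
  ∫ t in (0 : ℝ)..1, √(metric n m (γ t) (deriv γ t) (deriv γ t))

/-- The Schwarzschild distance of a point `x ∈ M` to the horizon: the infimum of the lengths of
the `C¹` curves in `M` from the horizon to `x`. -/
def distHorizon (n : ℕ) (m : ℝ) (x : Eucl n) : ℝ :=
  sInf {L | ∃ γ : ℝ → Eucl n, ContDiffOn ℝ 1 γ (Set.Icc 0 1) ∧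
    (∀ t ∈ Set.Icc (0 : ℝ) 1, γ t ∈ space n m) ∧ γ 0 ∈ horizon n m ∧ γ 1 = x ∧
    L = curveLength n m γ}

/-- `B_ρ`: the points of `M` at Schwarzschild distance at most `ρ` to the horizon. -/
def horizonBall (n : ℕ) (m ρ : ℝ) : Set (Eucl n) := {x ∈ space n m | distHorizon n m x ≤ ρ}

/-- The `k`-dimensional area of a set in the Schwarzschild metric. On a `k`-dimensional submanifold
the Euclidean area element is `μHE[k]`, the `k`-dimensional Hausdorff measure (normalized so as to
agree with Lebesgue measure on `ℝᵏ`), and the area element of `g = f² δ` is `f ^ k` times the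
Euclidean one. -/
def area (n : ℕ) (m : ℝ) (k : ℕ) (S : Set (Eucl n)) : ℝ≥0∞ :=
  ∫⁻ x in S, ENNReal.ofReal (confFactor n m x ^ k) ∂μHE[k]

/-- The Levi-Civita connection of `g = f² δ`: the linear map `v ↦ ∇_v Y` at the point `x`, where
`∇_v Y = D_v Y + f⁻¹ (df(v) Y + df(Y) v - ⟨v, Y⟩ grad f)`. -/
def covDeriv (n : ℕ) (m : ℝ) (Y : Eucl n → Eucl n) (x : Eucl n) : Eucl n →L[ℝ] Eucl n :=
  fderiv ℝ Y x + (confFactor n m x)⁻¹ •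
    ((fderiv ℝ (confFactor n m) x).smulRight (Y x)
      + (fderiv ℝ (confFactor n m) x (Y x)) • ContinuousLinearMap.id ℝ (Eucl n)
      - (innerSL ℝ (Y x)).smulRight (gradient (confFactor n m) x))

/-- The `g`-unit normal vector field to the level sets of `φ`. -/
def unitNormal (n : ℕ) (m : ℝ) (φ : Eucl n → ℝ) (x : Eucl n) : Eucl n :=
  (confFactor n m x * ‖gradient φ x‖)⁻¹ • gradient φ x

/-- The mean curvature at `x`, in the Schwarzschild metric, of the level set of `φ` through `x`,
i.e. the trace of `v ↦ ∇_v N` for the unit normal field `N`. (The trace over the whole space is the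
trace over the tangent space of the level set, because `g(∇_N N, N) = N(g(N, N)) / 2 = 0`.) -/
def meanCurvature (n : ℕ) (m : ℝ) (φ : Eucl n → ℝ) (x : Eucl n) : ℝ :=
  LinearMap.trace ℝ (Eucl n) (covDeriv n m (unitNormal n m φ) x).toLinearMap

/-- `S` is a (nonempty) properly embedded smooth free boundary minimal hypersurface of the
Schwarzschild space. It is a closed subset of `M` which near each of its points is the part in `M`
of the zero set of a smooth function `φ` with nonvanishing gradient; its mean curvature vanishes;
and it meets the horizon orthogonally, i.e. at its points on the horizon the radial direction is
tangent to it. In particular it is transverse to `∂M`, so that it is a smooth hypersurface with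
boundary `∂S = S ∩ ∂M`. -/
structure IsFreeBoundaryMinimal (n : ℕ) (m : ℝ) (S : Set (Eucl n)) : Prop where
  nonempty : S.Nonempty
  isClosed : IsClosed S
  subset : S ⊆ space n m
  locally_minimal : ∀ p ∈ S, ∃ (U : Set (Eucl n)) (φ : Eucl n → ℝ),
    IsOpen U ∧ p ∈ U ∧ ContDiffOn ℝ ∞ φ U ∧ (∀ x ∈ U, gradient φ x ≠ 0) ∧
    S ∩ U = {x ∈ U | x ∈ space n m ∧ φ x = 0} ∧
    (∀ x ∈ S ∩ U, meanCurvature n m φ x = 0) ∧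
    (∀ x ∈ S ∩ U ∩ horizon n m, inner ℝ (gradient φ x) x = 0)

/-- The boundary `∂S = S ∩ ∂M` of a properly embedded hypersurface `S` of `M`. -/
def boundary (n : ℕ) (m : ℝ) (S : Set (Eucl n)) : Set (Eucl n) := S ∩ horizon n m

/-! ### Minimal hypersurfaces of the unit sphere and the cones over them -/

/-- The orthogonal projection `v ↦ v - ⟨x, v⟩ x` onto the tangent space of the unit sphere at the
unit vector `x`. -/
def sphereProj (n : ℕ) (x : Eucl n) : Eucl n →L[ℝ] Eucl n :=
  ContinuousLinearMap.id ℝ (Eucl n) - (innerSL ℝ x).smulRight x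

/-- The gradient at a point `x` of the unit sphere of the restriction of `φ` to the sphere. -/
def sphereGrad (n : ℕ) (φ : Eucl n → ℝ) (x : Eucl n) : Eucl n := sphereProj n x (gradient φ x)

/-- The unit normal field, tangent to the sphere, to the level sets of `φ` in the unit sphere. -/
def sphereNormal (n : ℕ) (φ : Eucl n → ℝ) (x : Eucl n) : Eucl n :=
  ‖sphereGrad n φ x‖⁻¹ • sphereGrad n φ x

/-- The mean curvature at `x`, in the unit sphere, of the level set of `φ` through `x`: the trace
of `v ↦ ∇_v N` on the tangent space of the sphere, where `N` is the unit normal field and `∇_v N`,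
the Levi-Civita connection of the sphere, is the tangential part of `D_v N`. -/
def sphereMeanCurvature (n : ℕ) (φ : Eucl n → ℝ) (x : Eucl n) : ℝ :=
  LinearMap.trace ℝ (Eucl n)
    (sphereProj n x ∘L fderiv ℝ (sphereNormal n φ) x ∘L sphereProj n x).toLinearMap

/-- `Γ` is a (nonempty) closed embedded smooth minimal hypersurface of the unit sphere of `ℝⁿ`:
it is compact, near each of its points it is the zero set in the sphere of a smooth function whose
gradient along the sphere does not vanish, and its mean curvature vanishes. -/
structure IsClosedMinimalInSphere (n : ℕ) (Γ : Set (Eucl n)) : Prop where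
  nonempty : Γ.Nonempty
  isCompact : IsCompact Γ
  subset : Γ ⊆ Metric.sphere 0 1
  locally_minimal : ∀ p ∈ Γ, ∃ (U : Set (Eucl n)) (φ : Eucl n → ℝ),
    IsOpen U ∧ p ∈ U ∧ ContDiffOn ℝ ∞ φ U ∧
    (∀ x ∈ U ∩ Metric.sphere 0 1, sphereGrad n φ x ≠ 0) ∧
    Γ ∩ U = {x ∈ U | x ∈ Metric.sphere (0 : Eucl n) 1 ∧ φ x = 0} ∧
    (∀ x ∈ Γ ∩ U, sphereMeanCurvature n φ x = 0)

/-- The part `Σ_Γ = {x ∈ C_Γ : |x| ≥ R₀}` in `M` of the cone `C_Γ = {l y : y ∈ Γ, l > 0}`. -/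
def cone (n : ℕ) (m : ℝ) (Γ : Set (Eucl n)) : Set (Eucl n) :=
  {x | ∃ y ∈ Γ, ∃ l : ℝ, 0 < l ∧ x = l • y} ∩ space n m

/-- `S` is a minimal cone of the Schwarzschild space: the cone over a closed embedded minimal
hypersurface of the unit sphere. -/
def IsMinimalCone (n : ℕ) (m : ℝ) (S : Set (Eucl n)) : Prop :=
  ∃ Γ : Set (Eucl n), IsClosedMinimalInSphere n Γ ∧ S = cone n m Γ

/-- `Θ` is the `Γ`-density at infinity of `S`: the limit as `ρ → ∞` of
`vol(S ∩ B_ρ) / vol(Σ_Γ ∩ B_ρ)`, which is assumed to exist and to be finite. -/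
def HasDensityAtInfinity (n : ℕ) (m : ℝ) (Γ S : Set (Eucl n)) (Θ : ℝ≥0∞) : Prop :=
  Θ ≠ ⊤ ∧ Tendsto (fun ρ : ℝ => area n m (n - 1) (S ∩ horizonBall n m ρ) /
    area n m (n - 1) (cone n m Γ ∩ horizonBall n m ρ)) atTop (𝓝 Θ)

/-- The Euclidean volume `|Γ|` of an `(n - 2)`-dimensional submanifold of the unit sphere
of `ℝⁿ`. -/
def sphereVol (n : ℕ) (Γ : Set (Eucl n)) : ℝ≥0∞ := μHE[n - 2] Γ

end Schwarzschild

end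

set_option linter.unusedSectionVars false

namespace Schwarzschild

/-! ### The area formula for injective immersions -/

section AreaFormula

open Module Set
open scoped NNReal

variable {E F : Type*} [NormedAddCommGroup E] [InnerProductSpace ℝ E] [FiniteDimensional ℝ E]
  [NormedAddCommGroup F] [InnerProductSpace ℝ F]

/-! The proof is a weighted monotonicity formula, obtained by testing minimality with radial fields.
Write r = |x|, let F(r) be the conformal factor, h = -rF'/F (`decayRate`), N a Euclidean unit normal
of Σ and P = ⟨x,N⟩²/r² (`radialDefect`). By conformal change, Schwarzschild minimality says that the
Euclidean mean curvature of Σ is (n-1) h ⟨x,N⟩ / r². The Euclidean divergence theorem on Σ, applied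
to the tangential part of c(r) r^(1-n) x with c supported off the horizon, then reads ∫_Σ [c'(r)
r^(2-n) (1 - P) + (n-1) c(r) r^(1-n) (1 - h) P] = 0 (`first_variation`, `radial_first_variation`).
Since h < 1 off the horizon, for c ≥ 0 the second term is nonnegative, and where c > 0 it vanishes
only if the radial direction is tangent to Σ.

Let V(r) = ∫ s^(n-2) F(s)^(n-1) ds from R₀ to r, the volume of a cone over a link of unit volume.
Take c = k ψ, where k rises from 0 to 1 in a collar shrinking to the horizon and ψ is a C¹ version
of (V(R) - V(r))₊. The term with ψ' costs at most the area of Σ in {r ≤ R}. The term with k'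
concentrates on ∂Σ, where orthogonality forces P = 0 (`boundary_le_liminf`). What remains is a
defect controlling P. This is `boundary_add_defect_le`. Dividing by V(R) and letting R → ∞ gives
|R₀⁻¹∂Σ| + defect ≤ |Γ| Θ (`sphereVol_link_add_defect_le`); the density enters because distance
balls are coordinate balls (`horizonBall_radialDist`) and the cone over Γ has volume |Γ| V(R)
(`area_cone`). On the horizon F^(n-2) = 4 and R₀^(n-2) = m/2, so area(∂Σ) = 2m |R₀⁻¹∂Σ|
(`area_boundary`).

In case of equality the defect vanishes, hence P = 0 off the horizon, Σ is a union of rays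
(`IsRadial.smul_mem`), and its link is minimal in the sphere (`IsRadial.isMinimalCone`). Conversely,
for a cone over Γ' the density quotient is eventually the constant |Γ'| / |Γ|. -/

theorem euclideanHausdorffMeasure_image_le_of_edist_le {X Y Z : Type*} [Nonempty X]
    [EMetricSpace Y] [MeasurableSpace Y] [BorelSpace Y]
    [EMetricSpace Z] [MeasurableSpace Z] [BorelSpace Z] {f : X → Y} {h : X → Z} {t : Set X}
    {K : ℝ≥0} (d : ℕ) (H : ∀ x ∈ t, ∀ y ∈ t, edist (f x) (f y) ≤ K * edist (h x) (h y)) :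
    μHE[d] (f '' t) ≤ (K : ℝ≥0∞) ^ d * μHE[d] (h '' t) := by
  -- `h` need not be injective: by `H` equal values of `h` on `t` give equal values of `f`, so `f`
  -- factors through any section of `h`.
  have hL : LipschitzOnWith K (f ∘ Function.invFunOn h t) (h '' t) := by
    intro a ha b hb
    have h1 := Function.invFunOn_mem ha
    have h2 := Function.invFunOn_mem hb
    simpa [Function.invFunOn_eq ha, Function.invFunOn_eq hb] using H _ h1 _ h2
  have himg : f '' t ⊆ (f ∘ Function.invFunOn h t) '' (h '' t) := by
    rintro _ ⟨x, hx, rfl⟩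
    have hm : h x ∈ h '' t := mem_image_of_mem h hx
    refine ⟨h x, hm, ?_⟩
    have h0 := H _ (Function.invFunOn_mem hm) _ hx
    rw [Function.invFunOn_eq hm, edist_self, mul_zero, nonpos_iff_eq_zero, edist_eq_zero] at h0
    exact h0
  have key := hL.hausdorffMeasure_image_le (d := d) (Nat.cast_nonneg d)
  rw [ENNReal.rpow_natCast] at key
  simp only [Measure.euclideanHausdorffMeasure_def, Measure.smul_apply, ENNReal.smul_def,
    smul_eq_mul]
  calc _ ≤ _ := mul_le_mul_right ((measure_mono himg).trans key) _
    _ = _ := by ring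

/-- In a fixed orthonormal basis the Jacobian is the square root of a Gram determinant. -/
theorem continuous_normDet :
    Continuous fun L : E →L[ℝ] F => (L : E →ₗ[ℝ] F).normDet := by
  have h : (fun L : E →L[ℝ] F => (L : E →ₗ[ℝ] F).normDet) = fun L =>
      √((Matrix.gram ℝ (fun i => L (stdOrthonormalBasis ℝ E i))).det) := by
    ext L
    have := (L : E →ₗ[ℝ] F).normDet_sq_eq_det_gram (stdOrthonormalBasis ℝ E)
    simp only [RCLike.ofReal_real_eq_id, id] at this
    rw [← Real.sqrt_sq (L : E →ₗ[ℝ] F).normDet_nonneg, this]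
    rfl
  rw [h]
  refine Real.continuous_sqrt.comp (Continuous.matrix_det ?_)
  refine continuous_matrix fun i j => ?_
  simp only [Matrix.gram_apply]
  fun_prop

theorem normDet_pos_of_injective {L : E →ₗ[ℝ] F} (hL : Function.Injective L) : 0 < L.normDet := by
  refine lt_of_le_of_ne L.normDet_nonneg fun h => ?_
  exact (LinearMap.normDet_eq_zero_iff_ker_ne_bot.1 h.symm) (LinearMap.ker_eq_bot.2 hL)

variable [MeasurableSpace E] [BorelSpace E] [MeasurableSpace F] [BorelSpace F]
variable {f : E → F} {f' : E → E →L[ℝ] F} {s : Set E}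

/-- Near `x₀` the map and its linearization there are Lipschitz functions of each other, with
constants as close to 1 as desired. This compares the Hausdorff measures of their images, and for
the linear map the measure is a Jacobian times the volume. -/
theorem exists_nhds_area_le (hs : IsOpen s) (hf : ∀ x ∈ s, HasFDerivAt f (f' x) x)
    (hc : ContinuousOn f' s) {x₀ : E} (hx₀ : x₀ ∈ s) (hinj : Function.Injective (f' x₀))
    {c : ℝ} (hc1 : 1 < c) :
    ∃ U ∈ 𝓝 x₀, U ⊆ s ∧ ∀ t ⊆ U, MeasurableSet t →
      μHE[finrank ℝ E] (f '' t) ≤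
        ENNReal.ofReal c * ∫⁻ x in t, ENNReal.ofReal (f' x : E →ₗ[ℝ] F).normDet ∧
      ∫⁻ x in t, ENNReal.ofReal (f' x : E →ₗ[ℝ] F).normDet ≤
        ENNReal.ofReal c * μHE[finrank ℝ E] (f '' t) := by
  set A := f' x₀ with hA
  set k := finrank ℝ E
  -- The factor `a ^ k` pays for the Lipschitz comparison of `k`-dimensional measures, the last `a`
  -- for the variation of the Jacobian.
  obtain ⟨a, ha1, hac⟩ : ∃ a : ℝ, 1 < a ∧ a ^ k * a < c := by
    have h1 : Tendsto (fun a : ℝ => a ^ k * a) (𝓝[>] 1) (𝓝 (1 ^ k * 1)) :=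
      (Continuous.tendsto (by fun_prop) 1).mono_left nhdsWithin_le_nhds
    rw [one_pow, mul_one] at h1
    obtain ⟨a, h, h'⟩ := ((h1.eventually_lt_const hc1).and self_mem_nhdsWithin).exists
    exact ⟨a, h', h⟩
  obtain ⟨K, hK0, hK⟩ := (LinearMap.exists_antilipschitzWith (A : E →ₗ[ℝ] F)
    (LinearMap.ker_eq_bot.2 hinj))
  have hKn : ∀ v, ‖v‖ ≤ K * ‖A v‖ := fun v => by
    simpa [edist_zero_right] using hK.le_mul_dist v 0
  have hKp : (0 : ℝ) < K := hK0
  -- Chosen so that an error `r * ‖v‖` is at most `(1 - a⁻¹) * ‖A v‖`. The distortion then lies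
  -- between `a⁻¹` and `2 - a⁻¹`, and the latter is at most `a`.
  set r : ℝ := (1 - a⁻¹) / K with hr
  have hr0 : 0 < r := div_pos (by simpa using inv_lt_one_of_one_lt₀ ha1) hKp
  have hrK : r * K = 1 - a⁻¹ := by rw [hr]; field_simp
  have hJ := normDet_pos_of_injective (L := (A : E →ₗ[ℝ] F)) hinj
  set J := (A : E →ₗ[ℝ] F).normDet
  have hcat : ContinuousAt f' x₀ := hc.continuousAt (hs.mem_nhds hx₀)
  have hcJ : ContinuousAt (fun x => (f' x : E →ₗ[ℝ] F).normDet) x₀ :=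
    continuous_normDet.continuousAt.comp hcat
  have e1 : ∀ᶠ x in 𝓝 x₀, ‖f' x - A‖ < r := by
    have := (hcat.sub_const A).norm
    simp only [← hA, sub_self, norm_zero] at this
    exact this.eventually_lt_const hr0
  have e2 : ∀ᶠ x in 𝓝 x₀, (f' x : E →ₗ[ℝ] F).normDet < a * J :=
    hcJ.eventually_lt_const (by change J < _; nlinarith)
  have e3 : ∀ᶠ x in 𝓝 x₀, J / a < (f' x : E →ₗ[ℝ] F).normDet :=
    hcJ.eventually_const_lt (by change _ < J; rw [div_lt_iff₀ (by linarith)]; nlinarith)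
  obtain ⟨ε, hε, hball⟩ := Metric.eventually_nhds_iff_ball.1
    ((e1.and (e2.and e3)).and (hs.mem_nhds hx₀))
  refine ⟨Metric.ball x₀ ε, Metric.ball_mem_nhds _ hε, fun x hx => (hball x hx).2, ?_⟩
  intro t ht htm
  have happ : ∀ x ∈ t, ∀ y ∈ t, ‖f x - f y - A (x - y)‖ ≤ r * ‖x - y‖ := by
    intro x hx y hy
    exact (convex_ball x₀ ε).norm_image_sub_le_of_norm_hasFDerivWithin_le'
      (fun z hz => (hf z (hball z hz).2).hasFDerivWithinAt)
      (fun z hz => (hball z hz).1.1.le) (ht hy) (ht hx)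
  have ha0 : 0 < a := by linarith
  set a' : ℝ≥0 := ⟨a, ha0.le⟩ with ha'
  have hlin : ∀ v, r * ‖v‖ ≤ (1 - a⁻¹) * ‖A v‖ := fun v => by
    rw [← hrK, mul_assoc]; exact mul_le_mul_of_nonneg_left (hKn v) hr0.le
  have hainv : a⁻¹ ≤ 1 := inv_le_one_of_one_le₀ ha1.le
  have haa : 2 - a⁻¹ ≤ a := by
    have : a * a⁻¹ = 1 := mul_inv_cancel₀ ha0.ne'
    nlinarith [sq_nonneg (a - 1), inv_pos.2 ha0]
  have b1 : ∀ x ∈ t, ∀ y ∈ t, edist (f x) (f y) ≤ a' * edist (A x) (A y) := by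
    intro x hx y hy
    rw [edist_dist, edist_dist, ← ENNReal.ofReal_coe_nnreal, ← ENNReal.ofReal_mul (NNReal.coe_nonneg a'),
      dist_eq_norm, dist_eq_norm, ← map_sub]
    refine ENNReal.ofReal_le_ofReal ?_
    have h1 := happ x hx y hy
    have h2 := hlin (x - y)
    have h3 : ‖f x - f y‖ ≤ ‖f x - f y - A (x - y)‖ + ‖A (x - y)‖ := by
      simpa using norm_add_le (f x - f y - A (x - y)) (A (x - y))
    change _ ≤ a * _
    nlinarith [norm_nonneg (A (x - y))]
  have b2 : ∀ x ∈ t, ∀ y ∈ t, edist (A x) (A y) ≤ a' * edist (f x) (f y) := by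
    intro x hx y hy
    rw [edist_dist, edist_dist, ← ENNReal.ofReal_coe_nnreal, ← ENNReal.ofReal_mul (NNReal.coe_nonneg a'),
      dist_eq_norm, dist_eq_norm, ← map_sub]
    refine ENNReal.ofReal_le_ofReal ?_
    have h1 := happ x hx y hy
    have h2 := hlin (x - y)
    have h3 : ‖A (x - y)‖ ≤ ‖f x - f y‖ + ‖f x - f y - A (x - y)‖ := by
      simpa using norm_sub_le (f x - f y) (f x - f y - A (x - y))
    change _ ≤ a * _
    have h4 : a⁻¹ * ‖A (x - y)‖ ≤ ‖f x - f y‖ := by linarith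
    rwa [inv_mul_le_iff₀ ha0] at h4
  have m1 := euclideanHausdorffMeasure_image_le_of_edist_le k b1
  have m2 := euclideanHausdorffMeasure_image_le_of_edist_le k b2
  have mA : μHE[k] (A '' t) = ENNReal.ofReal J * volume t :=
    (A : E →ₗ[ℝ] F).euclideanHausdorffMeasure_image_eq_normDet_mul_volume t
  rw [mA] at m1 m2
  have i1 : ENNReal.ofReal J * volume t ≤
      ENNReal.ofReal a * ∫⁻ x in t, ENNReal.ofReal (f' x : E →ₗ[ℝ] F).normDet := by
    rw [← lintegral_const_mul' _ _ ENNReal.ofReal_ne_top, ← setLIntegral_const]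
    refine setLIntegral_mono' htm fun x hx => ?_
    rw [← ENNReal.ofReal_mul ha0.le]
    refine ENNReal.ofReal_le_ofReal ?_
    have := (hball x (ht hx)).1.2.2
    rw [div_lt_iff₀ ha0] at this
    linarith
  have i2 : ∫⁻ x in t, ENNReal.ofReal (f' x : E →ₗ[ℝ] F).normDet ≤
      ENNReal.ofReal a * (ENNReal.ofReal J * volume t) := by
    rw [← mul_assoc, ← ENNReal.ofReal_mul ha0.le, ← setLIntegral_const]
    exact setLIntegral_mono' htm fun x hx =>
      ENNReal.ofReal_le_ofReal (hball x (ht hx)).1.2.1.le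
  have hcoe : (a' : ℝ≥0∞) = ENNReal.ofReal a := by
    rw [← ENNReal.ofReal_coe_nnreal]; rfl
  have hak : (a' : ℝ≥0∞) ^ k * ENNReal.ofReal a ≤ ENNReal.ofReal c := by
    rw [hcoe, ← ENNReal.ofReal_pow ha0.le, ← ENNReal.ofReal_mul (by positivity)]
    exact ENNReal.ofReal_le_ofReal hac.le
  constructor
  · calc _ ≤ _ := m1
      _ ≤ _ := mul_le_mul_right i1 _
      _ ≤ _ := by rw [← mul_assoc]; exact mul_le_mul_left hak _
  · calc _ ≤ _ := i2
      _ ≤ _ := mul_le_mul_right m2 _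
      _ ≤ _ := by rw [← mul_assoc, mul_comm (ENNReal.ofReal a)]; exact mul_le_mul_left hak _

/-- **Area formula** for the Euclidean Hausdorff measure of the image of a set under an injective
immersion. -/
theorem area_formula (hs : IsOpen s) (hf : ∀ x ∈ s, HasFDerivAt f (f' x) x)
    (hc : ContinuousOn f' s) (himm : ∀ x ∈ s, Function.Injective (f' x)) (hinj : InjOn f s)
    {t : Set E} (hts : t ⊆ s) (ht : MeasurableSet t) :
    μHE[finrank ℝ E] (f '' t) = ∫⁻ x in t, ENNReal.ofReal (f' x : E →ₗ[ℝ] F).normDet := by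
  have hfc : ContinuousOn f s := fun x hx => (hf x hx).continuousAt.continuousWithinAt
  -- The local estimates are summed over a countable disjoint cover, both sides being countably
  -- additive by injectivity; afterwards `c` tends to 1.
  have main : ∀ c : ℝ, 1 < c →
      μHE[finrank ℝ E] (f '' t) ≤
        ENNReal.ofReal c * ∫⁻ x in t, ENNReal.ofReal (f' x : E →ₗ[ℝ] F).normDet ∧
      ∫⁻ x in t, ENNReal.ofReal (f' x : E →ₗ[ℝ] F).normDet ≤
        ENNReal.ofReal c * μHE[finrank ℝ E] (f '' t) := by
    intro c hc1
    rcases s.eq_empty_or_nonempty with rfl | hne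
    · simp [subset_empty_iff.1 hts]
    choose! U hU hUs hUt using fun x (hx : x ∈ s) =>
      exists_nhds_area_le hs hf hc hx (himm x hx) hc1
    obtain ⟨T, hTs, hTc, hT⟩ := TopologicalSpace.countable_cover_nhdsWithin
      (fun x hx => mem_nhdsWithin_of_mem_nhds (interior_mem_nhds.2 (hU x hx)))
    have hTne : T.Nonempty := by
      rcases T.eq_empty_or_nonempty with rfl | h
      · obtain ⟨x, hx⟩ := hne
        simpa using hT hx
      · exact h
    obtain ⟨q, hq⟩ := hTc.exists_eq_range hTne
    have hqs : ∀ i, q i ∈ s := fun i => hTs (hq ▸ mem_range_self i)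
    set D : ℕ → Set E := disjointed fun i => interior (U (q i)) with hD
    have hDm : ∀ i, MeasurableSet (D i) :=
      fun i => MeasurableSet.disjointed (fun i => isOpen_interior.measurableSet) i
    have hDd : Pairwise (Function.onFun Disjoint D) := disjoint_disjointed _
    have hDU : ∀ i, D i ⊆ U (q i) := fun i => (disjointed_subset _ i).trans interior_subset
    have hcov : t = ⋃ i, t ∩ D i := by
      rw [← inter_iUnion, iUnion_disjointed, eq_comm, inter_eq_left]
      intro x hx
      have := hT (hts hx)
      rw [hq] at this
      simpa using this
    have hdis : Pairwise (Function.onFun Disjoint fun i => t ∩ D i) := fun i j hij =>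
      (hDd hij).mono inter_subset_right inter_subset_right
    have hmeas : ∀ i, MeasurableSet (t ∩ D i) := fun i => ht.inter (hDm i)
    have e1 : ∫⁻ x in t, ENNReal.ofReal (f' x : E →ₗ[ℝ] F).normDet =
        ∑' i, ∫⁻ x in t ∩ D i, ENNReal.ofReal (f' x : E →ₗ[ℝ] F).normDet := by
      conv_lhs => rw [hcov]
      exact lintegral_iUnion hmeas hdis _
    have e2 : μHE[finrank ℝ E] (f '' t) = ∑' i, μHE[finrank ℝ E] (f '' (t ∩ D i)) := by
      conv_lhs => rw [hcov, image_iUnion]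
      refine measure_iUnion ?_ ?_
      · intro i j hij
        refine (hdis hij).image hinj (inter_subset_left.trans hts) (inter_subset_left.trans hts)
      · intro i
        exact (hmeas i).image_of_continuousOn_injOn
          (hfc.mono (inter_subset_left.trans hts)) (hinj.mono (inter_subset_left.trans hts))
    have hl := fun i => hUt (q i) (hqs i) (t ∩ D i) (inter_subset_right.trans (hDU i)) (hmeas i)
    rw [e1, e2, ← ENNReal.tsum_mul_left, ← ENNReal.tsum_mul_left]
    exact ⟨ENNReal.tsum_le_tsum fun i => (hl i).1, ENNReal.tsum_le_tsum fun i => (hl i).2⟩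
  have lim : ∀ b : ℝ≥0∞, Tendsto (fun c : ℝ => ENNReal.ofReal c * b) (𝓝[>] 1) (𝓝 b) := by
    intro b
    have h1 : Tendsto (fun c : ℝ => ENNReal.ofReal c) (𝓝[>] 1) (𝓝 (ENNReal.ofReal 1)) :=
      (ENNReal.continuous_ofReal.tendsto 1).mono_left nhdsWithin_le_nhds
    have h2 := ENNReal.Tendsto.mul_const (b := b) h1 (Or.inl (by simp))
    simpa using h2
  refine le_antisymm (ge_of_tendsto (lim _) ?_) (ge_of_tendsto (lim _) ?_)
  · filter_upwards [self_mem_nhdsWithin] with c hc using (main c hc).1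
  · filter_upwards [self_mem_nhdsWithin] with c hc using (main c hc).2

theorem restrict_image_eq_map_normDet (hs : IsOpen s) (hf : ∀ x ∈ s, HasFDerivAt f (f' x) x)
    (hc : ContinuousOn f' s) (himm : ∀ x ∈ s, Function.Injective (f' x)) (hinj : InjOn f s)
    {t : Set E} (hts : t ⊆ s) (ht : MeasurableSet t) :
    (μHE[finrank ℝ E] : Measure F).restrict (f '' t) =
      Measure.map (t.domRestrict f)
        (Measure.comap (↑) (volume.withDensity fun x =>
          ENNReal.ofReal (f' x : E →ₗ[ℝ] F).normDet)) := by
  have hfc : ContinuousOn f t := fun x hx => (hf x (hts hx)).continuousAt.continuousWithinAt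
  have hme : MeasurableEmbedding (t.domRestrict f) :=
    hfc.measurableEmbedding ht (hinj.mono hts)
  refine Measure.ext fun u hu => ?_
  rw [Measure.restrict_apply hu, hme.map_apply, Measure.comap_apply _ Subtype.val_injective
    (fun v hv => ht.subtype_image hv) _ (hme.measurable hu)]
  have h1 : Subtype.val '' (t.domRestrict f ⁻¹' u) = t ∩ f ⁻¹' u := by
    ext x; simp [and_comm]
  have hm : MeasurableSet (t ∩ f ⁻¹' u) := by
    rw [← h1]; exact ht.subtype_image (hme.measurable hu)
  rw [h1, withDensity_apply _ hm, ← area_formula hs hf hc himm hinj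
    (inter_subset_left.trans hts) hm, image_inter_preimage, inter_comm]

theorem aemeasurable_normDet (hc : ContinuousOn f' s) {t : Set E} (hts : t ⊆ s)
    (ht : MeasurableSet t) :
    AEMeasurable (fun x => (f' x : E →ₗ[ℝ] F).normDet) (volume.restrict t) :=
  (continuous_normDet.comp_continuousOn (hc.mono hts)).aemeasurable ht

theorem lintegral_image_eq_normDet (hs : IsOpen s) (hf : ∀ x ∈ s, HasFDerivAt f (f' x) x)
    (hc : ContinuousOn f' s) (himm : ∀ x ∈ s, Function.Injective (f' x)) (hinj : InjOn f s)
    {t : Set E} (hts : t ⊆ s) (ht : MeasurableSet t) (g : F → ℝ≥0∞) :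
    ∫⁻ x in f '' t, g x ∂μHE[finrank ℝ E] =
      ∫⁻ x in t, ENNReal.ofReal (f' x : E →ₗ[ℝ] F).normDet * g (f x) := by
  have hfc : ContinuousOn f t := fun x hx => (hf x (hts hx)).continuousAt.continuousWithinAt
  have hme : MeasurableEmbedding (t.domRestrict f) :=
    hfc.measurableEmbedding ht (hinj.mono hts)
  rw [restrict_image_eq_map_normDet hs hf hc himm hinj hts ht, hme.lintegral_map]
  simp only [Set.domRestrict_apply, ← Function.comp_apply (f := g)]
  rw [← (MeasurableEmbedding.subtype_coe ht).lintegral_map, map_comap_subtype_coe ht,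
    setLIntegral_withDensity_eq_setLIntegral_mul_non_measurable₀ _ _ _ ht]
  · simp only [Pi.mul_apply]
  · simp only [eventually_true, ENNReal.ofReal_lt_top]
  · exact (aemeasurable_normDet hc hts ht).ennreal_ofReal

theorem integrableOn_image_iff_normDet (hs : IsOpen s) (hf : ∀ x ∈ s, HasFDerivAt f (f' x) x)
    (hc : ContinuousOn f' s) (himm : ∀ x ∈ s, Function.Injective (f' x)) (hinj : InjOn f s)
    {t : Set E} (hts : t ⊆ s) (ht : MeasurableSet t) (g : F → ℝ) :
    IntegrableOn g (f '' t) μHE[finrank ℝ E] ↔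
      IntegrableOn (fun x => (f' x : E →ₗ[ℝ] F).normDet * g (f x)) t := by
  have hfc : ContinuousOn f t := fun x hx => (hf x (hts hx)).continuousAt.continuousWithinAt
  have hme : MeasurableEmbedding (t.domRestrict f) :=
    hfc.measurableEmbedding ht (hinj.mono hts)
  rw [IntegrableOn, restrict_image_eq_map_normDet hs hf hc himm hinj hts ht,
    hme.integrable_map_iff]
  simp only [Set.domRestrict_eq, ← Function.comp_assoc, ENNReal.ofReal]
  rw [← (MeasurableEmbedding.subtype_coe ht).integrable_map_iff, map_comap_subtype_coe ht,
    restrict_withDensity ht, integrable_withDensity_iff_integrable_coe_smul₀]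
  · simp_rw [IntegrableOn, Real.coe_toNNReal _ (LinearMap.normDet_nonneg _), smul_eq_mul,
      Function.comp_apply]
  · exact (aemeasurable_normDet hc hts ht).real_toNNReal

theorem integral_image_eq_normDet (hs : IsOpen s) (hf : ∀ x ∈ s, HasFDerivAt f (f' x) x)
    (hc : ContinuousOn f' s) (himm : ∀ x ∈ s, Function.Injective (f' x)) (hinj : InjOn f s)
    {t : Set E} (hts : t ⊆ s) (ht : MeasurableSet t) (g : F → ℝ) :
    ∫ x in f '' t, g x ∂μHE[finrank ℝ E] =
      ∫ x in t, (f' x : E →ₗ[ℝ] F).normDet * g (f x) := by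
  have hfc : ContinuousOn f t := fun x hx => (hf x (hts hx)).continuousAt.continuousWithinAt
  have hme : MeasurableEmbedding (t.domRestrict f) :=
    hfc.measurableEmbedding ht (hinj.mono hts)
  rw [restrict_image_eq_map_normDet hs hf hc himm hinj hts ht, hme.integral_map]
  simp only [Set.domRestrict_apply, ← Function.comp_apply (f := g), ENNReal.ofReal]
  rw [← (MeasurableEmbedding.subtype_coe ht).integral_map, map_comap_subtype_coe ht,
    setIntegral_withDensity_eq_setIntegral_smul₀
      (aemeasurable_normDet hc hts ht).real_toNNReal _ ht]
  congr with x
  rw [NNReal.smul_def, Real.coe_toNNReal _ (LinearMap.normDet_nonneg _), smul_eq_mul]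

end AreaFormula

/-! ### Local parametrizations of level sets -/

section LevelChart

open Module Set

variable {E H : Type*} [NormedAddCommGroup E] [NormedSpace ℝ E]
  [NormedAddCommGroup H] [NormedSpace ℝ H]

/-- The inverse function theorem, with the source cut down to the open set where the derivative is
invertible, so that the inverse is smooth on the whole target and not only at one point. -/
theorem exists_smooth_chart [CompleteSpace E] {Φ : E → H} {U : Set E} (hU : IsOpen U) {p : E}
    (hp : p ∈ U) (hΦ : ContDiffOn ℝ ∞ Φ U) (A : E ≃L[ℝ] H)
    (hA : HasFDerivAt Φ (A : E →L[ℝ] H) p) :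
    ∃ e : OpenPartialHomeomorph E H, p ∈ e.source ∧ e.source ⊆ U ∧ ⇑e = Φ ∧
      ContDiffOn ℝ ∞ e.symm e.target ∧
      ∀ x ∈ e.source, Function.Injective (fderiv ℝ Φ x) := by
  have hat : ∀ x ∈ U, ContDiffAt ℝ ∞ Φ x := fun x hx => hΦ.contDiffAt (hU.mem_nhds hx)
  set e₀ := (hat p hp).toOpenPartialHomeomorph Φ hA (by simp) with he₀
  have hcont : ContinuousOn (fderiv ℝ Φ) U :=
    (hΦ.fderiv_of_isOpen (m := 0) hU (by simp)).continuousOn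
  set V := U ∩ fderiv ℝ Φ ⁻¹' range ((↑) : (E ≃L[ℝ] H) → E →L[ℝ] H) with hV
  have hVo : IsOpen V := hcont.isOpen_inter_preimage hU ContinuousLinearEquiv.isOpen
  have hpV : p ∈ V := ⟨hp, A, hA.fderiv.symm⟩
  refine ⟨e₀.restrOpen V hVo, ?_, ?_, rfl, ?_, ?_⟩
  · exact ⟨(hat p hp).mem_toOpenPartialHomeomorph_source hA (by simp), hpV⟩
  · exact fun x hx => hx.2.1
  · intro y hy
    set e := e₀.restrOpen V hVo
    have hx : e.symm y ∈ e.source := e.map_target hy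
    obtain ⟨B, hB⟩ := hx.2.2
    have hd : HasFDerivAt Φ (B : E →L[ℝ] H) (e.symm y) := by
      have := ((hat _ hx.2.1).differentiableAt (by simp)).hasFDerivAt
      rwa [← hB] at this
    exact (e.contDiffAt_symm hy hd (hat _ hx.2.1)).contDiffWithinAt
  · intro x hx
    obtain ⟨B, hB⟩ := hx.2.2
    rw [← hB]
    exact B.injective

/-- `X`, defined on the open set `D`, parametrizes the zero set of `φ` in the open set `V`, and
`κ` restricts to its inverse. -/
structure IsLevelChart (κ : E → H) (φ : E → ℝ) (V : Set E) (D : Set H) (X : H → E) : Prop where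
  isOpen_source : IsOpen V
  isOpen_target : IsOpen D
  contDiffOn : ContDiffOn ℝ ∞ X D
  contDiffOn_coord : ContDiffOn ℝ ∞ κ V
  contDiffOn_fun : ContDiffOn ℝ ∞ φ V
  map_mem : ∀ z ∈ D, X z ∈ V
  coord_apply : ∀ z ∈ D, κ (X z) = z
  fun_apply : ∀ z ∈ D, φ (X z) = 0
  coord_mem : ∀ x ∈ V, φ x = 0 → κ x ∈ D
  apply_coord : ∀ x ∈ V, φ x = 0 → X (κ x) = x
  eq_zero_of_fderiv : ∀ x ∈ V, ∀ v, fderiv ℝ κ x v = 0 → fderiv ℝ φ x v = 0 → v = 0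

/-- The pair `(κ, φ)` is a local diffeomorphism at `p`, and `X` is its inverse restricted to the
slice where the second coordinate is zero. -/
theorem exists_levelChart [CompleteSpace E] {U : Set E} (hU : IsOpen U) {p : E} (hp : p ∈ U)
    {κ : E → H} {φ : E → ℝ} (hκ : ContDiffOn ℝ ∞ κ U) (hφ : ContDiffOn ℝ ∞ φ U)
    (A : E ≃L[ℝ] H × ℝ)
    (hA : (A : E →L[ℝ] H × ℝ) = (fderiv ℝ κ p).prod (fderiv ℝ φ p)) :
    ∃ V D X, p ∈ V ∧ V ⊆ U ∧ IsLevelChart κ φ V D X := by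
  have hd : HasFDerivAt (fun x => (κ x, φ x)) (A : E →L[ℝ] H × ℝ) p := by
    rw [hA]
    exact ((hκ.contDiffAt (hU.mem_nhds hp)).differentiableAt (by simp)).hasFDerivAt.prodMk
      ((hφ.contDiffAt (hU.mem_nhds hp)).differentiableAt (by simp)).hasFDerivAt
  obtain ⟨e, hpe, heU, he, hes, hinj⟩ := exists_smooth_chart hU hp (hκ.prodMk hφ) A hd
  have hc : Continuous fun z : H => (z, (0 : ℝ)) := by fun_prop
  have hf : ∀ z, (z, (0 : ℝ)) ∈ e.target →
      (κ (e.symm (z, 0)), φ (e.symm (z, 0))) = (z, 0) := fun z hz => by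
    have := e.right_inv hz
    rwa [he] at this
  refine ⟨e.source, (fun z => (z, (0 : ℝ))) ⁻¹' e.target, fun z => e.symm (z, 0), hpe, heU,
    e.open_source, e.open_target.preimage hc, ?_, hκ.mono heU, hφ.mono heU,
    fun z hz => e.map_target hz, fun z hz => congrArg Prod.fst (hf z hz),
    fun z hz => congrArg Prod.snd (hf z hz), ?_, ?_, ?_⟩
  · exact hes.comp (ContDiff.contDiffOn (by fun_prop)) fun z hz => hz
  · intro x hx h0
    have := e.map_source hx
    rw [he] at this
    simpa [h0] using this
  · intro x hx h0
    have := e.left_inv hx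
    rw [he] at this
    simpa [h0] using this
  · intro x hx v h1 h2
    have hxU := heU hx
    have hd : HasFDerivAt (fun x => (κ x, φ x)) ((fderiv ℝ κ x).prod (fderiv ℝ φ x)) x :=
      ((hκ.contDiffAt (hU.mem_nhds hxU)).differentiableAt (by simp)).hasFDerivAt.prodMk
        ((hφ.contDiffAt (hU.mem_nhds hxU)).differentiableAt (by simp)).hasFDerivAt
    refine hinj x hx ?_
    rw [hd.fderiv, map_zero, ContinuousLinearMap.prod_apply, h1, h2]
    rfl

namespace IsLevelChart

variable {κ : E → H} {φ : E → ℝ} {V : Set E} {D : Set H} {X : H → E}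

theorem image_eq (h : IsLevelChart κ φ V D X) : X '' D = {x ∈ V | φ x = 0} := by
  ext x
  constructor
  · rintro ⟨z, hz, rfl⟩
    exact ⟨h.map_mem z hz, h.fun_apply z hz⟩
  · rintro ⟨hx, h0⟩
    exact ⟨κ x, h.coord_mem x hx h0, h.apply_coord x hx h0⟩

theorem injOn (h : IsLevelChart κ φ V D X) : InjOn X D := fun a ha b hb hab => by
  rw [← h.coord_apply a ha, hab, h.coord_apply b hb]

theorem hasFDerivAt (h : IsLevelChart κ φ V D X) : ∀ z ∈ D, HasFDerivAt X (fderiv ℝ X z) z :=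
  fun z hz => ((h.contDiffOn.contDiffAt (h.isOpen_target.mem_nhds hz)).differentiableAt
    (by simp)).hasFDerivAt

theorem continuousOn_fderiv (h : IsLevelChart κ φ V D X) : ContinuousOn (fderiv ℝ X) D :=
  (h.contDiffOn.fderiv_of_isOpen (m := 0) h.isOpen_target (by simp)).continuousOn

theorem hasFDerivAt_fun (h : IsLevelChart κ φ V D X) :
    ∀ x ∈ V, HasFDerivAt φ (fderiv ℝ φ x) x :=
  fun x hx => ((h.contDiffOn_fun.contDiffAt (h.isOpen_source.mem_nhds hx)).differentiableAt
    (by simp)).hasFDerivAt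

theorem hasFDerivAt_coord (h : IsLevelChart κ φ V D X) :
    ∀ x ∈ V, HasFDerivAt κ (fderiv ℝ κ x) x :=
  fun x hx => ((h.contDiffOn_coord.contDiffAt (h.isOpen_source.mem_nhds hx)).differentiableAt
    (by simp)).hasFDerivAt

theorem fderiv_coord_apply (h : IsLevelChart κ φ V D X) {z : H} (hz : z ∈ D) (w : H) :
    fderiv ℝ κ (X z) (fderiv ℝ X z w) = w := by
  have h1 := (h.hasFDerivAt_coord _ (h.map_mem z hz)).comp z (h.hasFDerivAt z hz)
  have h2 : κ ∘ X =ᶠ[𝓝 z] id := by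
    filter_upwards [h.isOpen_target.mem_nhds hz] with y hy using h.coord_apply y hy
  have h3 := h1.unique ((hasFDerivAt_id z).congr_of_eventuallyEq h2)
  simpa using congrArg (fun L => L w) h3

theorem fderiv_fun_apply (h : IsLevelChart κ φ V D X) {z : H} (hz : z ∈ D) (w : H) :
    fderiv ℝ φ (X z) (fderiv ℝ X z w) = 0 := by
  have h1 := (h.hasFDerivAt_fun _ (h.map_mem z hz)).comp z (h.hasFDerivAt z hz)
  have h2 : φ ∘ X =ᶠ[𝓝 z] fun _ => 0 := by
    filter_upwards [h.isOpen_target.mem_nhds hz] with y hy using h.fun_apply y hy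
  have h3 := h1.unique ((hasFDerivAt_const (0 : ℝ) z).congr_of_eventuallyEq h2)
  simpa using congrArg (fun L => L w) h3

theorem injective_fderiv (h : IsLevelChart κ φ V D X) :
    ∀ z ∈ D, Function.Injective (fderiv ℝ X z) := fun z hz a b hab => by
  rw [← h.fderiv_coord_apply hz a, hab, h.fderiv_coord_apply hz b]

end IsLevelChart

end LevelChart

/-! ### Graph charts -/

section GraphChart

open Module Set

variable {E : Type*} [NormedAddCommGroup E] [InnerProductSpace ℝ E]

/-- The orthogonal projection to the hyperplane orthogonal to `e`. -/
noncomputable def hyperProj (e : E) : E →L[ℝ] (ℝ ∙ e)ᗮ := (ℝ ∙ e)ᗮ.orthogonalProjectionOnto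

theorem hyperProj_coe {e : E} (he : ‖e‖ = 1) (x : E) :
    (hyperProj e x : E) = x - inner ℝ e x • e := by
  rw [hyperProj, Submodule.coe_orthogonalProjectionOnto_apply,
    Submodule.starProjection_orthogonal_val, Submodule.starProjection_unit_singleton ℝ he]

variable [FiniteDimensional ℝ E]

theorem exists_equiv_of_ker {H : Type*} [NormedAddCommGroup H] [NormedSpace ℝ H]
    [FiniteDimensional ℝ H] (L : E →L[ℝ] H) (hL : ∀ v, L v = 0 → v = 0)
    (hfr : finrank ℝ E = finrank ℝ H) : ∃ A : E ≃L[ℝ] H, (A : E →L[ℝ] H) = L :=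
  ⟨(LinearEquiv.ofInjectiveOfFinrankEq (L : E →ₗ[ℝ] H)
    (LinearMap.ker_eq_bot.1 (LinearMap.ker_eq_bot'.2 hL)) hfr).toContinuousLinearEquiv,
    by ext v; rfl⟩

theorem finrank_hyperplane {e : E} (he : ‖e‖ = 1) : finrank ℝ (ℝ ∙ e)ᗮ + 1 = finrank ℝ E := by
  have h0 : e ≠ 0 := by rintro rfl; simp at he
  have := (ℝ ∙ e).finrank_add_finrank_orthogonal
  rw [finrank_span_singleton h0] at this
  omega

/-- A vector killed by the projection is a multiple of `e`, and the derivative of `φ` does not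
vanish on `e`; so the projection together with `φ` has injective derivative. -/
theorem exists_graphChart {U : Set E} (hU : IsOpen U) {p : E} (hp : p ∈ U) {φ : E → ℝ}
    (hφ : ContDiffOn ℝ ∞ φ U) {e : E} (he : ‖e‖ = 1) (hne : fderiv ℝ φ p e ≠ 0) :
    ∃ V D X, p ∈ V ∧ V ⊆ U ∧ IsLevelChart (hyperProj e) φ V D X := by
  set L := (fderiv ℝ (hyperProj e) p).prod (fderiv ℝ φ p) with hL
  have hLf : fderiv ℝ (hyperProj e) p = hyperProj e := (hyperProj e).fderiv
  have hker : ∀ v, L v = 0 → v = 0 := by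
    intro v hv
    have h1 : hyperProj e v = 0 := by
      have := congrArg Prod.fst hv
      simpa [hL, hLf] using this
    have h2 : fderiv ℝ φ p v = 0 := by
      have := congrArg Prod.snd hv
      simpa [hL] using this
    have h3 := hyperProj_coe he v
    rw [h1, Submodule.coe_zero, eq_comm, sub_eq_zero] at h3
    rw [h3, map_smul, smul_eq_mul] at h2
    have h4 : inner ℝ e v = 0 := (mul_eq_zero.1 h2).resolve_right hne
    rw [h3, h4, zero_smul]
  have hfr : finrank ℝ E = finrank ℝ ((ℝ ∙ e)ᗮ × ℝ) := by
    rw [finrank_prod, finrank_self, finrank_hyperplane he]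
  obtain ⟨A, hA⟩ := exists_equiv_of_ker L hker hfr
  exact exists_levelChart hU hp (hyperProj e).contDiff.contDiffOn hφ A hA

end GraphChart

/-! ### Unit normal fields of level sets -/

section Normal

open Module Set

variable {E : Type*} [NormedAddCommGroup E] [InnerProductSpace ℝ E] [FiniteDimensional ℝ E]

theorem inner_gradient (φ : E → ℝ) (x v : E) : inner ℝ (gradient φ x) v = fderiv ℝ φ x v := by
  simp [gradient]

/-- The Euclidean unit normal field to the level sets of `φ`. -/
noncomputable def euclNormal (φ : E → ℝ) (x : E) : E := ‖gradient φ x‖⁻¹ • gradient φ x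

variable {φ : E → ℝ} {U : Set E}

theorem contDiffOn_gradient (hU : IsOpen U) (hφ : ContDiffOn ℝ ∞ φ U) :
    ContDiffOn ℝ ∞ (gradient φ) U := by
  have h : ContDiffOn ℝ ∞ (fderiv ℝ φ) U := hφ.fderiv_of_isOpen hU (by simp)
  exact (InnerProductSpace.toDual ℝ E).symm.contDiff.comp_contDiffOn h

theorem contDiffOn_euclNormal (hU : IsOpen U) (hφ : ContDiffOn ℝ ∞ φ U)
    (h0 : ∀ x ∈ U, gradient φ x ≠ 0) : ContDiffOn ℝ ∞ (euclNormal φ) U := by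
  have hg := contDiffOn_gradient hU hφ
  exact ((hg.norm ℝ h0).inv fun x hx => norm_ne_zero_iff.2 (h0 x hx)).smul hg

theorem norm_euclNormal {x : E} (h0 : gradient φ x ≠ 0) : ‖euclNormal φ x‖ = 1 := by
  rw [euclNormal, norm_smul, norm_inv, norm_norm, inv_mul_cancel₀ (norm_ne_zero_iff.2 h0)]

theorem gradient_eq_smul_euclNormal (φ : E → ℝ) (x : E) :
    gradient φ x = ‖gradient φ x‖ • euclNormal φ x := by
  by_cases h : gradient φ x = 0
  · simp [h]
  · rw [euclNormal, smul_smul, mul_inv_cancel₀ (norm_ne_zero_iff.2 h), one_smul]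

theorem inner_fderiv_euclNormal_self (hU : IsOpen U) (hφ : ContDiffOn ℝ ∞ φ U)
    (h0 : ∀ x ∈ U, gradient φ x ≠ 0) {x : E} (hx : x ∈ U) (v : E) :
    inner ℝ (fderiv ℝ (euclNormal φ) x v) (euclNormal φ x) = 0 := by
  have hd : HasFDerivAt (euclNormal φ) (fderiv ℝ (euclNormal φ) x) x :=
    (((contDiffOn_euclNormal hU hφ h0).contDiffAt (hU.mem_nhds hx)).differentiableAt
      (by simp)).hasFDerivAt
  have h1 := hd.inner ℝ hd
  have h2 : (fun y => inner ℝ (euclNormal φ y) (euclNormal φ y)) =ᶠ[𝓝 x] fun _ => (1 : ℝ) := by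
    filter_upwards [hU.mem_nhds hx] with y hy
    rw [real_inner_self_eq_norm_sq, norm_euclNormal (h0 y hy), one_pow]
  have h3 := congrArg (fun L => L v)
    (h1.unique ((hasFDerivAt_const (1 : ℝ) x).congr_of_eventuallyEq h2))
  simp [real_inner_comm] at h3
  rw [real_inner_comm]
  linarith

theorem inner_fderiv_gradient_comm (hU : IsOpen U) (hφ : ContDiffOn ℝ ∞ φ U) {x : E}
    (hx : x ∈ U) (a b : E) :
    inner ℝ (fderiv ℝ (gradient φ) x a) b = inner ℝ (fderiv ℝ (gradient φ) x b) a := by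
  have hat : ContDiffAt ℝ ∞ φ x := hφ.contDiffAt (hU.mem_nhds hx)
  have hd : DifferentiableAt ℝ (fderiv ℝ φ) x :=
    (((hφ.fderiv_of_isOpen (m := ∞) hU (by simp)).contDiffAt
      (hU.mem_nhds hx))).differentiableAt (by simp)
  have hg : HasFDerivAt (gradient φ) (fderiv ℝ (gradient φ) x) x :=
    (((contDiffOn_gradient hU hφ).contDiffAt (hU.mem_nhds hx)).differentiableAt
      (by simp)).hasFDerivAt
  have key : ∀ a b, inner ℝ (fderiv ℝ (gradient φ) x a) b = fderiv ℝ (fderiv ℝ φ) x a b := by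
    intro a b
    have h1 := hg.inner ℝ (hasFDerivAt_const b x)
    have h2 := hd.hasFDerivAt.clm_apply (hasFDerivAt_const b x)
    simp only [inner_gradient] at h1
    simpa using congrArg (fun L => L a) (h1.unique h2)
  rw [key, key]
  exact (hat.isSymmSndFDerivAt (by
    rw [minSmoothness_of_isRCLikeNormedField]; exact WithTop.coe_le_coe.2 le_top)).eq a b

/-- The normal is a gradient times a scalar, so DN is a symmetric map plus a rank-one map with image
along N. Against `z` orthogonal to N the asymmetry comes from the rank-one part alone, and ⟨DN z, N⟩
= 0 expresses that part through the symmetric one. -/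
theorem inner_fderiv_euclNormal_sub (hU : IsOpen U) (hφ : ContDiffOn ℝ ∞ φ U)
    (h0 : ∀ x ∈ U, gradient φ x ≠ 0) {x : E} (hx : x ∈ U) (e : E) {z : E}
    (hz : inner ℝ (euclNormal φ x) z = 0) :
    inner ℝ (fderiv ℝ (euclNormal φ) x e) z - inner ℝ (fderiv ℝ (euclNormal φ) x z) e =
      inner ℝ (euclNormal φ x) e *
        inner ℝ (fderiv ℝ (euclNormal φ) x (euclNormal φ x)) z := by
  have hg := contDiffOn_gradient hU hφ
  have hgd : HasFDerivAt (gradient φ) (fderiv ℝ (gradient φ) x) x :=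
    ((hg.contDiffAt (hU.mem_nhds hx)).differentiableAt (by simp)).hasFDerivAt
  have hcd : DifferentiableAt ℝ (fun y => ‖gradient φ y‖⁻¹) x :=
    (((hg.norm ℝ h0).inv fun x hx => norm_ne_zero_iff.2 (h0 x hx)).contDiffAt
      (hU.mem_nhds hx)).differentiableAt (by simp)
  have hN := hcd.hasFDerivAt.smul hgd
  have hN' : fderiv ℝ (euclNormal φ) x = _ := hN.fderiv
  set c' := fderiv ℝ (fun y => ‖gradient φ y‖⁻¹) x
  set G := fderiv ℝ (gradient φ) x
  have hself := inner_fderiv_euclNormal_self hU hφ h0 hx z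
  have hGs : ∀ a b, inner ℝ (G a) b = inner ℝ (G b) a := inner_fderiv_gradient_comm hU hφ hx
  have hgr := gradient_eq_smul_euclNormal φ x
  have h1 := norm_euclNormal (h0 x hx)
  have hn0 := norm_ne_zero_iff.2 (h0 x hx)
  set N := euclNormal φ x
  have hNN : inner ℝ N N = (1 : ℝ) := by rw [real_inner_self_eq_norm_sq, h1, one_pow]
  set k := ‖gradient φ x‖
  rw [hN'] at hself ⊢
  simp only [add_apply, smul_apply,
    ContinuousLinearMap.smulRight_apply, inner_add_left, real_inner_smul_left] at hself ⊢
  rw [hgr] at hself ⊢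
  simp only [real_inner_smul_left, hz, hNN] at hself ⊢
  rw [hGs e z, hGs N z]
  linear_combination (-(inner ℝ N e)) * hself

end Normal

/-! ### The divergence identity -/

section Divergence

open Module Set

variable {E : Type*} [NormedAddCommGroup E] [InnerProductSpace ℝ E] [FiniteDimensional ℝ E]

/-- The trace of a continuous linear map. -/
noncomputable def tr (L : E →L[ℝ] E) : ℝ := LinearMap.trace ℝ E L.toLinearMap

theorem tr_add (L M : E →L[ℝ] E) : tr (L + M) = tr L + tr M := by simp [tr]
theorem tr_sub (L M : E →L[ℝ] E) : tr (L - M) = tr L - tr M := by simp [tr]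
theorem tr_smul (c : ℝ) (L : E →L[ℝ] E) : tr (c • L) = c * tr L := by simp [tr]
theorem tr_id : tr (ContinuousLinearMap.id ℝ E) = finrank ℝ E := by simp [tr]
theorem tr_smulRight (l : E →L[ℝ] ℝ) (v : E) : tr (l.smulRight v) = l v :=
  LinearMap.trace_smulRight (l : E →ₗ[ℝ] ℝ) v

/-- The derivative of the field `χ (x - ⟨x, N⟩ N) / ⟨N, e⟩`. -/
theorem hasFDerivAt_tangentField {N : E → E} {χ : E → ℝ} {x e : E} {N' : E →L[ℝ] E}
    {χ' : E →L[ℝ] ℝ} (hN : HasFDerivAt N N' x) (hχ : HasFDerivAt χ χ' x)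
    (hq : inner ℝ (N x) e ≠ (0 : ℝ)) :
    HasFDerivAt (fun y => (inner ℝ (N y) e)⁻¹ • (χ y • (y - inner ℝ y (N y) • N y)))
      ((inner ℝ (N x) e)⁻¹ • (χ x • (ContinuousLinearMap.id ℝ E -
          (inner ℝ x (N x) • N' + ((innerSL ℝ (N x)) + (innerSL ℝ x).comp N').smulRight (N x)))
        + χ'.smulRight (x - inner ℝ x (N x) • N x))
        + ((-((inner ℝ (N x) e) ^ 2)⁻¹ : ℝ) • (innerSL ℝ e).comp N').smulRight
          (χ x • (x - inner ℝ x (N x) • N x))) x := by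
  have h1 : HasFDerivAt (fun y => inner ℝ y (N y))
      ((innerSL ℝ (N x)) + (innerSL ℝ x).comp N') x := by
    refine ((hasFDerivAt_id x).inner ℝ hN).congr_fderiv ?_
    ext v
    simp [real_inner_comm, add_comm]
  have h2 : HasFDerivAt (fun y => inner ℝ (N y) e) ((innerSL ℝ e).comp N') x := by
    refine (hN.inner ℝ (hasFDerivAt_const e x)).congr_fderiv ?_
    ext v
    simp [real_inner_comm]
  have h3 : HasFDerivAt (fun y => (inner ℝ (N y) e)⁻¹)
      ((-((inner ℝ (N x) e) ^ 2)⁻¹ : ℝ) • (innerSL ℝ e).comp N') x :=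
    (hasDerivAt_inv hq).comp_hasFDerivAt x h2
  exact h3.smul (hχ.smul ((hasFDerivAt_id x).sub (h1.smul hN)))

/-- The right-hand factor of the composite is the projection along `e` onto the tangent space. The
weight ⟨N,e⟩⁻¹ is the area density of a graph in direction `e`, so the trace must be that density
times the tangential divergence of χ xᵀ. The stray terms ⟨DN e, x⟩, ⟨DN z, e⟩ and ⟨DN N, x⟩ cancel
by `hsym`. -/
theorem tr_tangentField {N x e : E} {N' : E →L[ℝ] E} {χ : ℝ} {χ' : E →L[ℝ] ℝ}
    (hN : inner ℝ N N = (1 : ℝ)) (hq : inner ℝ N e ≠ (0 : ℝ))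
    (hself : ∀ v, inner ℝ (N' v) N = (0 : ℝ))
    (hsym : ∀ z, inner ℝ N z = (0 : ℝ) →
      inner ℝ (N' e) z - inner ℝ (N' z) e = inner ℝ N e * (inner ℝ (N' N) z : ℝ)) :
    tr (((inner ℝ N e)⁻¹ • (χ • (ContinuousLinearMap.id ℝ E -
          (inner ℝ x N • N' + ((innerSL ℝ N) + (innerSL ℝ x).comp N').smulRight N))
        + χ'.smulRight (x - inner ℝ x N • N))
        + ((-((inner ℝ N e) ^ 2)⁻¹ : ℝ) • (innerSL ℝ e).comp N').smulRight
          (χ • (x - inner ℝ x N • N))).comp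
        (ContinuousLinearMap.id ℝ E - (innerSL ℝ N).smulRight ((inner ℝ N e)⁻¹ • e))) =
      (inner ℝ N e)⁻¹ * (χ * (finrank ℝ E - 1 - inner ℝ x N * tr N') +
        χ' (x - inner ℝ x N • N)) := by
  set q : ℝ := inner ℝ N e with hqd
  set z := x - inner ℝ x N • N with hz
  have hNz : inner ℝ N z = (0 : ℝ) := by
    rw [hz, inner_sub_right, real_inner_smul_right, hN, mul_one, real_inner_comm, sub_self]
  have hs := hsym z hNz
  have hxz : ∀ v, inner ℝ (N' v) z = (inner ℝ (N' v) x : ℝ) := fun v => by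
    rw [hz, inner_sub_right, real_inner_smul_right, hself, mul_zero, sub_zero]
  set W := (q⁻¹ • (χ • (ContinuousLinearMap.id ℝ E -
          (inner ℝ x N • N' + ((innerSL ℝ N) + (innerSL ℝ x).comp N').smulRight N))
        + χ'.smulRight z)
        + ((-(q ^ 2)⁻¹ : ℝ) • (innerSL ℝ e).comp N').smulRight (χ • z)) with hW
  have hcomp : W.comp (ContinuousLinearMap.id ℝ E - (innerSL ℝ N).smulRight (q⁻¹ • e)) =
      W - (innerSL ℝ N).smulRight (q⁻¹ • W e) := by
    ext v
    simp
  rw [hcomp, tr_sub, tr_smulRight]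
  have hWe : (innerSL ℝ N) (q⁻¹ • W e) = - (q⁻¹ * (q⁻¹ * (χ * inner ℝ (N' e) x))) := by
    have hNe : inner ℝ N (N' e) = (0 : ℝ) := by rw [real_inner_comm]; exact hself e
    simp only [hW, innerSL_apply_apply, add_apply,
      smul_apply, sub_apply,
      ContinuousLinearMap.smulRight_apply, ContinuousLinearMap.comp_apply, inner_add_right,
      inner_sub_right, real_inner_smul_right, hNz, hN, hNe, ContinuousLinearMap.id_apply]
    rw [← hqd, real_inner_comm x]
    ring
  have htr : tr W = q⁻¹ * (χ * (finrank ℝ E - (inner ℝ x N * tr N' +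
      (1 + inner ℝ (N' N) x))) + χ' z) - (q ^ 2)⁻¹ * (χ * inner ℝ (N' z) e) := by
    simp only [hW, tr_add, tr_smul, tr_sub, tr_id, tr_smulRight, innerSL_apply_apply,
      add_apply, smul_apply, map_smul,
      ContinuousLinearMap.comp_apply, hN, smul_eq_mul]
    rw [real_inner_comm x (N' N), real_inner_comm e (N' z)]
    ring
  rw [hWe, htr]
  rw [hxz, hxz] at hs
  have h2 : inner ℝ (N' e) x = (inner ℝ (N' z) e : ℝ) + q * inner ℝ (N' N) x := by linarith
  rw [h2]
  field_simp
  ring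

variable {H : Type*} [NormedAddCommGroup H] [InnerProductSpace ℝ H] [FiniteDimensional ℝ H]
  [MeasurableSpace H] [BorelSpace H]

theorem integral_fderiv_eq_zero {f : H → ℝ} (hf : ContDiff ℝ 1 f) (hc : HasCompactSupport f)
    (v : H) : ∫ x, fderiv ℝ f x v = 0 := by
  have hfi : Integrable f := hf.continuous.integrable_of_hasCompactSupport hc
  have hfi' : Integrable fun x => fderiv ℝ f x v :=
    ((hf.continuous_fderiv (by simp)).clm_apply continuous_const).integrable_of_hasCompactSupport
      (hc.fderiv_apply ℝ v)
  have := integral_mul_fderiv_eq_neg_fderiv_mul_of_integrable (μ := (volume : Measure H))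
    (f := fun _ => (1 : ℝ)) (g := f) (v := v) (by simp) (by simpa using hfi') (by simpa using hfi)
    (fun x _ => differentiableAt_const _) (fun x _ => hf.differentiable (by simp) x)
  simpa using this

/-- The divergence theorem for a compactly supported field. -/
theorem integral_tr_fderiv_eq_zero {Y : H → H} (hY : ContDiff ℝ 1 Y) (hc : HasCompactSupport Y) :
    ∫ x, tr (fderiv ℝ Y x) = 0 := by
  set b := stdOrthonormalBasis ℝ H
  have hYd : Differentiable ℝ Y := hY.differentiable (by simp)
  have hfd : ∀ i x, fderiv ℝ (fun y => inner ℝ (b i) (Y y)) x (b i) =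
      inner ℝ (b i) (fderiv ℝ Y x (b i)) := fun i x => by
    have := ((innerSL ℝ (b i)).hasFDerivAt.comp x (hYd x).hasFDerivAt).fderiv
    change fderiv ℝ ((innerSL ℝ (b i)) ∘ Y) x (b i) = _
    rw [this]; rfl
  have hsm : ∀ i, ContDiff ℝ 1 fun y => inner ℝ (b i) (Y y) := fun i =>
    contDiff_const.inner ℝ hY
  have hcs : ∀ i, HasCompactSupport fun y => inner ℝ (b i) (Y y) := fun i =>
    hc.comp_left (g := fun v => inner ℝ (b i) v) (inner_zero_right _)
  have h1 : ∀ x, tr (fderiv ℝ Y x) =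
      ∑ i, fderiv ℝ (fun y => inner ℝ (b i) (Y y)) x (b i) := fun x => by
    rw [tr, LinearMap.trace_eq_sum_inner _ b]
    exact Finset.sum_congr rfl fun i _ => (hfd i x).symm
  simp_rw [h1]
  rw [integral_finsetSum]
  · exact Finset.sum_eq_zero fun i _ => integral_fderiv_eq_zero (hsm i) (hcs i) _
  · intro i _
    exact (((hsm i).continuous_fderiv (by simp)).clm_apply
      continuous_const).integrable_of_hasCompactSupport ((hcs i).fderiv_apply ℝ _)

end Divergence

/-! ### The first variation formula in a graph chart -/

section FirstVariation

open Module Set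

variable {E : Type*} [NormedAddCommGroup E] [InnerProductSpace ℝ E] [FiniteDimensional ℝ E]
  {H : Type*} [NormedAddCommGroup H] [InnerProductSpace ℝ H] [FiniteDimensional ℝ H]

/-- The Gram matrix is the identity plus a rank-one matrix; its determinant is given by the matrix
determinant lemma. -/
theorem normDet_sq_of_inner_eq {L : H →ₗ[ℝ] E} {a : H}
    (h : ∀ v w, inner ℝ (L v) (L w) = inner ℝ v w + inner ℝ a v * (inner ℝ a w : ℝ)) :
    L.normDet ^ 2 = 1 + ‖a‖ ^ 2 := by
  classical
  set b := stdOrthonormalBasis ℝ H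
  have h1 := L.normDet_sq_eq_det_gram b
  simp only [RCLike.ofReal_real_eq_id, id] at h1
  set u : Fin (finrank ℝ H) → ℝ := fun i => inner ℝ a (b i)
  have h2 : Matrix.gram ℝ (fun i => L (b i)) =
      1 + Matrix.replicateCol Unit u * Matrix.replicateRow Unit u := by
    ext i j
    simp only [Matrix.gram_apply, h, Matrix.add_apply, Matrix.one_apply,
      orthonormal_iff_ite.1 b.orthonormal i j, Matrix.mul_apply, Matrix.replicateCol_apply,
      Matrix.replicateRow_apply, Finset.univ_unique, Finset.sum_singleton, u]
  rw [h1, h2, Matrix.det_one_add_replicateCol_mul_replicateRow]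
  congr 1
  rw [← real_inner_self_eq_norm_sq, ← b.sum_inner_mul_inner]
  simp only [dotProduct, u]
  refine Finset.sum_congr rfl fun i _ => ?_
  rw [real_inner_comm a (b i)]

variable {φ : E → ℝ} {U V : Set E} {e : E} {D : Set (ℝ ∙ e)ᗮ} {X : (ℝ ∙ e)ᗮ → E}

theorem fderiv_graphChart (he : ‖e‖ = 1) (h : IsLevelChart (hyperProj e) φ V D X)
    {z : (ℝ ∙ e)ᗮ} (hz : z ∈ D) (h0 : gradient φ (X z) ≠ 0)
    (hq : inner ℝ (euclNormal φ (X z)) e ≠ (0 : ℝ)) (w : (ℝ ∙ e)ᗮ) :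
    fderiv ℝ X z w = w - (inner ℝ (euclNormal φ (X z)) (w : E) *
      (inner ℝ (euclNormal φ (X z)) e)⁻¹) • e := by
  set N := euclNormal φ (X z)
  set u := fderiv ℝ X z w with hu
  have h1 := h.fderiv_coord_apply hz w
  rw [(hyperProj e).fderiv] at h1
  have h2 : u - inner ℝ e u • e = w := by
    rw [← hyperProj_coe he, h1]
  have h3 : inner ℝ N u = (0 : ℝ) := by
    have := h.fderiv_fun_apply hz w
    rw [← inner_gradient, gradient_eq_smul_euclNormal, real_inner_smul_left] at this
    exact (mul_eq_zero.1 this).resolve_left (norm_ne_zero_iff.2 h0)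
  have h4 : inner ℝ N (w : E) = - (inner ℝ e u * inner ℝ N e : ℝ) := by
    rw [← h2, inner_sub_right, real_inner_smul_right, h3, zero_sub]
  rw [h4, ← h2, neg_mul, mul_assoc, mul_inv_cancel₀ hq, mul_one]
  module

theorem normDet_graphChart (he : ‖e‖ = 1) (h : IsLevelChart (hyperProj e) φ V D X)
    {z : (ℝ ∙ e)ᗮ} (hz : z ∈ D) (h0 : gradient φ (X z) ≠ 0)
    (hq : 0 < (inner ℝ (euclNormal φ (X z)) e : ℝ)) :
    (fderiv ℝ X z : (ℝ ∙ e)ᗮ →ₗ[ℝ] E).normDet = (inner ℝ (euclNormal φ (X z)) e)⁻¹ := by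
  have hN := norm_euclNormal h0
  have hf := fderiv_graphChart he h hz h0 hq.ne'
  set N := euclNormal φ (X z)
  set q : ℝ := inner ℝ N e with hqd
  have hort : ∀ w : (ℝ ∙ e)ᗮ, inner ℝ e (w : E) = (0 : ℝ) := fun w =>
    Submodule.mem_orthogonal_singleton_iff_inner_right.1 w.2
  have hee : inner ℝ e e = (1 : ℝ) := by rw [real_inner_self_eq_norm_sq, he, one_pow]
  have hNa : ∀ w : (ℝ ∙ e)ᗮ, inner ℝ (hyperProj e N) w = (inner ℝ N (w : E) : ℝ) := fun w => by
    rw [Submodule.coe_inner, hyperProj_coe he, inner_sub_left, real_inner_smul_left, hort,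
      mul_zero, sub_zero]
  have hnorm : ‖hyperProj e N‖ ^ 2 = 1 - q ^ 2 := by
    rw [← real_inner_self_eq_norm_sq, hNa, hyperProj_coe he, inner_sub_right,
      real_inner_smul_right, real_inner_self_eq_norm_sq, hN, real_inner_comm, ← hqd]
    ring
  have key := normDet_sq_of_inner_eq (L := (fderiv ℝ X z : (ℝ ∙ e)ᗮ →ₗ[ℝ] E))
    (a := q⁻¹ • hyperProj e N) (fun v w => by
      rw [real_inner_smul_left, real_inner_smul_left, hNa, hNa, Submodule.coe_inner]
      simp only [ContinuousLinearMap.coe_coe, hf, inner_sub_left, inner_sub_right,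
        real_inner_smul_left, real_inner_smul_right, hee, hort, real_inner_comm e (v : E)]
      ring)
  rw [norm_smul, mul_pow, hnorm] at key
  have h5 : (fderiv ℝ X z : (ℝ ∙ e)ᗮ →ₗ[ℝ] E).normDet ^ 2 = (q⁻¹) ^ 2 := by
    rw [key, Real.norm_eq_abs, sq_abs]
    field_simp
    ring
  exact (sq_eq_sq₀ (LinearMap.normDet_nonneg _) (inv_nonneg.2 hq.le)).1 h5

/-- The first variation of area, for the field `χ x`, of the level sets of `φ`. -/
noncomputable def variationIntegrand (φ χ : E → ℝ) (x : E) : ℝ :=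
  χ x * (finrank ℝ E - 1 - inner ℝ x (euclNormal φ x) * tr (fderiv ℝ (euclNormal φ) x)) +
    fderiv ℝ χ x (x - inner ℝ x (euclNormal φ x) • euclNormal φ x)

theorem continuous_tr : Continuous (tr : (E →L[ℝ] E) → ℝ) :=
  LinearMap.continuous_of_finiteDimensional
    ((LinearMap.trace ℝ E) ∘ₗ (ContinuousLinearMap.coeLM ℝ : (E →L[ℝ] E) →ₗ[ℝ] E →ₗ[ℝ] E))

/-- The tangential field with divergence `variationIntegrand φ χ / ⟨N, e⟩` in a graph chart. -/
noncomputable def tangentField (φ χ : E → ℝ) (e y : E) : E :=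
  (inner ℝ (euclNormal φ y) e)⁻¹ • (χ y • (y - inner ℝ y (euclNormal φ y) • euclNormal φ y))

/-- This is √g div(Z) = ∂ᵢ(√g Zⁱ) for the tangential field Z = χ xᵀ in a graph chart, where √g =
⟨N,e⟩⁻¹. Cyclicity of the trace moves the projection to the right of DX, where the two compose to
the projection along `e` onto the tangent space. -/
theorem tr_fderiv_tangentField (he : ‖e‖ = 1) (h : IsLevelChart (hyperProj e) φ V D X)
    (hU : IsOpen U) (hφ : ContDiffOn ℝ ∞ φ U) (h0 : ∀ x ∈ U, gradient φ x ≠ 0)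
    {χ : E → ℝ} (hχ : Differentiable ℝ χ) {z : (ℝ ∙ e)ᗮ} (hz : z ∈ D) (hxU : X z ∈ U)
    (hqx : 0 < (inner ℝ (euclNormal φ (X z)) e : ℝ)) :
    tr (fderiv ℝ (fun z => hyperProj e (tangentField φ χ e (X z))) z) =
      (fderiv ℝ X z : (ℝ ∙ e)ᗮ →ₗ[ℝ] E).normDet * variationIntegrand φ χ (X z) := by
  have hNd : HasFDerivAt (euclNormal φ) (fderiv ℝ (euclNormal φ) (X z)) (X z) :=
    (((contDiffOn_euclNormal hU hφ h0).contDiffAt (hU.mem_nhds hxU)).differentiableAt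
      (by simp)).hasFDerivAt
  have hWd : HasFDerivAt (tangentField φ χ e) _ (X z) :=
    hasFDerivAt_tangentField hNd (hχ _).hasFDerivAt hqx.ne'
  have hYfd : fderiv ℝ (fun z => hyperProj e (tangentField φ χ e (X z))) z =
      ((hyperProj e).comp (fderiv ℝ (tangentField φ χ e) (X z))).comp (fderiv ℝ X z) := by
    rw [hWd.fderiv]
    exact (((hyperProj e).hasFDerivAt.comp _ hWd).comp z (h.hasFDerivAt z hz)).fderiv
  have hA : (fderiv ℝ X z).comp (hyperProj e) = ContinuousLinearMap.id ℝ E -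
      (innerSL ℝ (euclNormal φ (X z))).smulRight ((inner ℝ (euclNormal φ (X z)) e)⁻¹ • e) := by
    ext v
    rw [ContinuousLinearMap.comp_apply, fderiv_graphChart he h hz (h0 _ hxU) hqx.ne',
      hyperProj_coe he]
    simp only [sub_apply, ContinuousLinearMap.id_apply, ContinuousLinearMap.smulRight_apply,
      innerSL_apply_apply, inner_sub_right, real_inner_smul_right]
    rw [sub_mul, mul_assoc, mul_inv_cancel₀ hqx.ne', mul_one, smul_smul]
    module
  have htr : tr (fderiv ℝ (fun z => hyperProj e (tangentField φ χ e (X z))) z) =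
      tr ((fderiv ℝ (tangentField φ χ e) (X z)).comp ((fderiv ℝ X z).comp (hyperProj e))) := by
    rw [hYfd]
    exact LinearMap.trace_comp_comm'
      ((fderiv ℝ (tangentField φ χ e) (X z)).comp (fderiv ℝ X z)).toLinearMap
      (hyperProj e).toLinearMap
  have hNN : inner ℝ (euclNormal φ (X z)) (euclNormal φ (X z)) = (1 : ℝ) := by
    rw [real_inner_self_eq_norm_sq, norm_euclNormal (h0 _ hxU), one_pow]
  rw [htr, hA, hWd.fderiv, tr_tangentField hNN hqx.ne'
    (inner_fderiv_euclNormal_self hU hφ h0 hxU)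
    (fun z hz => inner_fderiv_euclNormal_sub hU hφ h0 hxU e hz),
    normDet_graphChart he h hz (h0 _ hxU) hqx]
  rfl

-- Near `p` the level set is a graph in the direction of its normal at `p`, and there the first
-- variation integral becomes the integral over a hyperplane of the divergence of a compactly
-- supported field.
set_option maxHeartbeats 1000000 in
theorem exists_local_first_variation [MeasurableSpace E] [BorelSpace E] (hU : IsOpen U)
    (hφ : ContDiffOn ℝ ∞ φ U) (h0 : ∀ x ∈ U, gradient φ x ≠ 0) {p : E} (hp : p ∈ U) :
    ∃ V, IsOpen V ∧ p ∈ V ∧ V ⊆ U ∧ ∀ χ : E → ℝ, ContDiff ℝ 1 χ → HasCompactSupport χ →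
      tsupport χ ⊆ V →
      IntegrableOn (variationIntegrand φ χ) {x ∈ V | φ x = 0} μHE[finrank ℝ E - 1] ∧
      ∫ x in {x ∈ V | φ x = 0}, variationIntegrand φ χ x ∂μHE[finrank ℝ E - 1] = 0 := by
  set N := euclNormal φ with hNdef
  set e := N p with he'
  have he : ‖e‖ = 1 := norm_euclNormal (h0 p hp)
  have hNs := contDiffOn_euclNormal hU hφ h0
  have hqc : ContinuousOn (fun x => (inner ℝ (N x) e : ℝ)) U :=
    hNs.continuousOn.inner continuousOn_const
  set U' := U ∩ (fun x => (inner ℝ (N x) e : ℝ)) ⁻¹' Ioi 0 with hU'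
  have hU'o : IsOpen U' := hqc.isOpen_inter_preimage hU isOpen_Ioi
  have hpU' : p ∈ U' := ⟨hp, by
    change (0 : ℝ) < inner ℝ (N p) e
    rw [← he', real_inner_self_eq_norm_sq, he]; norm_num⟩
  have hne : fderiv ℝ φ p e ≠ 0 := by
    rw [← inner_gradient, gradient_eq_smul_euclNormal, real_inner_smul_left]
    exact mul_ne_zero (norm_ne_zero_iff.2 (h0 p hp)) (ne_of_gt hpU'.2)
  obtain ⟨V, D, X, hpV, hVU', h⟩ := exists_graphChart hU'o hpU' (hφ.mono inter_subset_left) he hne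
  have hVU : V ⊆ U := hVU'.trans inter_subset_left
  have hq : ∀ x ∈ V, (0 : ℝ) < inner ℝ (N x) e := fun x hx => (hVU' hx).2
  refine ⟨V, h.isOpen_source, hpV, hVU, fun χ hχ hχc hχV => ?_⟩
  set W : E → E := tangentField φ χ e with hW
  set Y : (ℝ ∙ e)ᗮ → (ℝ ∙ e)ᗮ := D.indicator fun z => hyperProj e (W (X z)) with hY
  have hN1 : ContDiffOn ℝ 1 N V := (hNs.mono hVU).of_le (by simp)
  have hWs : ContDiffOn ℝ 1 W V := by
    refine ((hN1.inner ℝ contDiffOn_const).inv fun x hx => (hq x hx).ne').smul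
      (hχ.contDiffOn.smul (contDiffOn_id.sub ((contDiffOn_id.inner ℝ hN1).smul hN1)))
  have hYs : ContDiffOn ℝ 1 (fun z => hyperProj e (W (X z))) D :=
    (hyperProj e).contDiff.comp_contDiffOn
      (hWs.comp (h.contDiffOn.of_le (by simp)) h.map_mem)
  have hYeq : ∀ z ∈ D, Y =ᶠ[𝓝 z] fun z => hyperProj e (W (X z)) := fun z hz => by
    filter_upwards [h.isOpen_target.mem_nhds hz] with y hy
    rw [hY, indicator_of_mem hy]
  -- The part of the level set in the support of `χ` is compact inside `V`, so its projection is
  -- compact inside `D`; this makes the extension of the field by zero outside `D` a C¹ field.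
  set K := hyperProj e '' (tsupport χ ∩ φ ⁻¹' {0}) with hK
  have hKc : IsCompact K := by
    refine IsCompact.image ?_ (hyperProj e).continuous
    exact hχc.of_isClosed_subset ((h.contDiffOn_fun.continuousOn.mono
      hχV).preimage_isClosed_of_isClosed (isClosed_tsupport χ) isClosed_singleton)
      inter_subset_left
  have hKD : K ⊆ D := by
    rintro _ ⟨x, ⟨hx, hx0⟩, rfl⟩
    exact h.coord_mem x (hχV hx) hx0
  have hYK : ∀ z ∉ K, Y z = 0 := by
    intro z hz
    by_cases hzD : z ∈ D
    · rw [hY, indicator_of_mem hzD]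
      have : X z ∉ tsupport χ := fun hmem =>
        hz ⟨X z, ⟨hmem, h.fun_apply z hzD⟩, h.coord_apply z hzD⟩
      simp [hW, tangentField, image_eq_zero_of_notMem_tsupport this]
    · rw [hY, indicator_of_notMem hzD]
  have hYc : HasCompactSupport Y := HasCompactSupport.intro hKc hYK
  have hYd : ContDiff ℝ 1 Y := by
    rw [contDiff_iff_contDiffAt]
    intro z
    by_cases hz : z ∈ D
    · exact (hYs.contDiffAt (h.isOpen_target.mem_nhds hz)).congr_of_eventuallyEq (hYeq z hz)
    · have : Y =ᶠ[𝓝 z] fun _ => 0 := by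
        filter_upwards [hKc.isClosed.isOpen_compl.mem_nhds fun hzK => hz (hKD hzK)] with y hy
        exact hYK y hy
      exact contDiffAt_const.congr_of_eventuallyEq this
  have key : ∀ z ∈ D, (fderiv ℝ X z : (ℝ ∙ e)ᗮ →ₗ[ℝ] E).normDet * variationIntegrand φ χ (X z) =
      tr (fderiv ℝ Y z) := by
    intro z hz
    have hxV := h.map_mem z hz
    rw [(hYeq z hz).fderiv_eq]
    exact (tr_fderiv_tangentField he h hU hφ h0 (hχ.differentiable (by simp)) hz (hVU hxV)
      (hq _ hxV)).symm
  have hfr : finrank ℝ E - 1 = finrank ℝ (ℝ ∙ e)ᗮ := by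
    have := finrank_hyperplane he
    omega
  have htrc : Continuous fun z => tr (fderiv ℝ Y z) :=
    continuous_tr.comp (hYd.continuous_fderiv (by simp))
  have htri : Integrable fun z => tr (fderiv ℝ Y z) :=
    htrc.integrable_of_hasCompactSupport ((hYc.fderiv ℝ).comp_left (g := fun L : (ℝ ∙ e)ᗮ →L[ℝ] (ℝ ∙ e)ᗮ => tr L) (by simp [tr]))
  rw [hfr, ← h.image_eq]
  constructor
  · rw [integrableOn_image_iff_normDet h.isOpen_target h.hasFDerivAt h.continuousOn_fderiv
      h.injective_fderiv h.injOn subset_rfl h.isOpen_target.measurableSet]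
    exact htri.integrableOn.congr_fun (fun z hz => (key z hz).symm)
      h.isOpen_target.measurableSet
  · rw [integral_image_eq_normDet h.isOpen_target h.hasFDerivAt h.continuousOn_fderiv
      h.injective_fderiv h.injOn subset_rfl h.isOpen_target.measurableSet,
      setIntegral_congr_fun h.isOpen_target.measurableSet key]
    rw [setIntegral_eq_integral_of_forall_compl_eq_zero, integral_tr_fderiv_eq_zero hYd hYc]
    intro z hz
    have : fderiv ℝ Y z = 0 := by
      have : Y =ᶠ[𝓝 z] fun _ => 0 := by
        filter_upwards [hKc.isClosed.isOpen_compl.mem_nhds fun hzK => hz (hKD hzK)] with y hy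
        exact hYK y hy
      rw [this.fderiv_eq]; simp
    rw [this]; simp [tr]

end FirstVariation

/-! ### The conformal factor -/

section ConfFactor

variable {n : ℕ} {m : ℝ}

/-- The conformal factor as a function of the radius. -/
noncomputable def radialFactor (n : ℕ) (m r : ℝ) : ℝ := (1 + m / (2 * r ^ (n - 2))) ^ (2 / ((n : ℝ) - 2))

theorem confFactor_eq (x : Eucl n) : confFactor n m x = radialFactor n m ‖x‖ := rfl

/-- The function `-r F'(r) / F(r)`, where `F` is the conformal factor. -/
noncomputable def decayRate (n : ℕ) (m r : ℝ) : ℝ := 2 * m / (2 * r ^ (n - 2) + m)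

theorem radialFactor_pos (hm : 0 < m) {r : ℝ} (hr : 0 < r) : 0 < radialFactor n m r :=
  Real.rpow_pos_of_pos (by positivity) _

theorem hasDerivAt_radialFactor (hn : 3 ≤ n) (hm : 0 < m) {r : ℝ} (hr : 0 < r) :
    HasDerivAt (radialFactor n m) (-(radialFactor n m r * decayRate n m r / r)) r := by
  obtain ⟨k, rfl⟩ : ∃ k, n = k + 3 := ⟨n - 3, by omega⟩
  have hb : 0 < 1 + m / (2 * r ^ (k + 1)) := by positivity
  have h1 : HasDerivAt (fun r : ℝ => 1 + m / (2 * r ^ (k + 1)))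
      (-(m * (2 * ((k + 1 : ℕ) * r ^ k)) / (2 * r ^ (k + 1)) ^ 2)) r := by
    have := ((hasDerivAt_const r m).div (((hasDerivAt_pow (k + 1) r).const_mul 2))
      (by positivity)).const_add 1
    refine this.congr_deriv ?_
    rw [Nat.add_sub_cancel]
    ring
  have h2 := h1.rpow_const (p := 2 / (((k + 3 : ℕ) : ℝ) - 2)) (Or.inl hb.ne')
  refine HasDerivAt.congr_deriv h2 ?_
  have hk : ((k + 3 : ℕ) : ℝ) - 2 = k + 1 := by push_cast; ring
  simp only [radialFactor, decayRate, show k + 3 - 2 = k + 1 by omega, hk]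
  rw [Real.rpow_sub_one hb.ne']
  have hk1 : ((k : ℝ) + 1) ≠ 0 := by positivity
  have hb2 : 2 * r ^ (k + 1) + m ≠ 0 := by positivity
  set A := (1 + m / (2 * r ^ (k + 1))) ^ (2 / ((k : ℝ) + 1))
  push_cast
  field_simp
  ring

theorem horizonRadius_pos (hm : 0 < m) : 0 < horizonRadius n m :=
  Real.rpow_pos_of_pos (by positivity) _

theorem horizonRadius_pow (hn : 3 ≤ n) (hm : 0 < m) : horizonRadius n m ^ (n - 2) = m / 2 := by
  have h2 : ((n - 2 : ℕ) : ℝ) = (n : ℝ) - 2 := by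
    rw [Nat.cast_sub (by omega)]; norm_num
  have h3 : (n : ℝ) - 2 ≠ 0 := by
    rw [← h2]; exact_mod_cast (by omega : n - 2 ≠ 0)
  rw [horizonRadius, ← Real.rpow_natCast, ← Real.rpow_mul (by positivity), h2,
    one_div_mul_cancel h3, Real.rpow_one]

/-- The rate equals 1 exactly when r^(n-2) = m/2, that is on the horizon. The strict inequality
beyond it is what makes the equality case rigid. -/
theorem decayRate_lt_one (hn : 3 ≤ n) (hm : 0 < m) {r : ℝ} (hr : horizonRadius n m < r) :
    decayRate n m r < 1 := by
  have h0 : 0 < r := (horizonRadius_pos hm).trans hr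
  have h1 : m / 2 < r ^ (n - 2) := by
    rw [← horizonRadius_pow hn hm]
    exact pow_lt_pow_left₀ hr (horizonRadius_pos hm).le (by omega)
  rw [decayRate, div_lt_one (by positivity)]
  linarith

theorem hasFDerivAt_norm_comp {E : Type*} [NormedAddCommGroup E] [InnerProductSpace ℝ E]
    {b : ℝ → ℝ} {b' : ℝ} {x : E} (hx : x ≠ 0)
    (hb : HasDerivAt b b' ‖x‖) :
    HasFDerivAt (fun y : E => b ‖y‖) ((b' / ‖x‖) • innerSL ℝ x) x := by
  have h := hb.comp_hasFDerivAt x ((differentiableAt_id.norm ℝ hx).hasFDerivAt)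
  refine h.congr_fderiv ?_
  ext v
  have h2 : HasFDerivAt (fun y : E => √(‖y‖ ^ 2)) ((1 / (2 * √(‖x‖ ^ 2))) • (2 • innerSL ℝ x)) x :=
    (hasStrictFDerivAt_norm_sq x).hasFDerivAt.sqrt (by positivity)
  simp only [Real.sqrt_sq (norm_nonneg _)] at h2
  simp only [id, h2.fderiv, smul_apply, innerSL_apply_apply, smul_eq_mul, nsmul_eq_mul]
  have : ‖x‖ ≠ 0 := norm_ne_zero_iff.2 hx
  push_cast
  field_simp

theorem hasFDerivAt_confFactor (hn : 3 ≤ n) (hm : 0 < m) {x : Eucl n} (hx : x ≠ 0) :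
    HasFDerivAt (confFactor n m)
      ((-(radialFactor n m ‖x‖ * decayRate n m ‖x‖ / ‖x‖) / ‖x‖) • innerSL ℝ x) x :=
  hasFDerivAt_norm_comp hx (hasDerivAt_radialFactor hn hm (norm_pos_iff.2 hx))

/-- Conformal change of the mean curvature: for g = f²δ one has f H_g = H + (n-1) d(log f)(N), and
here d(log f)(N) = -h ⟨x,N⟩ / r². -/
theorem tr_fderiv_euclNormal (hn : 3 ≤ n) (hm : 0 < m) {φ : Eucl n → ℝ} {U : Set (Eucl n)}
    (hU : IsOpen U) (hφ : ContDiffOn ℝ ∞ φ U) (h0 : ∀ x ∈ U, gradient φ x ≠ 0) {x : Eucl n}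
    (hxU : x ∈ U) (hx : x ≠ 0) (hH : meanCurvature n m φ x = 0) :
    tr (fderiv ℝ (euclNormal φ) x) =
      ((n : ℝ) - 1) * (decayRate n m ‖x‖ * inner ℝ x (euclNormal φ x) / ‖x‖ ^ 2) := by
  have hf := hasFDerivAt_confFactor hn hm hx
  have hfp : 0 < confFactor n m x := radialFactor_pos hm (norm_pos_iff.2 hx)
  have hN : HasFDerivAt (euclNormal φ) (fderiv ℝ (euclNormal φ) x) x :=
    (((contDiffOn_euclNormal hU hφ h0).contDiffAt (hU.mem_nhds hxU)).differentiableAt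
      (by simp)).hasFDerivAt
  have hu : unitNormal n m φ = (fun y => (confFactor n m y)⁻¹) • euclNormal φ := by
    ext1 y
    rw [Pi.smul_apply', unitNormal, euclNormal, smul_smul, mul_inv]
  have hinv : HasFDerivAt (fun y => (confFactor n m y)⁻¹) ((-(confFactor n m x ^ 2)⁻¹ : ℝ) •
      ((-(radialFactor n m ‖x‖ * decayRate n m ‖x‖ / ‖x‖) / ‖x‖) • innerSL ℝ x)) x :=
    (hasDerivAt_inv hfp.ne').comp_hasFDerivAt x hf
  have hY := hinv.smul hN
  rw [← hu] at hY
  have hx0 : ‖x‖ ≠ 0 := norm_ne_zero_iff.2 hx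
  change tr (covDeriv n m (unitNormal n m φ) x) = 0 at hH
  rw [covDeriv, hY.fderiv] at hH
  simp only [tr_add, tr_smul, tr_sub, tr_smulRight, tr_id, innerSL_apply_apply,
    finrank_euclideanSpace, Fintype.card_fin] at hH
  rw [real_inner_comm, inner_gradient, hf.fderiv] at hH
  simp only [hu, Pi.smul_apply', confFactor_eq, smul_apply, smul_eq_mul, innerSL_apply_apply,
    map_smul] at hH
  rw [confFactor_eq] at hfp
  set F := radialFactor n m ‖x‖
  set t := tr (fderiv ℝ (euclNormal φ) x)
  set s : ℝ := inner ℝ x (euclNormal φ x)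
  field_simp at hH ⊢
  linarith

end ConfFactor

/-! ### Global first variation -/

section Global

open Set

variable {n : ℕ} {m : ℝ} {S : Set (Eucl n)}

/-- `φ` is a local defining function, on the open set `U`, of the free boundary minimal
hypersurface `S`. -/
structure IsLocalEquation (n : ℕ) (m : ℝ) (S U : Set (Eucl n)) (φ : Eucl n → ℝ) : Prop where
  isOpen : IsOpen U
  contDiffOn : ContDiffOn ℝ ∞ φ U
  gradient_ne : ∀ x ∈ U, gradient φ x ≠ 0
  inter_eq : S ∩ U = {x ∈ U | x ∈ space n m ∧ φ x = 0}
  meanCurvature_eq : ∀ x ∈ S ∩ U, meanCurvature n m φ x = 0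
  orthogonal : ∀ x ∈ S ∩ U ∩ horizon n m, inner ℝ (gradient φ x) x = 0

theorem IsFreeBoundaryMinimal.exists_localEquation (hS : IsFreeBoundaryMinimal n m S)
    {p : Eucl n} (hp : p ∈ S) : ∃ U φ, p ∈ U ∧ IsLocalEquation n m S U φ := by
  obtain ⟨U, φ, h1, h2, h3, h4, h5, h6, h7⟩ := hS.locally_minimal p hp
  exact ⟨U, φ, h2, h1, h3, h4, h5, h6, h7⟩

/-- The part of the Schwarzschild space off the horizon. -/
def exterior (n : ℕ) (m : ℝ) : Set (Eucl n) := {x | horizonRadius n m < ‖x‖}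

theorem isOpen_exterior : IsOpen (exterior n m) := isOpen_lt continuous_const continuous_norm

theorem exterior_ne_zero (hm : 0 < m) {x : Eucl n} (hx : x ∈ exterior n m) : x ≠ 0 :=
  norm_pos_iff.1 ((horizonRadius_pos hm).trans hx)

namespace IsLocalEquation

variable {U U' : Set (Eucl n)} {φ φ' : Eucl n → ℝ}

theorem mem_iff (h : IsLocalEquation n m S U φ) {x : Eucl n} (hx : x ∈ U)
    (hx' : x ∈ space n m) : x ∈ S ↔ φ x = 0 := by
  have := Set.ext_iff.1 h.inter_eq x
  simp only [mem_inter_iff, hx, and_true, mem_ofPred_eq, hx', true_and] at this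
  exact this

/-- Off the horizon `S` fills the zero set of `φ`, so `φ'` vanishes along a chart of that set and
both normals are orthogonal to the same hyperplane. The equations describe `S` only inside M, which
is why the point is taken in the exterior. -/
theorem euclNormal_parallel (h : IsLocalEquation n m S U φ) (h' : IsLocalEquation n m S U' φ')
    {x : Eucl n} (hxS : x ∈ S) (hxU : x ∈ U) (hxU' : x ∈ U') (hx : x ∈ exterior n m) :
    ∃ c : ℝ, c ^ 2 = 1 ∧ euclNormal φ' x = c • euclNormal φ x := by
  set e := euclNormal φ x with he'
  have he : ‖e‖ = 1 := norm_euclNormal (h.gradient_ne x hxU)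
  have hee : inner ℝ e e = (1 : ℝ) := by rw [real_inner_self_eq_norm_sq, he, one_pow]
  have hne : fderiv ℝ φ x e ≠ 0 := by
    rw [← inner_gradient, gradient_eq_smul_euclNormal, real_inner_smul_left, ← he', hee, mul_one]
    exact norm_ne_zero_iff.2 (h.gradient_ne x hxU)
  have hO : IsOpen (U ∩ (U' ∩ exterior n m)) := h.isOpen.inter (h'.isOpen.inter isOpen_exterior)
  obtain ⟨V, D, X, hxV, hVO, hc⟩ := exists_graphChart hO ⟨hxU, hxU', hx⟩
    (h.contDiffOn.mono inter_subset_left) he hne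
  have hφx : φ x = 0 := (h.mem_iff hxU (le_of_lt (show horizonRadius n m < ‖x‖ from hx))).1 hxS
  have hz := hc.coord_mem x hxV hφx
  have hXz := hc.apply_coord x hxV hφx
  set z := hyperProj e x
  have hzero : ∀ y ∈ D, φ' (X y) = 0 := fun y hy => by
    have hm := hVO (hc.map_mem y hy)
    have hs : X y ∈ space n m := le_of_lt (show horizonRadius n m < ‖X y‖ from hm.2.2)
    exact (h'.mem_iff hm.2.1 hs).1 ((h.mem_iff hm.1 hs).2 (hc.fun_apply y hy))
  have hd' : HasFDerivAt φ' (fderiv ℝ φ' x) (X z) := by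
    rw [hXz]
    exact ((h'.contDiffOn.contDiffAt (h'.isOpen.mem_nhds hxU')).differentiableAt
      (by simp)).hasFDerivAt
  have horth : ∀ w, fderiv ℝ φ' x (fderiv ℝ X z w) = 0 := by
    intro w
    have h1 := hd'.comp z (hc.hasFDerivAt z hz)
    have h2 : φ' ∘ X =ᶠ[𝓝 z] fun _ => 0 := by
      filter_upwards [hc.isOpen_target.mem_nhds hz] with y hy using hzero y hy
    simpa using congrArg (fun L => L w)
      (h1.unique ((hasFDerivAt_const (0 : ℝ) z).congr_of_eventuallyEq h2))
  have hw : ∀ w : (ℝ ∙ e)ᗮ, fderiv ℝ X z w = w := by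
    intro w
    have hew : inner ℝ e (w : Eucl n) = (0 : ℝ) :=
      Submodule.mem_orthogonal_singleton_iff_inner_right.1 w.2
    have := fderiv_graphChart he hc hz (by rw [hXz]; exact h.gradient_ne x hxU)
      (by rw [hXz, ← he', hee]; exact one_ne_zero) w
    rw [hXz, ← he', hew, zero_mul, zero_smul, sub_zero] at this
    exact this
  set v := euclNormal φ' x
  have hv : ‖v‖ = 1 := norm_euclNormal (h'.gradient_ne x hxU')
  have hvw : ∀ w : (ℝ ∙ e)ᗮ, inner ℝ v (w : Eucl n) = (0 : ℝ) := fun w => by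
    have := horth w
    rw [hw, ← inner_gradient, gradient_eq_smul_euclNormal, real_inner_smul_left] at this
    exact (mul_eq_zero.1 this).resolve_left (norm_ne_zero_iff.2 (h'.gradient_ne x hxU'))
  have h3 := hvw (hyperProj e v)
  rw [hyperProj_coe he, inner_sub_right, real_inner_smul_right, real_inner_self_eq_norm_sq, hv]
    at h3
  have hs : inner ℝ v e = (inner ℝ e v : ℝ) := real_inner_comm _ _
  have hc2 : (inner ℝ e v : ℝ) ^ 2 = 1 := by rw [hs] at h3; linarith
  refine ⟨inner ℝ e v, hc2, ?_⟩
  have h4 : ‖v - (inner ℝ e v : ℝ) • e‖ ^ 2 = 0 := by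
    rw [norm_sub_sq_real, real_inner_smul_right, hs, norm_smul, hv, he, Real.norm_eq_abs, mul_one,
      sq_abs]
    linarith
  exact sub_eq_zero.1 (norm_eq_zero.1 (pow_eq_zero_iff two_ne_zero |>.1 h4))

end IsLocalEquation

open Classical in
/-- A Euclidean unit normal vector of the hypersurface `S` at `x`. -/
noncomputable def normalAt (n : ℕ) (m : ℝ) (S : Set (Eucl n)) (x : Eucl n) : Eucl n :=
  if h : ∃ U φ, x ∈ U ∧ IsLocalEquation n m S U φ then euclNormal h.choose_spec.choose x else 0

/-- The normal is selected by choice and known only up to sign. The integrands built from it are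
quadratic in the normal, so the sign drops out. -/
theorem IsLocalEquation.normalAt_eq {U : Set (Eucl n)} {φ : Eucl n → ℝ}
    (h : IsLocalEquation n m S U φ) {x : Eucl n} (hxS : x ∈ S) (hxU : x ∈ U)
    (hx : x ∈ exterior n m) :
    ∃ c : ℝ, c ^ 2 = 1 ∧ normalAt n m S x = c • euclNormal φ x := by
  have hex : ∃ U φ, x ∈ U ∧ IsLocalEquation n m S U φ := ⟨U, φ, hxU, h⟩
  rw [normalAt, dif_pos hex]
  exact h.euclNormal_parallel hex.choose_spec.choose_spec.2 hxS hxU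
    hex.choose_spec.choose_spec.1 hx

/-- The integrand of the first variation of the Schwarzschild area of `S` for the field
`χ x / F ^ (n - 1)`. -/
noncomputable def globalIntegrand (n : ℕ) (m : ℝ) (S : Set (Eucl n)) (χ : Eucl n → ℝ)
    (x : Eucl n) : ℝ :=
  χ x * (((n : ℝ) - 1) * (1 - decayRate n m ‖x‖ * inner ℝ x (normalAt n m S x) ^ 2 / ‖x‖ ^ 2)) +
    fderiv ℝ χ x (x - inner ℝ x (normalAt n m S x) • normalAt n m S x)

theorem IsLocalEquation.globalIntegrand_eq (hn : 3 ≤ n) (hm : 0 < m) {U : Set (Eucl n)}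
    {φ : Eucl n → ℝ} (h : IsLocalEquation n m S U φ) {x : Eucl n} (hxS : x ∈ S) (hxU : x ∈ U)
    (hx : x ∈ exterior n m) (χ : Eucl n → ℝ) :
    globalIntegrand n m S χ x = variationIntegrand φ χ x := by
  obtain ⟨c, hc, hN⟩ := h.normalAt_eq hxS hxU hx
  rw [globalIntegrand, variationIntegrand, hN, tr_fderiv_euclNormal hn hm h.isOpen h.contDiffOn
    h.gradient_ne hxU (exterior_ne_zero hm hx) (h.meanCurvature_eq x ⟨hxS, hxU⟩),
    real_inner_smul_right, finrank_euclideanSpace, Fintype.card_fin]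
  congr 1
  · rw [mul_pow, hc]; ring
  · rw [smul_smul, show c * inner ℝ x (euclNormal φ x) * c = c ^ 2 * inner ℝ x (euclNormal φ x) by
      ring, hc, one_mul]

/-- Localizing the first variation only needs the sum to be one on `K`; reassembling the lower
bounds at the horizon also needs the bound by one everywhere. -/
theorem exists_finite_smooth_partition {E : Type*} [NormedAddCommGroup E] [InnerProductSpace ℝ E]
    [FiniteDimensional ℝ E] {K : Set E} (hK : IsCompact K) {V : E → Set E}
    (hV : ∀ x ∈ K, IsOpen (V x)) (hxV : ∀ x ∈ K, x ∈ V x) :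
    ∃ (t : Finset E) (ρ : E → E → ℝ), (∀ i ∈ t, i ∈ K ∧ ContDiff ℝ ∞ (ρ i) ∧
      tsupport (ρ i) ⊆ V i ∧ ∀ x, 0 ≤ ρ i x) ∧ (∀ x ∈ K, ∑ i ∈ t, ρ i x = 1) ∧
      ∀ x, ∑ i ∈ t, ρ i x ≤ 1 := by
  classical
  obtain ⟨t, htK, htc⟩ := hK.elim_nhds_subcover V (fun x hx => (hV x hx).mem_nhds (hxV x hx))
  obtain ⟨f, hf⟩ := SmoothPartitionOfUnity.exists_isSubordinate (modelWithCornersSelf ℝ E)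
    hK.isClosed (fun i : t => V (i : E)) (fun i => hV _ (htK i i.2)) (by
      intro x hx
      obtain ⟨i, hi, hxi⟩ := mem_iUnion₂.1 (htc hx)
      exact mem_iUnion.2 ⟨⟨i, hi⟩, hxi⟩)
  set ρ : E → E → ℝ := fun i x => if h : i ∈ t then f ⟨i, h⟩ x else 0 with hρ
  have hi : ∀ i (h : i ∈ t), ρ i = f ⟨i, h⟩ := fun i h => by ext x; simp [hρ, h]
  have hsum : ∀ x, ∑ i ∈ t, ρ i x = ∑ᶠ i, f i x := fun x => by
    rw [finsum_eq_sum_of_fintype, ← Finset.sum_coe_sort t]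
    exact Finset.sum_congr rfl fun i _ => by rw [hi i i.2]
  refine ⟨t, ρ, fun i h => ⟨htK i h, ?_, ?_, ?_⟩, ?_, ?_⟩
  · rw [hi i h]; exact (f ⟨i, h⟩).contMDiff.contDiff
  · rw [hi i h]; exact hf ⟨i, h⟩
  · rw [hi i h]; exact f.nonneg _
  · intro x hx; rw [hsum, f.sum_eq_one hx]
  · intro x; rw [hsum]; exact f.sum_le_one x

end Global

/-! ### The global first variation formula and its radial form. -/

section Global

open Set

variable {n : ℕ} {m : ℝ} {S : Set (Eucl n)}

theorem globalIntegrand_eq_zero {χ : Eucl n → ℝ} {x : Eucl n} (hx : x ∉ tsupport χ) :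
    globalIntegrand n m S χ x = 0 := by
  have h := fderiv_of_notMem_tsupport ℝ hx
  rw [globalIntegrand, image_eq_zero_of_notMem_tsupport hx, h]
  simp

theorem globalIntegrand_sum {ι : Type*} {t : Finset ι} {χ : ι → Eucl n → ℝ}
    (hχ : ∀ i ∈ t, Differentiable ℝ (χ i)) (x : Eucl n) :
    globalIntegrand n m S (fun y => ∑ i ∈ t, χ i y) x =
      ∑ i ∈ t, globalIntegrand n m S (χ i) x := by
  simp only [globalIntegrand]
  rw [fderiv_fun_sum fun i hi => hχ i hi x, Finset.sum_add_distrib, Finset.sum_mul,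
    sum_apply]

theorem exists_first_variation_nhds (hn : 3 ≤ n) (hm : 0 < m) (hS : IsFreeBoundaryMinimal n m S)
    {p : Eucl n} (hp : p ∈ exterior n m) :
    ∃ V : Set (Eucl n), IsOpen V ∧ p ∈ V ∧ ∀ χ : Eucl n → ℝ, ContDiff ℝ 1 χ →
      HasCompactSupport χ → tsupport χ ⊆ V →
      IntegrableOn (globalIntegrand n m S χ) S μHE[n - 1] ∧
      ∫ x in S, globalIntegrand n m S χ x ∂μHE[n - 1] = 0 := by
  by_cases hpS : p ∈ S
  · obtain ⟨U, φ, hpU, h⟩ := hS.exists_localEquation hpS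
    have hO : IsOpen (U ∩ exterior n m) := h.isOpen.inter isOpen_exterior
    obtain ⟨V, hV, hpV, hVU, hvar⟩ := exists_local_first_variation hO
      (h.contDiffOn.mono inter_subset_left) (fun x hx => h.gradient_ne x hx.1) ⟨hpU, hp⟩
    refine ⟨V, hV, hpV, fun χ h1 h2 h3 => ?_⟩
    obtain ⟨hi, hz⟩ := hvar χ h1 h2 h3
    rw [finrank_euclideanSpace, Fintype.card_fin] at hi hz
    have hset : {x ∈ V | φ x = 0} = S ∩ V := by
      ext x
      have hx : x ∈ V → (x ∈ S ↔ φ x = 0) := fun hx =>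
        h.mem_iff (hVU hx).1 (le_of_lt (show horizonRadius n m < ‖x‖ from (hVU hx).2))
      constructor
      · rintro ⟨h4, h5⟩; exact ⟨(hx h4).2 h5, h4⟩
      · rintro ⟨h4, h5⟩; exact ⟨h5, (hx h5).1 h4⟩
    rw [hset] at hi hz
    have hm1 : MeasurableSet (S ∩ V) := hS.isClosed.measurableSet.inter hV.measurableSet
    have heq : EqOn (variationIntegrand φ χ) (globalIntegrand n m S χ) (S ∩ V) := fun x hx =>
      (h.globalIntegrand_eq hn hm hx.1 (hVU hx.2).1 (hVU hx.2).2 χ).symm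
    have hoff : ∀ x ∈ S \ (S ∩ V), globalIntegrand n m S χ x = 0 := fun x hx =>
      globalIntegrand_eq_zero fun hx' => hx.2 ⟨hx.1, h3 hx'⟩
    refine ⟨?_, ?_⟩
    · exact (hi.congr_fun heq hm1).of_forall_sdiff_eq_zero hS.isClosed.measurableSet hoff
    · rw [setIntegral_eq_of_subset_of_forall_sdiff_eq_zero hS.isClosed.measurableSet
        inter_subset_left hoff, ← setIntegral_congr_fun hm1 heq, hz]
  · refine ⟨Sᶜ, hS.isClosed.isOpen_compl, hpS, fun χ h1 h2 h3 => ?_⟩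
    have hz : EqOn (globalIntegrand n m S χ) (fun _ => 0) S := fun x hx =>
      globalIntegrand_eq_zero fun hx' => h3 hx' hx
    exact ⟨integrableOn_zero.congr_fun hz.symm hS.isClosed.measurableSet, by
      rw [setIntegral_congr_fun hS.isClosed.measurableSet hz]; simp⟩

/-- The first variation formula for fields supported away from the horizon. -/
theorem first_variation (hn : 3 ≤ n) (hm : 0 < m) (hS : IsFreeBoundaryMinimal n m S)
    {χ : Eucl n → ℝ} (hχ : ContDiff ℝ 1 χ) (hχc : HasCompactSupport χ)
    (hχs : tsupport χ ⊆ exterior n m) :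
    IntegrableOn (globalIntegrand n m S χ) S μHE[n - 1] ∧
      ∫ x in S, globalIntegrand n m S χ x ∂μHE[n - 1] = 0 := by
  choose! V hV hpV hvar using fun p (hp : p ∈ tsupport χ) =>
    exists_first_variation_nhds hn hm hS (hχs hp)
  obtain ⟨t, ρ, ht, hsum, -⟩ := exists_finite_smooth_partition hχc hV hpV
  have hsm : ∀ i ∈ t, ContDiff ℝ 1 fun x => ρ i x * χ x := fun i hi =>
    ((ht i hi).2.1.of_le (by simp)).mul hχ
  have hpieces := fun i (hi : i ∈ t) => hvar i (ht i hi).1 (fun x => ρ i x * χ x) (hsm i hi)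
    (hχc.mul_left) ((tsupport_mul_subset_left).trans (ht i hi).2.2.1)
  have hχeq : χ = fun x => ∑ i ∈ t, ρ i x * χ x := by
    ext x
    rw [← Finset.sum_mul]
    by_cases hx : x ∈ tsupport χ
    · rw [hsum x hx, one_mul]
    · rw [image_eq_zero_of_notMem_tsupport hx, mul_zero]
  have hg : globalIntegrand n m S χ =
      fun x => ∑ i ∈ t, globalIntegrand n m S (fun y => ρ i y * χ y) x := by
    ext x
    conv_lhs => rw [hχeq]
    exact globalIntegrand_sum (fun i hi => (hsm i hi).differentiable (by simp)) x
  rw [hg]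
  refine ⟨integrable_finsetSum _ fun i hi => (hpieces i hi).1, ?_⟩
  rw [integral_finsetSum _ fun i hi => (hpieces i hi).1]
  exact Finset.sum_eq_zero fun i hi => (hpieces i hi).2

/-- The square of the normal component of the radial unit vector on `S`. -/
noncomputable def radialDefect (n : ℕ) (m : ℝ) (S : Set (Eucl n)) (x : Eucl n) : ℝ :=
  inner ℝ x (normalAt n m S x) ^ 2 / ‖x‖ ^ 2

/-- The power r^(1-n) is chosen so that its derivative cancels the dimensional term (n-1) c r^(1-n);
apart from the derivative of `c`, only the multiple of (1 - h) P survives. -/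
theorem globalIntegrand_radial (hn : 3 ≤ n) {c : ℝ → ℝ} {x : Eucl n} (hx : x ≠ 0)
    (hc : DifferentiableAt ℝ c ‖x‖) :
    globalIntegrand n m S (fun y => c ‖y‖ * (‖y‖ ^ (n - 1))⁻¹) x =
      deriv c ‖x‖ / ‖x‖ ^ (n - 2) * (1 - radialDefect n m S x) +
      ((n : ℝ) - 1) * (c ‖x‖ / ‖x‖ ^ (n - 1)) * (1 - decayRate n m ‖x‖) * radialDefect n m S x := by
  obtain ⟨k, rfl⟩ : ∃ k, n = k + 3 := ⟨n - 3, by omega⟩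
  have hr : 0 < ‖x‖ := norm_pos_iff.2 hx
  have hb : HasDerivAt (fun r : ℝ => c r * (r ^ (k + 2))⁻¹)
      (deriv c ‖x‖ * (‖x‖ ^ (k + 2))⁻¹ +
        c ‖x‖ * (-((k + 2 : ℕ) * ‖x‖ ^ (k + 1)) / (‖x‖ ^ (k + 2)) ^ 2)) ‖x‖ :=
    hc.hasDerivAt.mul ((hasDerivAt_pow (k + 2) ‖x‖).inv (by positivity))
  have hf := (hasFDerivAt_norm_comp hx hb).fderiv
  simp only [show k + 3 - 1 = k + 2 by omega, show k + 3 - 2 = k + 1 by omega]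
  rw [globalIntegrand, hf, radialDefect]
  simp only [smul_apply, innerSL_apply_apply, inner_sub_right, real_inner_smul_right, smul_eq_mul,
    real_inner_self_eq_norm_sq]
  set s : ℝ := inner ℝ x (normalAt (k + 3) m S x)
  push_cast
  field_simp
  ring

theorem radial_first_variation (hn : 3 ≤ n) (hm : 0 < m) (hS : IsFreeBoundaryMinimal n m S)
    {c : ℝ → ℝ} (hc : ContDiff ℝ 1 c) {a b : ℝ} (ha : horizonRadius n m < a)
    (hca : ∀ r < a, c r = 0) (hcb : ∀ r, b < r → c r = 0) :
    IntegrableOn (fun x => deriv c ‖x‖ / ‖x‖ ^ (n - 2) * (1 - radialDefect n m S x) +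
      ((n : ℝ) - 1) * (c ‖x‖ / ‖x‖ ^ (n - 1)) * (1 - decayRate n m ‖x‖) * radialDefect n m S x)
      S μHE[n - 1] ∧
    ∫ x in S, (deriv c ‖x‖ / ‖x‖ ^ (n - 2) * (1 - radialDefect n m S x) +
      ((n : ℝ) - 1) * (c ‖x‖ / ‖x‖ ^ (n - 1)) * (1 - decayRate n m ‖x‖) * radialDefect n m S x)
      ∂μHE[n - 1] = 0 := by
  set χ : Eucl n → ℝ := fun y => c ‖y‖ * (‖y‖ ^ (n - 1))⁻¹ with hχ
  have hapos : 0 < a := (horizonRadius_pos hm).trans ha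
  have hχd : ContDiff ℝ 1 χ := by
    rw [contDiff_iff_contDiffAt]
    intro x
    by_cases hx : x = 0
    · have : χ =ᶠ[𝓝 x] fun _ => 0 := by
        filter_upwards [(isOpen_lt continuous_norm continuous_const).mem_nhds
          (show ‖x‖ < a by simpa [hx] using hapos)] with y hy
        simp [hχ, hca _ hy]
      exact contDiffAt_const.congr_of_eventuallyEq this
    · have h1 : ContDiffAt ℝ 1 (fun y : Eucl n => ‖y‖) x := contDiffAt_norm ℝ hx
      exact (hc.contDiffAt.comp x h1).mul ((h1.pow _).inv (by positivity))
  have hsupp : Function.support χ ⊆ Metric.closedBall 0 b ∩ {x | a ≤ ‖x‖} := by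
    intro x hx
    have hx' : c ‖x‖ ≠ 0 := fun h0 => hx (by simp [hχ, h0])
    refine ⟨?_, ?_⟩
    · by_contra h; exact hx' (hcb _ (by simpa using h))
    · by_contra h; exact hx' (hca _ (not_le.1 h))
  have hcl : IsClosed (Metric.closedBall (0 : Eucl n) b ∩ {x | a ≤ ‖x‖}) :=
    Metric.isClosed_closedBall.inter (isClosed_le continuous_const continuous_norm)
  have hts : tsupport χ ⊆ Metric.closedBall 0 b ∩ {x | a ≤ ‖x‖} :=
    closure_minimal hsupp hcl
  have hcs : HasCompactSupport χ :=
    (isCompact_closedBall (0 : Eucl n) b).of_isClosed_subset (isClosed_tsupport χ)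
      (hts.trans inter_subset_left)
  obtain ⟨h1, h2⟩ := first_variation hn hm hS hχd hcs
    (fun x hx => lt_of_lt_of_le ha (hts hx).2)
  have heq : EqOn (globalIntegrand n m S χ) _ S := fun x hx =>
    globalIntegrand_radial hn (norm_pos_iff.1 (lt_of_lt_of_le (horizonRadius_pos hm)
      (hS.subset hx))) (hc.differentiable (by simp) _)
  exact ⟨h1.congr_fun heq hS.isClosed.measurableSet, by
    rw [← setIntegral_congr_fun hS.isClosed.measurableSet heq, h2]⟩

end Global

/-! ### Polar charts -/

section PolarChart

open Module Set

variable {E : Type*} [NormedAddCommGroup E] [InnerProductSpace ℝ E] [FiniteDimensional ℝ E]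
  {H : Type*} [NormedAddCommGroup H] [InnerProductSpace ℝ H] [FiniteDimensional ℝ H]

/-- Orthogonality of `u` to the image of `L₁` makes the Gram matrix block diagonal. -/
theorem normDet_withLp_prod {L : WithLp 2 (H × ℝ) →ₗ[ℝ] E} {L₁ : H →ₗ[ℝ] E} {u : E}
    (hL : ∀ y : WithLp 2 (H × ℝ), L y = L₁ y.fst + y.snd • u) (hu : ∀ w, inner ℝ (L₁ w) u = (0 : ℝ)) :
    L.normDet = L₁.normDet * ‖u‖ := by
  classical
  set b := stdOrthonormalBasis ℝ H
  set b' := b.prod (OrthonormalBasis.singleton Unit ℝ)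
  have h1 := L.normDet_sq_eq_det_gram b'
  have h2 := L₁.normDet_sq_eq_det_gram b
  simp only [RCLike.ofReal_real_eq_id, id] at h1 h2
  have hu' : ∀ w, inner ℝ u (L₁ w) = (0 : ℝ) := fun w => by rw [real_inner_comm, hu]
  have hg : Matrix.gram ℝ (fun i => L (b' i)) = Matrix.fromBlocks
      (Matrix.gram ℝ (fun i => L₁ (b i))) 0 0 (Matrix.of fun _ _ : Unit => ‖u‖ ^ 2) := by
    ext i j
    rcases i with i | i <;> rcases j with j | j <;>
      simp [b', Matrix.gram_apply, hL, hu, hu', -WithLp.prod_inner_apply]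
  rw [hg, Matrix.det_fromBlocks_zero₂₁, ← h2, Matrix.det_unique, Matrix.of_apply] at h1
  have h3 : L.normDet ^ 2 = (L₁.normDet * ‖u‖) ^ 2 := by rw [h1, mul_pow]
  exact (sq_eq_sq₀ L.normDet_nonneg (mul_nonneg L₁.normDet_nonneg (norm_nonneg _))).1 h3

/-- Polar coordinates, followed by an orthogonal projection in the angular variable. -/
noncomputable def polarCoord (K : Submodule ℝ E) (x : E) : WithLp 2 (K × ℝ) :=
  WithLp.toLp 2 (K.orthogonalProjectionOnto (‖x‖⁻¹ • x), ‖x‖)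

variable {K : Submodule ℝ E}

theorem contDiffOn_polarCoord : ContDiffOn ℝ ∞ (polarCoord K) {x | x ≠ 0} := by
  intro x hx
  have h1 : ContDiffAt ℝ ∞ (fun y : E => ‖y‖) x := contDiffAt_norm ℝ hx
  have h2 : ContDiffAt ℝ ∞ (fun y : E => K.orthogonalProjectionOnto (‖y‖⁻¹ • y)) x :=
    K.orthogonalProjectionOnto.contDiff.contDiffAt.comp x
      ((h1.inv (norm_ne_zero_iff.2 hx)).smul contDiffAt_id)
  exact ((WithLp.prodContinuousLinearEquiv 2 ℝ K ℝ).symm.contDiff.contDiffAt.comp x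
    (h2.prodMk h1)).contDiffWithinAt

theorem fderiv_polarCoord {x : E} (hx : x ≠ 0) (v : E) :
    fderiv ℝ (polarCoord K) x v = WithLp.toLp 2 (K.orthogonalProjectionOnto
      (‖x‖⁻¹ • v - (inner ℝ x v / ‖x‖ ^ 3) • x), inner ℝ x v / ‖x‖) := by
  have hx0 : ‖x‖ ≠ 0 := norm_ne_zero_iff.2 hx
  have h1 : HasFDerivAt (fun y : E => ‖y‖) ((1 / ‖x‖) • innerSL ℝ x) x :=
    hasFDerivAt_norm_comp (b := fun r => r) hx (hasDerivAt_id _)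
  have h2 : HasFDerivAt (fun y : E => ‖y‖⁻¹) ((-(‖x‖ ^ 2)⁻¹ / ‖x‖) • innerSL ℝ x) x :=
    hasFDerivAt_norm_comp (b := fun r => r⁻¹) hx (hasDerivAt_inv hx0)
  have h3 := (K.orthogonalProjectionOnto.hasFDerivAt.comp x
    (h2.smul (hasFDerivAt_id x))).prodMk h1
  have h4 := (WithLp.prodContinuousLinearEquiv 2 ℝ K ℝ).symm.hasFDerivAt.comp x h3
  have h5 : fderiv ℝ (polarCoord K) x = _ := h4.fderiv
  rw [h5]
  change WithLp.toLp 2 (K.orthogonalProjectionOnto (‖x‖⁻¹ • v +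
    ((-(‖x‖ ^ 2)⁻¹ / ‖x‖) * inner ℝ x v) • x), (1 / ‖x‖) * inner ℝ x v) = _
  congr 2
  · congr 1
    rw [sub_eq_add_neg, ← neg_smul]
    congr 2
    field_simp
  · ring

theorem finrank_orthogonal_pair {p ν : E} (hp : p ≠ 0) (hν : ν ≠ 0) (h : inner ℝ p ν = (0 : ℝ)) :
    finrank ℝ (Submodule.span ℝ {p, ν})ᗮ + 2 = finrank ℝ E := by
  have hli : LinearIndependent ℝ ![p, ν] := by
    refine linearIndependent_of_ne_zero_of_inner_eq_zero (𝕜 := ℝ) ?_ ?_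
    · intro i; fin_cases i <;> simpa
    · intro i j hij
      fin_cases i <;> fin_cases j <;> simp_all [real_inner_comm]
  have h1 := finrank_span_eq_card hli
  rw [Matrix.range_cons_cons_empty] at h1
  have h2 := (Submodule.span ℝ {p, ν}).finrank_add_finrank_orthogonal
  rw [h1, Fintype.card_fin] at h2
  omega

/-- The direction `ν` is angular and transverse to the level set. Keeping |x|, and the component of
x/|x| orthogonal to `p` and `ν`, gives coordinates on the level set in which the radius is one
coordinate; its slices are the intersections with spheres. -/
theorem exists_polarChart {U : Set E} (hU : IsOpen U) {p : E} (hp : p ∈ U) {φ : E → ℝ}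
    (hφ : ContDiffOn ℝ ∞ φ U) (hp0 : p ≠ 0) {ν : E} (hν : inner ℝ p ν = (0 : ℝ))
    (hne : fderiv ℝ φ p ν ≠ 0) :
    ∃ (K : Submodule ℝ E) (V : Set E) (D : _) (X : _), finrank ℝ K + 2 = finrank ℝ E ∧
      p ∈ V ∧ V ⊆ U ∩ {x | x ≠ 0} ∧ IsLevelChart (polarCoord K) φ V D X := by
  have hν0 : ν ≠ 0 := by rintro rfl; simp at hne
  set K := (Submodule.span ℝ {p, ν})ᗮ with hK
  have hfr := finrank_orthogonal_pair hp0 hν0 hν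
  have hO : IsOpen (U ∩ {x : E | x ≠ 0}) := hU.inter isOpen_ne
  have hpK : K.orthogonalProjectionOnto p = 0 := by
    rw [Submodule.orthogonalProjectionOnto_eq_zero_iff, hK, Submodule.orthogonal_orthogonal]
    exact Submodule.subset_span (by simp)
  set L := (fderiv ℝ (polarCoord K) p).prod (fderiv ℝ φ p) with hL
  have hker : ∀ v, L v = 0 → v = 0 := by
    intro v hv
    have h1 : fderiv ℝ (polarCoord K) p v = 0 := congrArg Prod.fst hv
    have h2 : fderiv ℝ φ p v = 0 := congrArg Prod.snd hv
    rw [fderiv_polarCoord hp0] at h1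
    have h3 := congrArg WithLp.fst h1
    have h4 := congrArg WithLp.snd h1
    simp only [WithLp.zero_fst, WithLp.zero_snd, map_sub, map_smul, hpK, smul_zero,
      sub_zero] at h3 h4
    have h5 : K.orthogonalProjectionOnto v = 0 :=
      (smul_eq_zero.1 h3).resolve_left (inv_ne_zero (norm_ne_zero_iff.2 hp0))
    have h6 : inner ℝ p v = (0 : ℝ) := (div_eq_zero_iff.1 h4).resolve_right
      (norm_ne_zero_iff.2 hp0)
    rw [Submodule.orthogonalProjectionOnto_eq_zero_iff, hK, Submodule.orthogonal_orthogonal,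
      Submodule.mem_span_pair] at h5
    obtain ⟨a, b, rfl⟩ := h5
    rw [inner_add_right, real_inner_smul_right, real_inner_smul_right, hν, mul_zero, add_zero,
      real_inner_self_eq_norm_sq] at h6
    have ha : a = 0 := (mul_eq_zero.1 h6).resolve_right
      (pow_ne_zero _ (norm_ne_zero_iff.2 hp0))
    rw [ha, zero_smul, zero_add, map_smul, smul_eq_mul] at h2
    have hb : b = 0 := (mul_eq_zero.1 h2).resolve_right hne
    rw [ha, hb]; simp
  have hfr2 : finrank ℝ E = finrank ℝ (WithLp 2 (K × ℝ) × ℝ) := by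
    have h1 : finrank ℝ (WithLp 2 (K × ℝ)) = finrank ℝ K + 1 := by
      rw [(WithLp.prodContinuousLinearEquiv 2 ℝ K ℝ).toLinearEquiv.finrank_eq, finrank_prod,
        finrank_self]
    have h2 : finrank ℝ K + 2 = finrank ℝ E := hfr
    rw [finrank_prod, finrank_self, h1]
    omega
  obtain ⟨A, hA⟩ := exists_equiv_of_ker L hker hfr2
  obtain ⟨V, D, X, h1, h2, h3⟩ := exists_levelChart hO ⟨hp, hp0⟩
    (contDiffOn_polarCoord.mono inter_subset_right) (hφ.mono inter_subset_left) A hA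
  exact ⟨K, V, D, X, hfr, h1, h2, h3⟩

namespace IsLevelChart

variable {φ : E → ℝ} {V : Set E} {D : Set (WithLp 2 (K × ℝ))} {X : WithLp 2 (K × ℝ) → E}

theorem norm_apply (h : IsLevelChart (polarCoord K) φ V D X) {z : WithLp 2 (K × ℝ)}
    (hz : z ∈ D) : ‖X z‖ = z.snd := congrArg WithLp.snd (h.coord_apply z hz)

theorem inner_fderiv_apply (h : IsLevelChart (polarCoord K) φ V D X) {z : WithLp 2 (K × ℝ)}
    (hz : z ∈ D) (h0 : X z ≠ 0) (y : WithLp 2 (K × ℝ)) :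
    inner ℝ (X z) (fderiv ℝ X z y) = ‖X z‖ * y.snd := by
  have h1 := h.fderiv_coord_apply hz y
  rw [fderiv_polarCoord h0] at h1
  have h2 : inner ℝ (X z) (fderiv ℝ X z y) / ‖X z‖ = y.snd := congrArg WithLp.snd h1
  rw [← h2]
  have : ‖X z‖ ≠ 0 := norm_ne_zero_iff.2 h0
  field_simp

/-- Where the level set is tangent to the radial direction, so is the chart. -/
theorem fderiv_apply_radial (h : IsLevelChart (polarCoord K) φ V D X) {z : WithLp 2 (K × ℝ)}
    (hz : z ∈ D) (h0 : X z ≠ 0) (hrad : fderiv ℝ φ (X z) (X z) = 0) :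
    fderiv ℝ X z (WithLp.toLp 2 (0, 1)) = ‖X z‖⁻¹ • X z := by
  have hx0 : ‖X z‖ ≠ 0 := norm_ne_zero_iff.2 h0
  refine sub_eq_zero.1 (h.eq_zero_of_fderiv _ (h.map_mem z hz) _ ?_ ?_)
  · rw [map_sub, h.fderiv_coord_apply hz, fderiv_polarCoord h0, real_inner_smul_right,
      real_inner_self_eq_norm_sq, smul_smul, ← sub_smul]
    have h1 : ‖X z‖⁻¹ * ‖X z‖⁻¹ - ‖X z‖⁻¹ * ‖X z‖ ^ 2 / ‖X z‖ ^ 3 = 0 := by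
      field_simp; ring
    have h2 : ‖X z‖⁻¹ * ‖X z‖ ^ 2 / ‖X z‖ = 1 := by field_simp
    rw [h1, h2, zero_smul, map_zero, sub_self]
  · rw [map_sub, h.fderiv_fun_apply hz, map_smul, hrad, smul_zero, sub_zero]

/-- The inclusion of a slice of fixed radius. -/
noncomputable def slice (K : Submodule ℝ E) (s : ℝ) (w : K) : WithLp 2 (K × ℝ) := WithLp.toLp 2 (w, s)

/-- The derivative of the inclusion of a slice. -/
noncomputable def sliceL (K : Submodule ℝ E) : K →L[ℝ] WithLp 2 (K × ℝ) :=
  ((WithLp.prodContinuousLinearEquiv 2 ℝ K ℝ).symm : K × ℝ →L[ℝ] WithLp 2 (K × ℝ)).comp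
    (ContinuousLinearMap.inl ℝ K ℝ)

theorem sliceL_apply (w : K) : sliceL K w = WithLp.toLp 2 (w, 0) := rfl

theorem continuous_slice (s : ℝ) : Continuous (slice K s) :=
  (WithLp.prodContinuousLinearEquiv 2 ℝ K ℝ).symm.continuous.comp (by fun_prop)

theorem hasFDerivAt_slice (s : ℝ) (w : K) : HasFDerivAt (slice K s) (sliceL K) w :=
  (WithLp.prodContinuousLinearEquiv 2 ℝ K ℝ).symm.hasFDerivAt.comp w
    ((hasFDerivAt_id w).prodMk (hasFDerivAt_const s w))

variable (h : IsLevelChart (polarCoord K) φ V D X) (s : ℝ)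
include h

theorem isOpen_slice : IsOpen (slice K s ⁻¹' D) := h.isOpen_target.preimage (continuous_slice s)

theorem hasFDerivAt_comp_slice : ∀ w ∈ slice K s ⁻¹' D,
    HasFDerivAt (fun w => X (slice K s w)) ((fderiv ℝ X (slice K s w)).comp (sliceL K)) w :=
  fun w hw => (h.hasFDerivAt _ hw).comp w (hasFDerivAt_slice s w)

theorem continuousOn_fderiv_slice :
    ContinuousOn (fun w => (fderiv ℝ X (slice K s w)).comp (sliceL K)) (slice K s ⁻¹' D) :=
  (h.continuousOn_fderiv.comp (continuous_slice s).continuousOn fun _ hw => hw).clm_comp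
    continuousOn_const

theorem injective_fderiv_slice : ∀ w ∈ slice K s ⁻¹' D,
    Function.Injective ((fderiv ℝ X (slice K s w)).comp (sliceL K)) := fun _ hw _ _ hab =>
  congrArg WithLp.fst (h.injective_fderiv _ hw hab)

theorem injOn_slice : InjOn (fun w => X (slice K s w)) (slice K s ⁻¹' D) := fun _ ha _ hb hab =>
  congrArg WithLp.fst (h.injOn ha hb hab)

theorem image_slice :
    (fun w => X (slice K s w)) '' (slice K s ⁻¹' D) = {x ∈ V | ‖x‖ = s ∧ φ x = 0} := by
  ext x
  constructor
  · rintro ⟨w, hw, rfl⟩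
    exact ⟨h.map_mem _ hw, h.norm_apply hw, h.fun_apply _ hw⟩
  · rintro ⟨hx, rfl, h0⟩
    refine ⟨(polarCoord K x).fst, ?_, ?_⟩
    · exact h.coord_mem x hx h0
    · exact h.apply_coord x hx h0

end IsLevelChart

end PolarChart

/-! ### Concentration of the first variation on the boundary -/

section Collar

open Module Set

variable {K : Type*} [NormedAddCommGroup K] [InnerProductSpace ℝ K] [FiniteDimensional ℝ K]
  [MeasurableSpace K] [BorelSpace K]

/-- The substitution τ = c (s - a) - 1. -/
theorem lintegral_mul_comp_dilation (κ g : ℝ → ℝ≥0∞) (hκ : Measurable κ) (hg : Measurable g)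
    (a : ℝ) {c : ℝ} (hc : 0 < c) :
    ∫⁻ s, ENNReal.ofReal c * κ (c * (s - a) - 1) * g s = ∫⁻ τ, κ τ * g (a + (τ + 1) / c) := by
  set h : ℝ → ℝ≥0∞ := fun τ => κ τ * g (a + (τ + 1) / c) with hh
  have hm : Measurable h := hκ.mul (hg.comp (by fun_prop))
  have h1 : ∫⁻ τ, h τ = ∫⁻ t, h (t - (c * a + 1)) := (lintegral_sub_right_eq_self h _).symm
  have hm' : Measurable fun t => h (t - (c * a + 1)) := hm.comp (by fun_prop)
  have h2 : ∫⁻ t, h (t - (c * a + 1)) =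
      ENNReal.ofReal c * ∫⁻ s, h (c * s - (c * a + 1)) := by
    conv_lhs => rw [← Real.smul_map_volume_mul_left hc.ne']
    rw [lintegral_smul_measure, lintegral_map hm' (by fun_prop), abs_of_pos hc, smul_eq_mul]
  have hm2 : Measurable fun s => h (c * s - (c * a + 1)) := hm.comp (by fun_prop)
  rw [h1, h2, ← lintegral_const_mul _ hm2]
  refine lintegral_congr fun s => ?_
  rw [hh, mul_assoc]
  congr 3
  · ring
  · field_simp; ring

theorem lintegral_withLp_prod {g : WithLp 2 (K × ℝ) → ℝ≥0∞} (hg : Measurable g) :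
    ∫⁻ z, g z = ∫⁻ w : K, ∫⁻ s : ℝ, g (WithLp.toLp 2 (w, s)) := by
  rw [← (WithLp.volume_preserving_toLp K ℝ).lintegral_comp hg]
  exact lintegral_prod _ (hg.comp (WithLp.volume_preserving_toLp K ℝ).measurable).aemeasurable

/-- After the substitution s = a + (τ + 1)/(j + 1) the kernel no longer depends on j, and Fatou's
lemma applies; a lower bound is all that is needed. The shift by one confines the kernel to s > a +
1/(j + 1), so that the matching cutoff vanishes near the horizon. -/
theorem le_liminf_lintegral_collar {κ : ℝ → ℝ≥0∞} (hκ : Measurable κ)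
    (hκ0 : ∀ τ ≤ 0, κ τ = 0) (a : ℝ) {G : WithLp 2 (K × ℝ) → ℝ≥0∞} (hG : Measurable G)
    (hlim : ∀ w : K, G (WithLp.toLp 2 (w, a)) ≤
      liminf (fun s => G (WithLp.toLp 2 (w, s))) (𝓝[>] a)) :
    (∫⁻ τ, κ τ) * ∫⁻ w : K, G (WithLp.toLp 2 (w, a)) ≤
      liminf (fun j : ℕ => ∫⁻ z : WithLp 2 (K × ℝ),
        ENNReal.ofReal (j + 1) * κ ((j + 1) * (z.snd - a) - 1) * G z) atTop := by
  have htoLp : Measurable (WithLp.toLp 2 : K × ℝ → WithLp 2 (K × ℝ)) :=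
    (WithLp.volume_preserving_toLp K ℝ).measurable
  have hsnd : Measurable fun z : WithLp 2 (K × ℝ) => z.snd :=
    measurable_snd.comp (WithLp.volume_preserving_ofLp K ℝ).measurable
  have hmeas : ∀ j : ℕ, Measurable fun q : K × ℝ =>
      κ q.2 * G (WithLp.toLp 2 (q.1, a + (q.2 + 1) / ((j : ℝ) + 1))) := fun j =>
    (hκ.comp measurable_snd).mul (hG.comp (htoLp.comp (by fun_prop)))
  have hj : ∀ j : ℕ, ∫⁻ z : WithLp 2 (K × ℝ),
        ENNReal.ofReal (j + 1) * κ ((j + 1) * (z.snd - a) - 1) * G z =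
      ∫⁻ q : K × ℝ, κ q.2 * G (WithLp.toLp 2 (q.1, a + (q.2 + 1) / ((j : ℝ) + 1))) := by
    intro j
    rw [lintegral_withLp_prod (by fun_prop), Measure.volume_eq_prod,
      lintegral_prod _ (hmeas j).aemeasurable]
    refine lintegral_congr fun w => ?_
    exact lintegral_mul_comp_dilation κ (fun s => G (WithLp.toLp 2 (w, s))) hκ
      (hG.comp (htoLp.comp (by fun_prop))) a (by positivity)
  simp_rw [hj]
  refine le_trans ?_ (lintegral_liminf_le hmeas)
  have hGa : Measurable fun w : K => G (WithLp.toLp 2 (w, a)) := hG.comp (htoLp.comp (by fun_prop))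
  rw [mul_comm, ← lintegral_prod_mul hGa.aemeasurable hκ.aemeasurable, ← Measure.volume_eq_prod]
  refine lintegral_mono fun q => ?_
  rcases le_or_gt q.2 0 with hq | hq
  · simp [hκ0 _ hq]
  · have ht : Tendsto (fun j : ℕ => a + (q.2 + 1) / ((j : ℝ) + 1)) atTop (𝓝[>] a) := by
      refine tendsto_nhdsWithin_iff.2 ⟨?_, Eventually.of_forall fun j => ?_⟩
      · have := (tendsto_one_div_add_atTop_nhds_zero_nat (𝕜 := ℝ)).const_mul (q.2 + 1)
        simpa [div_eq_mul_inv] using this.const_add a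
      · exact lt_add_of_pos_right a (by positivity)
    have h1 := (hlim q.1).trans (liminf_le_liminf_of_le ht)
    have h2 := ENNReal.le_liminf_mul (f := atTop) (u := fun _ : ℕ => κ q.2)
      (v := fun j : ℕ => G (WithLp.toLp 2 (q.1, a + (q.2 + 1) / ((j : ℝ) + 1))))
    rw [liminf_const] at h2
    rw [mul_comm]
    exact (mul_le_mul_right h1 _).trans h2

open IsLevelChart

/-- The free boundary condition acts here. It makes the gradient at `p` angular, so that a polar
chart exists across the horizon. On the horizon it makes P vanish and makes the radial derivative of
the chart a unit vector orthogonal to the slice, so that the area density of `S` reduces to that of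
its boundary. -/
theorem exists_collar_nhds {n : ℕ} {m : ℝ} {S : Set (Eucl n)} (hn : 3 ≤ n) (hm : 0 < m)
    (hS : IsFreeBoundaryMinimal n m S) {p : Eucl n} (hp : p ∈ boundary n m S) :
    ∃ V : Set (Eucl n), IsOpen V ∧ p ∈ V ∧ ∀ χ : Eucl n → ℝ, Continuous χ →
      Function.support χ ⊆ V → ∀ κ : ℝ → ℝ≥0∞, Measurable κ → (∀ τ ≤ 0, κ τ = 0) →
      ∫⁻ τ, κ τ = 1 → ∀ B : ℝ → ℝ, ContinuousOn B (Ioi 0) →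
      ENNReal.ofReal (B (horizonRadius n m)) *
        ∫⁻ x in boundary n m S, ENNReal.ofReal (χ x) ∂μHE[n - 2] ≤
      liminf (fun j : ℕ => ∫⁻ x in S,
        ENNReal.ofReal (j + 1) * κ ((j + 1) * (‖x‖ - horizonRadius n m) - 1) *
          (ENNReal.ofReal (B ‖x‖) * (ENNReal.ofReal (χ x) *
            ENNReal.ofReal (1 - radialDefect n m S x))) ∂μHE[n - 1]) atTop := by
  obtain ⟨U, φ, hpU, hU⟩ := hS.exists_localEquation hp.1
  have hp0 : p ≠ 0 := norm_pos_iff.1 ((horizonRadius_pos hm).trans_le (hS.subset hp.1))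
  have hν : inner ℝ p (gradient φ p) = (0 : ℝ) := by
    rw [real_inner_comm]; exact hU.orthogonal p ⟨⟨hp.1, hpU⟩, hp.2⟩
  have hne : fderiv ℝ φ p (gradient φ p) ≠ 0 := by
    rw [← inner_gradient]
    exact inner_self_ne_zero.2 (hU.gradient_ne p hpU)
  obtain ⟨K, V, D, X, hK, hpV, hVU, hX⟩ :=
    exists_polarChart hU.isOpen hpU hU.contDiffOn hp0 hν hne
  rw [finrank_euclideanSpace, Fintype.card_fin] at hK
  have hKn : finrank ℝ K = n - 2 := by omega
  have hWn : finrank ℝ (WithLp 2 (K × ℝ)) = n - 1 := by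
    rw [(WithLp.prodContinuousLinearEquiv 2 ℝ K ℝ).toLinearEquiv.finrank_eq, finrank_prod,
      finrank_self]
    omega
  refine ⟨V, hX.isOpen_source, hpV, fun χ hχ hχV κ hκ hκ0 hκ1 B hB => ?_⟩
  set a := horizonRadius n m with ha
  have hapos : 0 < a := horizonRadius_pos hm
  -- Stands in for 1 - `radialDefect`: it is continuous across the horizon, and agrees with it on
  -- `S` in the exterior, where the chosen normal is controlled.
  set T : Eucl n → ℝ := fun x => 1 - inner ℝ x (euclNormal φ x) ^ 2 / ‖x‖ ^ 2 with hT
  have hTc : ContinuousOn T V := by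
    have h1 : ContinuousOn (euclNormal φ) V :=
      ((contDiffOn_euclNormal hU.isOpen hU.contDiffOn hU.gradient_ne).continuousOn).mono
        fun x hx => (hVU hx).1
    refine continuousOn_const.sub (((continuousOn_id.inner h1).pow 2).div
      (continuous_norm.continuousOn.pow 2) fun x hx => ?_)
    exact pow_ne_zero _ (norm_ne_zero_iff.2 (hVU hx).2)
  have hsnd : ∀ z ∈ D, 0 < z.snd := fun z hz => by
    rw [← hX.norm_apply hz]; exact norm_pos_iff.2 (hVU (hX.map_mem z hz)).2
  have hcsnd : Continuous fun z : WithLp 2 (K × ℝ) => z.snd :=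
    continuous_snd.comp (WithLp.prodContinuousLinearEquiv 2 ℝ K ℝ).continuous
  set J : WithLp 2 (K × ℝ) → ℝ := fun z => (fderiv ℝ X z : WithLp 2 (K × ℝ) →ₗ[ℝ] Eucl n).normDet with hJ
  have hJc : ContinuousOn J D := continuous_normDet.comp_continuousOn hX.continuousOn_fderiv
  set g : WithLp 2 (K × ℝ) → ℝ≥0∞ := fun z => ENNReal.ofReal (J z) * (ENNReal.ofReal (B z.snd) *
    (ENNReal.ofReal (χ (X z)) * ENNReal.ofReal (T (X z)))) with hg
  have hXc : ContinuousOn X D := hX.contDiffOn.continuousOn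
  have hof : ∀ {f : WithLp 2 (K × ℝ) → ℝ}, ContinuousOn f D →
      ContinuousOn (fun z => ENNReal.ofReal (f z)) D :=
    fun hf => ENNReal.continuous_ofReal.comp_continuousOn hf
  have hmul : ∀ {f f' : WithLp 2 (K × ℝ) → ℝ≥0∞}, ContinuousOn f D → (∀ z, f z ≠ ⊤) →
      ContinuousOn f' D → (∀ z, f' z ≠ ⊤) → ContinuousOn (fun z => f z * f' z) D :=
    fun hf h1 hf' h2 z hz =>
      ENNReal.Tendsto.mul (hf z hz) (Or.inr (h2 z)) (hf' z hz) (Or.inr (h1 z))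
  have hgc : ContinuousOn g D := by
    refine hmul (hof hJc) (fun _ => ENNReal.ofReal_ne_top) (hmul (hof (hB.comp
      hcsnd.continuousOn hsnd)) (fun _ => ENNReal.ofReal_ne_top) (hmul (hof
      (hχ.comp_continuousOn hXc)) (fun _ => ENNReal.ofReal_ne_top) (hof (hTc.comp hXc
      hX.map_mem)) fun _ => ENNReal.ofReal_ne_top) fun z => ?_) fun z => ?_
    · finiteness
    · finiteness
  have hDm : MeasurableSet D := hX.isOpen_target.measurableSet
  have hGm : Measurable (D.indicator g) := by
    classical
    have h1 := hgc.measurable_piecewise (g := (0 : WithLp 2 (K × ℝ) → ℝ≥0∞)) continuousOn_const hDm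
    rwa [piecewise_eq_indicator] at h1
  have hlim : ∀ w : K, D.indicator g (WithLp.toLp 2 (w, a)) ≤
      liminf (fun s => D.indicator g (WithLp.toLp 2 (w, s))) (𝓝[>] a) := by
    intro w
    by_cases hw : WithLp.toLp 2 (w, a) ∈ D
    · have h1 : ContinuousAt (D.indicator g) (WithLp.toLp 2 (w, a)) :=
        (hgc.continuousAt (hX.isOpen_target.mem_nhds hw)).congr (by
          filter_upwards [hX.isOpen_target.mem_nhds hw] with z hz
          rw [indicator_of_mem hz])
      have h2 : Continuous fun s : ℝ => (WithLp.toLp 2 (w, s) : WithLp 2 (K × ℝ)) :=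
        (WithLp.prodContinuousLinearEquiv 2 ℝ K ℝ).symm.continuous.comp (by fun_prop)
      have h3 : Tendsto (fun s => D.indicator g (WithLp.toLp 2 (w, s))) (𝓝[>] a)
          (𝓝 (D.indicator g (WithLp.toLp 2 (w, a)))) :=
        (ContinuousAt.comp (f := fun s : ℝ => (WithLp.toLp 2 (w, s) : WithLp 2 (K × ℝ))) h1
          h2.continuousAt).tendsto.mono_left nhdsWithin_le_nhds
      exact h3.liminf_eq.ge
    · rw [indicator_of_notMem hw]; exact bot_le
  have main := le_liminf_lintegral_collar hκ hκ0 a hGm hlim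
  rw [hκ1, one_mul] at main
  have hleft : ENNReal.ofReal (B a) * ∫⁻ x in boundary n m S, ENNReal.ofReal (χ x) ∂μHE[n - 2] =
      ∫⁻ w : K, D.indicator g (WithLp.toLp 2 (w, a)) := by
    have h1 : ∀ x, ENNReal.ofReal (χ x) = V.indicator (fun x => ENNReal.ofReal (χ x)) x := by
      intro x
      by_cases hx : x ∈ V
      · rw [indicator_of_mem hx]
      · rw [indicator_of_notMem hx, show χ x = 0 by
          by_contra h; exact hx (hχV h), ENNReal.ofReal_zero]
    have h2 : V ∩ boundary n m S = (fun w => X (slice K a w)) '' (slice K a ⁻¹' D) := by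
      rw [hX.image_slice]
      ext x
      constructor
      · rintro ⟨hx, hxS, hxa⟩
        exact ⟨hx, hxa, (hU.mem_iff (hVU hx).1 (hS.subset hxS)).1 hxS⟩
      · rintro ⟨hx, hxa, h0⟩
        exact ⟨hx, (hU.mem_iff (hVU hx).1 hxa.ge).2 h0, hxa⟩
    rw [lintegral_congr h1, setLIntegral_indicator hX.isOpen_source.measurableSet, h2, ← hKn,
      lintegral_image_eq_normDet (hX.isOpen_slice a) (hX.hasFDerivAt_comp_slice a)
      (hX.continuousOn_fderiv_slice a) (hX.injective_fderiv_slice a) (hX.injOn_slice a) subset_rfl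
      (hX.isOpen_slice a).measurableSet, ← lintegral_const_mul' _ _ ENNReal.ofReal_ne_top,
      ← lintegral_indicator (hX.isOpen_slice a).measurableSet]
    refine lintegral_congr fun w => ?_
    by_cases hw : WithLp.toLp 2 (w, a) ∈ D
    · rw [indicator_of_mem (show w ∈ slice K a ⁻¹' D from hw), indicator_of_mem hw]
      have hna : ‖X (WithLp.toLp 2 (w, a))‖ = a := hX.norm_apply hw
      have hXV := hX.map_mem _ hw
      have hXS : X (WithLp.toLp 2 (w, a)) ∈ S :=
        (hU.mem_iff (hVU hXV).1 hna.ge).2 (hX.fun_apply _ hw)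
      have horth := hU.orthogonal _ ⟨⟨hXS, (hVU hXV).1⟩, hna⟩
      have hX0 : X (WithLp.toLp 2 (w, a)) ≠ 0 := (hVU hXV).2
      have hT1 : T (X (WithLp.toLp 2 (w, a))) = 1 := by
        rw [hT]
        simp only [euclNormal]
        rw [real_inner_smul_right, real_inner_comm, horth, mul_zero, zero_pow two_ne_zero,
          zero_div, sub_zero]
      have hrad := hX.fderiv_apply_radial hw hX0 (by rw [← inner_gradient, horth])
      have hdet := normDet_withLp_prod (L := (fderiv ℝ X (WithLp.toLp 2 (w, a)) : WithLp 2 (K × ℝ) →ₗ[ℝ] Eucl n))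
        (L₁ := ((fderiv ℝ X (WithLp.toLp 2 (w, a))).comp (sliceL K) : K →ₗ[ℝ] Eucl n))
        (u := ‖X (WithLp.toLp 2 (w, a))‖⁻¹ • X (WithLp.toLp 2 (w, a))) (by
          intro y
          have : y = WithLp.toLp 2 (y.fst, 0) + y.snd • WithLp.toLp 2 (0, 1) := by
            apply WithLp.ofLp_injective
            ext <;> simp
          conv_lhs => rw [this]
          rw [map_add, map_smul]
          congr 2) (by
          intro v
          have := hX.inner_fderiv_apply hw hX0 (sliceL K v)
          rw [real_inner_smul_right, real_inner_comm]
          change _ * inner ℝ _ (fderiv ℝ X (WithLp.toLp 2 (w, a)) (sliceL K v)) = 0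
          rw [this, sliceL_apply]
          simp)
      rw [norm_smul, norm_inv, norm_norm, inv_mul_cancel₀ (norm_ne_zero_iff.2 hX0), mul_one]
        at hdet
      have hJ1 : J (WithLp.toLp 2 (w, a)) = _ := hdet
      simp only [hg]
      rw [hT1, hJ1, ENNReal.ofReal_one, mul_one]
      exact mul_left_comm _ _ _
    · rw [indicator_of_notMem (show w ∉ slice K a ⁻¹' D from hw), indicator_of_notMem hw]
  rw [hleft]
  refine main.trans (liminf_le_liminf (Eventually.of_forall fun j => ?_))
  -- The chart also covers radii below that of the horizon, where its image has left `S`; the kernel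
  -- vanishes there.
  set D' := D ∩ {z | a < z.snd} with hD'
  have hD'm : MeasurableSet D' := hDm.inter (isOpen_lt continuous_const hcsnd).measurableSet
  have himg : X '' D' ⊆ S := by
    rintro _ ⟨z, hz, rfl⟩
    have h1 : X z ∈ space n m := by
      change a ≤ ‖X z‖
      rw [hX.norm_apply hz.1]; exact le_of_lt hz.2
    exact (hU.mem_iff (hVU (hX.map_mem z hz.1)).1 h1).2 (hX.fun_apply z hz.1)
  refine le_trans ?_ (lintegral_mono_set himg)
  rw [← hWn, lintegral_image_eq_normDet hX.isOpen_target hX.hasFDerivAt hX.continuousOn_fderiv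
    hX.injective_fderiv hX.injOn inter_subset_left hD'm, ← lintegral_indicator hD'm]
  refine lintegral_mono fun z => ?_
  by_cases hz : z ∈ D'
  · have hXe : X z ∈ exterior n m := by
      change a < ‖X z‖
      rw [hX.norm_apply hz.1]; exact hz.2
    have hP : 1 - radialDefect n m S (X z) = T (X z) := by
      obtain ⟨c, hc, hN⟩ := hU.normalAt_eq (himg ⟨z, hz, rfl⟩) (hVU (hX.map_mem z hz.1)).1 hXe
      rw [radialDefect, hN, real_inner_smul_right, mul_pow, hc, one_mul]
    rw [indicator_of_mem hz, indicator_of_mem hz.1, hP, hX.norm_apply hz.1]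
    apply le_of_eq
    simp only [hg, hJ]
    ring
  · rw [indicator_of_notMem hz]
    by_cases hzD : z ∈ D
    · have h1 : z.snd ≤ a := not_lt.1 fun h => hz ⟨hzD, h⟩
      have h2 : ((j : ℝ) + 1) * (z.snd - a) ≤ 0 :=
        mul_nonpos_of_nonneg_of_nonpos (by positivity) (sub_nonpos.2 h1)
      rw [hκ0 _ (by linarith)]
      simp
    · rw [indicator_of_notMem hzD]; simp

theorem liminf_add_liminf_le (u v : ℕ → ℝ≥0∞) :
    liminf u atTop + liminf v atTop ≤ liminf (fun j => u j + v j) atTop := by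
  rw [liminf_eq_iSup_iInf_of_nat, liminf_eq_iSup_iInf_of_nat, liminf_eq_iSup_iInf_of_nat,
    ENNReal.iSup_add_iSup_of_monotone]
  · exact iSup_mono fun j => le_iInf₂ fun i hi => add_le_add (iInf₂_le i hi) (iInf₂_le i hi)
  all_goals exact fun a b hab => le_iInf₂ fun i hi => iInf₂_le i (hab.trans hi)

theorem sum_liminf_le {ι : Type*} (t : Finset ι) (u : ι → ℕ → ℝ≥0∞) :
    ∑ i ∈ t, liminf (u i) atTop ≤ liminf (fun a => ∑ i ∈ t, u i a) atTop := by
  classical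
  induction t using Finset.induction_on with
  | empty => simp
  | insert i t hi ih =>
    simp_rw [Finset.sum_insert hi]
    exact (add_le_add_right ih _).trans (liminf_add_liminf_le _ _)

/-- The integral is a supremum over simple functions below the integrand, hence superadditive
without measurability; none is established for expressions in `normalAt`. -/
theorem sum_lintegral_le {ι α : Type*} [MeasurableSpace α] (μ : Measure α) (t : Finset ι)
    (u : ι → α → ℝ≥0∞) : ∑ i ∈ t, ∫⁻ a, u i a ∂μ ≤ ∫⁻ a, ∑ i ∈ t, u i a ∂μ := by
  classical
  induction t using Finset.induction_on with
  | empty => simp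
  | insert i t hi ih =>
    simp_rw [Finset.sum_insert hi]
    exact (add_le_add_right ih _).trans (le_lintegral_add _ _)

theorem IsFreeBoundaryMinimal.isCompact_boundary {n : ℕ} {m : ℝ} {S : Set (Eucl n)}
    (hS : IsFreeBoundaryMinimal n m S) : IsCompact (boundary n m S) := by
  have h : boundary n m S = S ∩ Metric.sphere 0 (horizonRadius n m) := by
    ext x; simp [boundary, horizon]
  rw [h]
  exact (isCompact_sphere _ _).inter_left hS.isClosed

theorem boundary_le_liminf {n : ℕ} {m : ℝ} {S : Set (Eucl n)} (hn : 3 ≤ n) (hm : 0 < m)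
    (hS : IsFreeBoundaryMinimal n m S) {κ : ℝ → ℝ≥0∞} (hκ : Measurable κ)
    (hκ0 : ∀ τ ≤ 0, κ τ = 0) (hκ1 : ∫⁻ τ, κ τ = 1) {B : ℝ → ℝ} (hB : ContinuousOn B (Ioi 0)) :
    ENNReal.ofReal (B (horizonRadius n m)) * μHE[n - 2] (boundary n m S) ≤
      liminf (fun j : ℕ => ∫⁻ x in S,
        ENNReal.ofReal (j + 1) * κ ((j + 1) * (‖x‖ - horizonRadius n m) - 1) *
          (ENNReal.ofReal (B ‖x‖) * ENNReal.ofReal (1 - radialDefect n m S x)) ∂μHE[n - 1])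
        atTop := by
  choose! V hV hpV hVχ using fun p (hp : p ∈ boundary n m S) => exists_collar_nhds hn hm hS hp
  obtain ⟨t, ρ, ht, hsum, hle⟩ := exists_finite_smooth_partition hS.isCompact_boundary hV hpV
  have h1 : ∀ i ∈ t, _ := fun i hi => hVχ i (ht i hi).1 (ρ i) (ht i hi).2.1.continuous
    ((subset_tsupport _).trans (ht i hi).2.2.1) κ hκ hκ0 hκ1 B hB
  have h2 : μHE[n - 2] (boundary n m S) =
      ∑ i ∈ t, ∫⁻ x in boundary n m S, ENNReal.ofReal (ρ i x) ∂μHE[n - 2] := by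
    rw [← lintegral_finsetSum' _ fun i hi =>
      (ht i hi).2.1.continuous.measurable.ennreal_ofReal.aemeasurable, ← setLIntegral_one]
    refine setLIntegral_congr_fun hS.isCompact_boundary.measurableSet fun x hx => ?_
    rw [← ENNReal.ofReal_sum_of_nonneg fun i hi => (ht i hi).2.2.2 x, hsum x hx,
      ENNReal.ofReal_one]
  rw [h2, Finset.mul_sum]
  refine (Finset.sum_le_sum h1).trans ((sum_liminf_le _ _).trans
    (liminf_le_liminf (Eventually.of_forall fun j => ?_)))
  refine (sum_lintegral_le _ _ _).trans (lintegral_mono fun x => ?_)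
  rw [← Finset.mul_sum, ← Finset.mul_sum, ← Finset.sum_mul,
    ← ENNReal.ofReal_sum_of_nonneg fun i hi => (ht i hi).2.2.2 x]
  gcongr
  exact mul_le_of_le_one_left' (ENNReal.ofReal_le_one.2 (hle x))

end Collar

/-! ### The weighted monotonicity inequality -/

section Monotonicity

open Set

theorem hasDerivAt_integral {f : ℝ → ℝ} (hf : Continuous f) (a t : ℝ) :
    HasDerivAt (fun t => ∫ s in a..t, f s) (f t) t :=
  intervalIntegral.integral_hasDerivAt_right (hf.intervalIntegrable _ _)
    hf.aestronglyMeasurable.stronglyMeasurableAtFilter hf.continuousAt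

theorem contDiff_integral {f : ℝ → ℝ} (hf : Continuous f) (a : ℝ) :
    ContDiff ℝ 1 (fun t => ∫ s in a..t, f s) := by
  rw [contDiff_one_iff_deriv]
  refine ⟨fun t => (hasDerivAt_integral hf a t).differentiableAt, ?_⟩
  rwa [show deriv (fun t => ∫ s in a..t, f s) = f from
    funext fun t => (hasDerivAt_integral hf a t).deriv]

/-- A `C¹` function that vanishes for negative arguments and has slope one for large ones. -/
noncomputable def softPos (t : ℝ) : ℝ := ∫ s in (0 : ℝ)..t, max 0 (min s 1)

theorem hasDerivAt_softPos (t : ℝ) : HasDerivAt softPos (max 0 (min t 1)) t :=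
  hasDerivAt_integral (by fun_prop) 0 t

theorem contDiff_softPos : ContDiff ℝ 1 softPos := contDiff_integral (by fun_prop) 0

theorem monotone_softPos : Monotone softPos :=
  monotone_of_hasDerivAt_nonneg hasDerivAt_softPos fun _ => le_max_left _ _

theorem softPos_of_nonpos {t : ℝ} (ht : t ≤ 0) : softPos t = 0 := by
  rw [softPos, intervalIntegral.integral_congr (g := fun _ => (0 : ℝ))]
  · simp
  · intro s hs
    rw [uIcc_of_ge ht] at hs
    simp [hs.2]

theorem softPos_nonneg (t : ℝ) : 0 ≤ softPos t := by
  rcases le_total t 0 with h | h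
  · rw [softPos_of_nonpos h]
  · rw [← softPos_of_nonpos le_rfl]; exact monotone_softPos h

/-- Smoothing the positive part loses at most one, which is negligible against volumes tending to
infinity. -/
theorem sub_one_le_softPos (t : ℝ) : t - 1 ≤ softPos t := by
  rcases le_total t 1 with h | h
  · exact (sub_nonpos.2 h).trans (softPos_nonneg t)
  · have hc : Continuous fun s : ℝ => max 0 (min s 1) := by fun_prop
    have h1 : softPos t = softPos 1 + ∫ s in (1 : ℝ)..t, max 0 (min s 1) :=
      (intervalIntegral.integral_add_adjacent_intervals (hc.intervalIntegrable _ _)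
        (hc.intervalIntegrable _ _)).symm
    have h2 : ∫ s in (1 : ℝ)..t, max 0 (min s 1) = t - 1 := by
      rw [intervalIntegral.integral_congr (g := fun _ => (1 : ℝ))]
      · simp
      · intro s hs
        rw [uIcc_of_le h] at hs
        simp [hs.1]
    linarith [softPos_nonneg 1]

theorem deriv_smoothTransition_of_nonpos {t : ℝ} (ht : t ≤ 0) :
    deriv Real.smoothTransition t = 0 :=
  IsLocalMin.deriv_eq_zero (Eventually.of_forall fun s => by
    rw [Real.smoothTransition.zero_of_nonpos ht]; exact Real.smoothTransition.nonneg s)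

theorem deriv_smoothTransition_of_one_le {t : ℝ} (ht : 1 ≤ t) :
    deriv Real.smoothTransition t = 0 :=
  IsLocalMax.deriv_eq_zero (Eventually.of_forall fun s => by
    rw [Real.smoothTransition.one_of_one_le ht]; exact Real.smoothTransition.le_one s)

theorem deriv_smoothTransition_nonneg (t : ℝ) : 0 ≤ deriv Real.smoothTransition t :=
  Real.smoothTransition.monotone.deriv_nonneg

theorem continuous_deriv_smoothTransition : Continuous (deriv Real.smoothTransition) :=
  (Real.smoothTransition.contDiff (n := 1)).continuous_deriv (by simp)

theorem hasDerivAt_smoothTransition (t : ℝ) :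
    HasDerivAt Real.smoothTransition (deriv Real.smoothTransition t) t :=
  ((Real.smoothTransition.contDiff (n := 1)).differentiable (by simp) t).hasDerivAt

theorem lintegral_deriv_smoothTransition :
    ∫⁻ t, ENNReal.ofReal (deriv Real.smoothTransition t) = 1 := by
  have h0 : (fun t => ENNReal.ofReal (deriv Real.smoothTransition t)) =
      (Ioc 0 1).indicator fun t => ENNReal.ofReal (deriv Real.smoothTransition t) := by
    ext t
    by_cases ht : t ∈ Ioc (0 : ℝ) 1
    · rw [indicator_of_mem ht]
    · rw [indicator_of_notMem ht]
      rcases le_or_gt t 0 with h | h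
      · simp [deriv_smoothTransition_of_nonpos h]
      · have h1 : 1 ≤ t := by
          by_contra h2; exact ht ⟨h, (not_le.1 h2).le⟩
        simp [deriv_smoothTransition_of_one_le h1]
  rw [h0, lintegral_indicator measurableSet_Ioc,
    ← ofReal_integral_eq_lintegral_ofReal
      (continuous_deriv_smoothTransition.integrableOn_Ioc)
      (Eventually.of_forall deriv_smoothTransition_nonneg),
    ← intervalIntegral.integral_of_le zero_le_one,
    intervalIntegral.integral_eq_sub_of_hasDerivAt (fun t _ => hasDerivAt_smoothTransition t)
      (continuous_deriv_smoothTransition.intervalIntegrable _ _)]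
  simp

variable {n : ℕ} {m : ℝ} {S : Set (Eucl n)}

/-- The Schwarzschild area density of a cone, in isotropic coordinates, at radius
`max r R₀`. -/
noncomputable def coneDensity (n : ℕ) (m r : ℝ) : ℝ :=
  max r (horizonRadius n m) ^ (n - 2) * radialFactor n m (max r (horizonRadius n m)) ^ (n - 1)

/-- The Schwarzschild volume up to radius `r` of a cone over a hypersurface of unit volume. -/
noncomputable def coneVolume (n : ℕ) (m r : ℝ) : ℝ :=
  ∫ s in horizonRadius n m..r, coneDensity n m s

theorem continuousOn_radialFactor (hn : 3 ≤ n) (hm : 0 < m) :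
    ContinuousOn (radialFactor n m) (Ioi 0) := fun _ hr =>
  (hasDerivAt_radialFactor hn hm hr).continuousAt.continuousWithinAt

theorem continuous_radialFactor_max (hn : 3 ≤ n) (hm : 0 < m) :
    Continuous fun r => radialFactor n m (max r (horizonRadius n m)) :=
  (continuousOn_radialFactor hn hm).comp_continuous (by fun_prop) fun _ =>
    lt_max_of_lt_right (horizonRadius_pos hm)

theorem one_le_radialFactor (hn : 3 ≤ n) (hm : 0 < m) {r : ℝ} (hr : 0 < r) :
    1 ≤ radialFactor n m r := by
  have hn' : (3 : ℝ) ≤ n := by exact_mod_cast hn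
  refine Real.one_le_rpow ?_ (div_nonneg two_pos.le (by linarith))
  have : 0 ≤ m / (2 * r ^ (n - 2)) := by positivity
  linarith

theorem continuous_coneDensity (hn : 3 ≤ n) (hm : 0 < m) : Continuous (coneDensity n m) :=
  (by fun_prop : Continuous fun r => max r (horizonRadius n m) ^ (n - 2)).mul
    ((continuous_radialFactor_max hn hm).pow _)

theorem coneDensity_of_le {r : ℝ} (hr : horizonRadius n m ≤ r) :
    coneDensity n m r = r ^ (n - 2) * radialFactor n m r ^ (n - 1) := by
  rw [coneDensity, max_eq_left hr]

theorem coneDensity_pos (hm : 0 < m) (r : ℝ) : 0 < coneDensity n m r := by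
  have h : 0 < max r (horizonRadius n m) := lt_max_of_lt_right (horizonRadius_pos hm)
  have := radialFactor_pos (n := n) hm h
  rw [coneDensity]
  positivity

theorem hasDerivAt_coneVolume (hn : 3 ≤ n) (hm : 0 < m) (r : ℝ) :
    HasDerivAt (coneVolume n m) (coneDensity n m r) r :=
  hasDerivAt_integral (continuous_coneDensity hn hm) _ r

theorem contDiff_coneVolume (hn : 3 ≤ n) (hm : 0 < m) : ContDiff ℝ 1 (coneVolume n m) :=
  contDiff_integral (continuous_coneDensity hn hm) _

theorem strictMono_coneVolume (hn : 3 ≤ n) (hm : 0 < m) : StrictMono (coneVolume n m) :=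
  strictMono_of_hasDerivAt_pos (hasDerivAt_coneVolume hn hm) fun r => coneDensity_pos hm r

theorem coneVolume_horizonRadius : coneVolume n m (horizonRadius n m) = 0 :=
  intervalIntegral.integral_same

theorem tendsto_coneVolume (hn : 3 ≤ n) (hm : 0 < m) :
    Tendsto (coneVolume n m) atTop atTop := by
  have hR := horizonRadius_pos (n := n) hm
  have hd : ∀ s, horizonRadius n m ^ (n - 2) ≤ coneDensity n m s := fun s => by
    have h0 : horizonRadius n m ≤ max s (horizonRadius n m) := le_max_right _ _
    have h1 := one_le_pow₀ (one_le_radialFactor hn hm (hR.trans_le h0)) (n := n - 1)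
    have h2 := pow_le_pow_left₀ hR.le h0 (n - 2)
    rw [coneDensity]
    nlinarith [pow_pos hR (n - 2)]
  have hl : ∀ r, horizonRadius n m ≤ r →
      (r - horizonRadius n m) * horizonRadius n m ^ (n - 2) ≤ coneVolume n m r := fun r hr => by
    have := intervalIntegral.integral_mono_on hr
      ((continuous_const (y := horizonRadius n m ^ (n - 2))).intervalIntegrable (μ := volume) _ _)
      ((continuous_coneDensity hn hm).intervalIntegrable _ _) (fun s _ => hd s)
    rwa [intervalIntegral.integral_const, smul_eq_mul] at this
  refine tendsto_atTop_mono' _ (eventually_ge_atTop (horizonRadius n m) |>.mono hl) ?_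
  exact (tendsto_atTop_add_const_right _ _ tendsto_id).atTop_mul_const (pow_pos hR _)

theorem norm_normalAt_le (x : Eucl n) : ‖normalAt n m S x‖ ≤ 1 := by
  rw [normalAt]
  split_ifs with h
  · exact (norm_euclNormal (h.choose_spec.choose_spec.2.gradient_ne x
      h.choose_spec.choose_spec.1)).le
  · simp

theorem radialDefect_nonneg (x : Eucl n) : 0 ≤ radialDefect n m S x := by
  rw [radialDefect]; positivity

theorem radialDefect_le_one (x : Eucl n) : radialDefect n m S x ≤ 1 := by
  rw [radialDefect]
  refine div_le_one_of_le₀ ?_ (by positivity)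
  rw [sq_le_sq, abs_norm]
  calc |inner ℝ x (normalAt n m S x)| ≤ ‖x‖ * ‖normalAt n m S x‖ := abs_real_inner_le_norm _ _
    _ ≤ ‖x‖ * 1 := by gcongr; exact norm_normalAt_le x
    _ = ‖x‖ := mul_one _

theorem decayRate_le_one (hn : 3 ≤ n) (hm : 0 < m) {r : ℝ} (hr : horizonRadius n m ≤ r) :
    decayRate n m r ≤ 1 := by
  have h1 := pow_le_pow_left₀ (horizonRadius_pos hm).le hr (n - 2)
  rw [horizonRadius_pow hn hm] at h1
  rw [decayRate, div_le_one (by linarith)]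
  linarith

/-- The defect of monotonicity on `S` between the radii `a` and `b`. -/
noncomputable def defectIntegral (n : ℕ) (m : ℝ) (S : Set (Eucl n)) (a b : ℝ) : ℝ≥0∞ :=
  ∫⁻ x in S ∩ {x | a ≤ ‖x‖ ∧ ‖x‖ ≤ b}, ENNReal.ofReal (((n : ℝ) - 1) / ‖x‖ ^ (n - 1) *
    (1 - decayRate n m ‖x‖) * radialDefect n m S x) ∂μHE[n - 1]

/-- The monotonicity inequality before normalization: `radial_first_variation` for c = k ψ, where k'
ψ produces the boundary term, k ψ' is paid for by the area, and the remaining term bounds the defect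
from above. -/
theorem boundary_add_defect_le (hn : 3 ≤ n) (hm : 0 < m) (hS : IsFreeBoundaryMinimal n m S)
    {a b : ℝ} (ha : horizonRadius n m < a) (R : ℝ) :
    ENNReal.ofReal ((coneVolume n m R - 1) / horizonRadius n m ^ (n - 2)) *
        μHE[n - 2] (boundary n m S) +
      ENNReal.ofReal (coneVolume n m R - coneVolume n m b - 1) * defectIntegral n m S a b ≤
    ∫⁻ x in S ∩ {x | ‖x‖ ≤ R}, ENNReal.ofReal (confFactor n m x ^ (n - 1)) ∂μHE[n - 1] := by
  set R₀ := horizonRadius n m with hR₀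
  have hR₀p : 0 < R₀ := horizonRadius_pos hm
  set A := ∫⁻ x in S ∩ {x | ‖x‖ ≤ R}, ENNReal.ofReal (confFactor n m x ^ (n - 1)) ∂μHE[n - 1]
    with hA
  -- Local finiteness of the area of `S` is not presupposed: with infinite area there is nothing to
  -- prove, and with finite area the density is integrable and can be added to the first variation.
  by_cases hAtop : A = ⊤
  · rw [hAtop]; exact le_top
  have hn1 : (0 : ℝ) ≤ (n : ℝ) - 1 := by
    have : (3 : ℝ) ≤ n := by exact_mod_cast hn
    linarith
  have hSm := hS.isClosed.measurableSet
  set g : Eucl n → ℝ := {x | ‖x‖ ≤ R}.indicator fun x => confFactor n m x ^ (n - 1) with hg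
  have hball : MeasurableSet {x : Eucl n | ‖x‖ ≤ R} :=
    (isClosed_le continuous_norm continuous_const).measurableSet
  have hcf : ContinuousOn (confFactor n m) {x | x ≠ 0} := fun x hx =>
    (hasFDerivAt_confFactor hn hm hx).continuousAt.continuousWithinAt
  have hS0 : ∀ x ∈ S, 0 < ‖x‖ := fun x hx => hR₀p.trans_le (hS.subset hx)
  have hgpos : ∀ x ∈ S, 0 ≤ g x := fun x hx => by
    refine indicator_apply_nonneg fun _ => ?_
    exact pow_nonneg (radialFactor_pos hm (hS0 x hx)).le _
  have hgm : AEStronglyMeasurable g (μHE[n - 1].restrict S) := by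
    refine AEStronglyMeasurable.indicator ?_ hball
    exact ((hcf.mono fun x hx => norm_pos_iff.1 (hS0 x hx)).pow _).aestronglyMeasurable hSm
  have hgl : ∫⁻ x in S, ENNReal.ofReal (g x) ∂μHE[n - 1] = A := by
    rw [hA, inter_comm, ← setLIntegral_indicator hball]
    refine lintegral_congr fun x => ?_
    by_cases hx : x ∈ {x : Eucl n | ‖x‖ ≤ R}
    · rw [hg, indicator_of_mem hx, indicator_of_mem hx]
    · rw [hg, indicator_of_notMem hx, indicator_of_notMem hx, ENNReal.ofReal_zero]
  have hgae : 0 ≤ᵐ[μHE[n - 1].restrict S] g := by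
    filter_upwards [ae_restrict_mem hSm] with x hx using hgpos x hx
  have hgi : IntegrableOn g S μHE[n - 1] := by
    refine ⟨hgm, ?_⟩
    rw [hasFiniteIntegral_iff_ofReal hgae, hgl]
    exact lt_top_iff_ne_top.2 hAtop
  set V := coneVolume n m
  -- A C¹ substitute for (V(R) - V(r))₊, zero for r ≥ R and with slope between -V' and 0.
  set ψ : ℝ → ℝ := fun r => softPos (V R - V r) with hψ
  have hψd : ∀ r, HasDerivAt ψ (-(max 0 (min (V R - V r) 1) * coneDensity n m r)) r := fun r => by
    have := (hasDerivAt_softPos (V R - V r)).comp r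
      ((hasDerivAt_coneVolume hn hm r).const_sub (V R))
    rw [mul_neg] at this
    exact this
  have hψc : ContDiff ℝ 1 ψ :=
    contDiff_softPos.comp (contDiff_const.sub (contDiff_coneVolume hn hm))
  have hψ0 : ∀ r, 0 ≤ ψ r := fun r => softPos_nonneg _
  set B : ℝ → ℝ := fun r => ψ r / r ^ (n - 2) with hB
  have hBc : ContinuousOn B (Ioi 0) := hψc.continuous.continuousOn.div
    (continuous_pow _).continuousOn fun r hr => (pow_pos hr _).ne'
  have hcol := boundary_le_liminf hn hm hS
    (κ := fun t => ENNReal.ofReal (deriv Real.smoothTransition t))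
    continuous_deriv_smoothTransition.measurable.ennreal_ofReal
    (fun t ht => by rw [deriv_smoothTransition_of_nonpos ht, ENNReal.ofReal_zero])
    lintegral_deriv_smoothTransition hBc
  have hBR : (V R - 1) / R₀ ^ (n - 2) ≤ B R₀ := by
    have h1 := sub_one_le_softPos (V R - V R₀)
    rw [show V R₀ = 0 from coneVolume_horizonRadius, sub_zero] at h1
    simp only [hB, hψ]
    rw [show V R₀ = 0 from coneVolume_horizonRadius, sub_zero]
    gcongr
  have hcol' := (mul_le_mul_left (ENNReal.ofReal_le_ofReal hBR)
    (μHE[n - 2] (boundary n m S))).trans hcol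
  refine (add_le_add_left hcol' _).trans ?_
  set Q := ENNReal.ofReal (V R - V b - 1) * defectIntegral n m S a b with hQ
  set u : ℕ → ℝ≥0∞ := fun j => ∫⁻ x in S, ENNReal.ofReal (j + 1) *
    ENNReal.ofReal (deriv Real.smoothTransition ((j + 1) * (‖x‖ - R₀) - 1)) *
          (ENNReal.ofReal (B ‖x‖) * ENNReal.ofReal (1 - radialDefect n m S x)) ∂μHE[n - 1]
  suffices h : ∀ᶠ j in atTop, u j + Q ≤ A by
    have h1 : liminf u atTop + liminf (fun _ : ℕ => Q) atTop ≤
      liminf (fun j => u j + Q) atTop := liminf_add_liminf_le _ _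
    rw [liminf_const] at h1
    refine h1.trans ?_
    have h2 := liminf_le_liminf (f := atTop) (u := fun j => u j + Q) (v := fun _ => A) h
    rwa [liminf_const] at h2
  -- From j₀ on, the transition of the cutoff ends before the radius `a`, so the cutoff is 1 on the
  -- shell of the defect.
  obtain ⟨j₀, hj₀⟩ := exists_nat_gt (2 / (a - R₀))
  filter_upwards [eventually_ge_atTop j₀] with j hj
  -- Zero for r ≤ R₀ + 1/(j+1) and one for r ≥ R₀ + 2/(j+1); its derivative is the kernel in the
  -- collar estimate.
  set k : ℝ → ℝ := fun r => Real.smoothTransition ((j + 1) * (r - R₀) - 1) with hk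
  have hj1 : (0 : ℝ) < j + 1 := by positivity
  have hkd : ∀ r, HasDerivAt k
      ((j + 1) * deriv Real.smoothTransition ((j + 1) * (r - R₀) - 1)) r := fun r => by
    have h1 : HasDerivAt (fun r : ℝ => ((j : ℝ) + 1) * (r - R₀) - 1) (j + 1) r := by
      simpa using (((hasDerivAt_id r).sub_const R₀).const_mul ((j : ℝ) + 1)).sub_const 1
    have := (hasDerivAt_smoothTransition _).comp r h1
    rwa [mul_comm] at this
  have hkc : ContDiff ℝ 1 k := (Real.smoothTransition.contDiff (n := 1)).comp (by fun_prop)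
  have hk0 : ∀ r, 0 ≤ k r := fun r => Real.smoothTransition.nonneg _
  have hk1 : ∀ r, k r ≤ 1 := fun r => Real.smoothTransition.le_one _
  set c : ℝ → ℝ := fun r => k r * ψ r with hc
  obtain ⟨hI, hI0⟩ := radial_first_variation hn hm hS (c := c) (hkc.mul hψc)
    (a := R₀ + 1 / (j + 1)) (b := R) (lt_add_of_pos_right _ (by positivity)) (by
      intro r hr
      have : ((j : ℝ) + 1) * (r - R₀) - 1 ≤ 0 := by
        have h1 : r - R₀ ≤ 1 / ((j : ℝ) + 1) := by linarith
        have h2 := mul_le_mul_of_nonneg_left h1 hj1.le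
        rw [mul_one_div_cancel hj1.ne'] at h2
        linarith
      simp only [hc, hk, Real.smoothTransition.zero_of_nonpos this, zero_mul]) (by
      intro r hr
      have : V R - V r ≤ 0 := sub_nonpos.2 ((strictMono_coneVolume hn hm).monotone hr.le)
      simp only [hc, hψ, softPos_of_nonpos this, mul_zero])
  set I : Eucl n → ℝ := fun x => deriv c ‖x‖ / ‖x‖ ^ (n - 2) * (1 - radialDefect n m S x) +
      ((n : ℝ) - 1) * (c ‖x‖ / ‖x‖ ^ (n - 1)) * (1 - decayRate n m ‖x‖) * radialDefect n m S x
    with hIdef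
  set A₁ : Eucl n → ℝ := fun x => (j + 1) * deriv Real.smoothTransition ((j + 1) * (‖x‖ - R₀) - 1)
    * (B ‖x‖ * (1 - radialDefect n m S x)) with hA₁
  set A₂ : Eucl n → ℝ := fun x => ((n : ℝ) - 1) * (c ‖x‖ / ‖x‖ ^ (n - 1)) *
    (1 - decayRate n m ‖x‖) * radialDefect n m S x with hA₂
  have hA₁0 : ∀ x ∈ S, 0 ≤ A₁ x := fun x hx => by
    have := hS0 x hx
    have h1 := deriv_smoothTransition_nonneg (((j : ℝ) + 1) * (‖x‖ - R₀) - 1)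
    have h2 := hψ0 ‖x‖
    have h3 := sub_nonneg.2 (radialDefect_le_one (n := n) (m := m) (S := S) x)
    simp only [hA₁, hB]
    positivity
  have hA₂0 : ∀ x ∈ S, 0 ≤ A₂ x := fun x hx => by
    have := hS0 x hx
    have h1 := mul_nonneg (hk0 ‖x‖) (hψ0 ‖x‖)
    have h2 := sub_nonneg.2 (decayRate_le_one hn hm (hS.subset hx))
    have h3 := radialDefect_nonneg (n := n) (m := m) (S := S) x
    simp only [hA₂, hc]
    positivity
  -- In c' = k' ψ + k ψ' the first summand is `A₁`. The second, divided by r^(n-2), has size at most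
  -- F^(n-1) on r ≤ R because V' = r^(n-2) F^(n-1), and is absorbed by `g`.
  have hAI : ∀ x ∈ S, A₁ x + A₂ x ≤ I x + g x := fun x hx => by
    have hr := hS0 x hx
    have hrR : R₀ ≤ ‖x‖ := hS.subset hx
    have h3 := sub_nonneg.2 (radialDefect_le_one (n := n) (m := m) (S := S) x)
    have h4 := radialDefect_nonneg (n := n) (m := m) (S := S) x
    have hcd : deriv c ‖x‖ = (j + 1) * deriv Real.smoothTransition ((j + 1) * (‖x‖ - R₀) - 1) *
        ψ ‖x‖ + k ‖x‖ * -(max 0 (min (V R - V ‖x‖) 1) * coneDensity n m ‖x‖) :=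
      ((hkd ‖x‖).mul (hψd ‖x‖)).deriv
    have hIx : I x = A₁ x + A₂ x - k ‖x‖ * max 0 (min (V R - V ‖x‖) 1) *
        (radialFactor n m ‖x‖ ^ (n - 1) * (1 - radialDefect n m S x)) := by
      simp only [hIdef, hA₁, hA₂, hB, hcd, coneDensity_of_le hrR]
      field_simp
      ring
    rw [hIx]
    suffices h : k ‖x‖ * max 0 (min (V R - V ‖x‖) 1) *
        (radialFactor n m ‖x‖ ^ (n - 1) * (1 - radialDefect n m S x)) ≤ g x by linarith
    have hF : 0 ≤ radialFactor n m ‖x‖ ^ (n - 1) := pow_nonneg (radialFactor_pos hm hr).le _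
    by_cases hxR : x ∈ {x : Eucl n | ‖x‖ ≤ R}
    · rw [hg, indicator_of_mem hxR, confFactor_eq]
      have h5 : max 0 (min (V R - V ‖x‖) 1) ≤ 1 := max_le zero_le_one (min_le_right _ _)
      have h6 : k ‖x‖ * max 0 (min (V R - V ‖x‖) 1) ≤ 1 :=
        mul_le_one₀ (hk1 _) (le_max_left _ _) h5
      have h7 : radialFactor n m ‖x‖ ^ (n - 1) * (1 - radialDefect n m S x) ≤
        radialFactor n m ‖x‖ ^ (n - 1) := mul_le_of_le_one_right hF (by linarith)
      exact (mul_le_of_le_one_left (mul_nonneg hF h3) h6).trans h7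
    · have h5 : V R - V ‖x‖ ≤ 0 :=
        sub_nonpos.2 ((strictMono_coneVolume hn hm).monotone (not_le.1 hxR).le)
      rw [hg, indicator_of_notMem hxR, max_eq_left ((min_le_left _ _).trans h5)]
      simp
  have hu : u j = ∫⁻ x in S, ENNReal.ofReal (A₁ x) ∂μHE[n - 1] := by
    refine setLIntegral_congr_fun hSm fun x hx => ?_
    have := hS0 x hx
    have h1 := deriv_smoothTransition_nonneg (((j : ℝ) + 1) * (‖x‖ - R₀) - 1)
    have h2 := hψ0 ‖x‖
    have h3 : 0 ≤ B ‖x‖ := by simp only [hB]; positivity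
    simp only [hA₁]
    rw [ENNReal.ofReal_mul (by positivity), ENNReal.ofReal_mul hj1.le, ENNReal.ofReal_mul h3]
  have hQ2 : Q ≤ ∫⁻ x in S, ENNReal.ofReal (A₂ x) ∂μHE[n - 1] := by
    rw [hQ, defectIntegral, ← lintegral_const_mul' _ _ ENNReal.ofReal_ne_top]
    refine le_trans (setLIntegral_mono' ?_ ?_) (lintegral_mono_set inter_subset_left)
    · exact hSm.inter ((isClosed_le continuous_const continuous_norm).inter
        (isClosed_le continuous_norm continuous_const)).measurableSet
    · rintro x ⟨hx, hax, hxb⟩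
      have hr := hS0 x hx
      have hkx : k ‖x‖ = 1 := by
        refine Real.smoothTransition.one_of_one_le ?_
        have hj' : (j₀ : ℝ) ≤ j := by exact_mod_cast hj
        have h1 : 2 / (a - R₀) ≤ (j : ℝ) + 1 := by linarith
        rw [div_le_iff₀ (sub_pos.2 ha)] at h1
        have h2 : ((j : ℝ) + 1) * (a - R₀) ≤ (j + 1) * (‖x‖ - R₀) := by gcongr
        linarith
      have hψx : V R - V b - 1 ≤ ψ ‖x‖ := by
        have h1 := sub_one_le_softPos (V R - V ‖x‖)
        have h2 : V ‖x‖ ≤ V b := (strictMono_coneVolume hn hm).monotone hxb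
        simp only [hψ]
        linarith
      have h2 := sub_nonneg.2 (decayRate_le_one hn hm (hS.subset hx))
      have h3 := radialDefect_nonneg (n := n) (m := m) (S := S) x
      have h4 : 0 ≤ ((n : ℝ) - 1) / ‖x‖ ^ (n - 1) * (1 - decayRate n m ‖x‖) *
        radialDefect n m S x := by positivity
      rw [← ENNReal.ofReal_mul' h4]
      refine ENNReal.ofReal_le_ofReal ((mul_le_mul_of_nonneg_right hψx h4).trans_eq ?_)
      simp only [hA₂, hc, hkx]
      ring
  calc u j + Q ≤ ∫⁻ x in S, ENNReal.ofReal (A₁ x) ∂μHE[n - 1] +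
        ∫⁻ x in S, ENNReal.ofReal (A₂ x) ∂μHE[n - 1] := add_le_add hu.le hQ2
    _ ≤ ∫⁻ x in S, (ENNReal.ofReal (A₁ x) + ENNReal.ofReal (A₂ x)) ∂μHE[n - 1] :=
        le_lintegral_add _ _
    _ ≤ ∫⁻ x in S, ENNReal.ofReal (I x + g x) ∂μHE[n - 1] := by
        refine setLIntegral_mono' hSm fun x hx => ?_
        rw [← ENNReal.ofReal_add (hA₁0 x hx) (hA₂0 x hx)]
        exact ENNReal.ofReal_le_ofReal (hAI x hx)
    _ = ENNReal.ofReal (∫ x in S, (I x + g x) ∂μHE[n - 1]) := by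
        refine (ofReal_integral_eq_lintegral_ofReal (hI.add hgi) ?_).symm
        filter_upwards [ae_restrict_mem hSm] with x hx
        exact (add_nonneg (hA₁0 x hx) (hA₂0 x hx)).trans (hAI x hx)
    _ = ENNReal.ofReal (∫ x in S, g x ∂μHE[n - 1]) := by
        rw [integral_add hI hgi, hI0, zero_add]
    _ = A := by rw [ofReal_integral_eq_lintegral_ofReal hgi hgae, hgl]

end Monotonicity

/-! ### The distance to the horizon -/

section Distance

open Set

variable {n : ℕ} {m : ℝ}

/-- The Schwarzschild distance to the horizon as a function of the isotropic radius. -/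
noncomputable def radialDist (n : ℕ) (m r : ℝ) : ℝ :=
  ∫ s in horizonRadius n m..r, radialFactor n m (max s (horizonRadius n m))

theorem hasDerivAt_radialDist (hn : 3 ≤ n) (hm : 0 < m) (r : ℝ) :
    HasDerivAt (radialDist n m) (radialFactor n m (max r (horizonRadius n m))) r :=
  hasDerivAt_integral (continuous_radialFactor_max hn hm) _ r

theorem strictMono_radialDist (hn : 3 ≤ n) (hm : 0 < m) : StrictMono (radialDist n m) :=
  strictMono_of_hasDerivAt_pos (hasDerivAt_radialDist hn hm) fun _ =>
    radialFactor_pos hm (lt_max_of_lt_right (horizonRadius_pos hm))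

theorem tendsto_radialDist (hn : 3 ≤ n) (hm : 0 < m) :
    Tendsto (radialDist n m) atTop atTop := by
  have hl : ∀ r, horizonRadius n m ≤ r → r - horizonRadius n m ≤ radialDist n m r := fun r hr => by
    have := intervalIntegral.integral_mono_on hr
      ((continuous_const (y := (1 : ℝ))).intervalIntegrable (μ := volume) _ _)
      ((continuous_radialFactor_max hn hm).intervalIntegrable _ _)
      (fun s _ => one_le_radialFactor hn hm (lt_max_of_lt_right (horizonRadius_pos hm)))
    rwa [intervalIntegral.integral_const, smul_eq_mul, mul_one] at this
  exact tendsto_atTop_mono' _ (eventually_ge_atTop (horizonRadius n m) |>.mono hl)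
    (tendsto_atTop_add_const_right _ _ tendsto_id)

theorem sqrt_metric (hm : 0 < m) {x : Eucl n} (hx : x ∈ space n m) (v : Eucl n) :
    √(metric n m x v v) = radialFactor n m ‖x‖ * ‖v‖ := by
  have h : 0 < ‖x‖ := (horizonRadius_pos hm).trans_le hx
  rw [metric, real_inner_self_eq_norm_sq, ← mul_pow, confFactor_eq,
    Real.sqrt_sq (mul_nonneg (radialFactor_pos hm h).le (norm_nonneg v))]

/-- The derivative of `radialDist` along the norm of γ is F times the radial velocity, at most the
Schwarzschild speed F |γ'|. -/
theorem radialDist_le_curveLength (hn : 3 ≤ n) (hm : 0 < m) {γ : ℝ → Eucl n}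
    (hγ : ContDiffOn ℝ 1 γ (Icc 0 1)) (hγs : ∀ t ∈ Icc (0 : ℝ) 1, γ t ∈ space n m)
    (h0 : γ 0 ∈ horizon n m) : radialDist n m ‖γ 1‖ ≤ curveLength n m γ := by
  have hR := horizonRadius_pos (n := n) hm
  have hD0 : radialDist n m ‖γ 0‖ = 0 := by
    rw [show ‖γ 0‖ = horizonRadius n m from h0]; exact intervalIntegral.integral_same
  have hne : ∀ t ∈ Icc (0 : ℝ) 1, γ t ≠ 0 := fun t ht =>
    norm_pos_iff.1 (hR.trans_le (hγs t ht))
  have hd : ∀ t ∈ Ioo (0 : ℝ) 1, HasDerivAt γ (deriv γ t) t := fun t ht =>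
    ((hγ.contDiffAt (Icc_mem_nhds ht.1 ht.2)).differentiableAt (by simp)).hasDerivAt
  have hder : ∀ t ∈ Ioo (0 : ℝ) 1, HasDerivAt (fun t => radialDist n m ‖γ t‖)
      (radialFactor n m ‖γ t‖ * (inner ℝ (γ t) (deriv γ t) / ‖γ t‖)) t := fun t ht => by
    have ht' := Ioo_subset_Icc_self ht
    have h1 := hasFDerivAt_norm_comp (hne t ht') (hasDerivAt_radialDist hn hm ‖γ t‖)
    have h2 := h1.comp_hasDerivAt t (hd t ht)
    rw [max_eq_left (hγs t ht')] at h2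
    refine h2.congr_deriv ?_
    simp only [smul_apply, innerSL_apply_apply, smul_eq_mul]
    ring
  have hcont : ContinuousOn (fun t => radialDist n m ‖γ t‖) (Icc 0 1) :=
    (continuous_iff_continuousAt.2 fun r =>
      (hasDerivAt_radialDist hn hm r).continuousAt).comp_continuousOn hγ.continuousOn.norm
  -- Nothing is known about `deriv γ` at the endpoints; the one-sided `derivWithin` is continuous on
  -- the closed interval and agrees with it inside.
  have hint : IntegrableOn (fun t => √(metric n m (γ t) (deriv γ t) (deriv γ t))) (Icc 0 1) := by
    have h1 : ContinuousOn (fun t => radialFactor n m ‖γ t‖ * ‖derivWithin γ (Icc 0 1) t‖)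
        (Icc 0 1) :=
      ((continuousOn_radialFactor hn hm).comp hγ.continuousOn.norm fun t ht =>
        hR.trans_le (hγs t ht)).mul
        (hγ.continuousOn_derivWithin (uniqueDiffOn_Icc zero_lt_one) (by simp)).norm
    rw [integrableOn_Icc_iff_integrableOn_Ioo]
    refine ((h1.integrableOn_Icc).mono_set Ioo_subset_Icc_self).congr_fun (fun t ht => ?_)
      measurableSet_Ioo
    simp only
    rw [sqrt_metric hm (hγs t (Ioo_subset_Icc_self ht)),
      derivWithin_of_mem_nhds (Icc_mem_nhds ht.1 ht.2)]
  have := intervalIntegral.sub_le_integral_of_hasDeriv_right_of_le zero_le_one hcont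
    (fun t ht => (hder t ht).hasDerivWithinAt) hint (fun t ht => by
      have ht' := Ioo_subset_Icc_self ht
      have hp : 0 < ‖γ t‖ := hR.trans_le (hγs t ht')
      rw [sqrt_metric hm (hγs t ht')]
      refine mul_le_mul_of_nonneg_left ?_ (radialFactor_pos hm hp).le
      rw [div_le_iff₀ hp, mul_comm]
      exact real_inner_le_norm _ _)
  rwa [hD0, sub_zero] at this

/-- The radial segment from the horizon, with the radius as an affine function of the parameter,
attains the lower bound. -/
theorem exists_curve_radialDist (hm : 0 < m) {x : Eucl n} (hx : x ∈ space n m) :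
    ∃ γ : ℝ → Eucl n, ContDiffOn ℝ 1 γ (Icc 0 1) ∧ (∀ t ∈ Icc (0 : ℝ) 1, γ t ∈ space n m) ∧
      γ 0 ∈ horizon n m ∧ γ 1 = x ∧ radialDist n m ‖x‖ = curveLength n m γ := by
  set R := horizonRadius n m with hR
  have hRp : 0 < R := horizonRadius_pos hm
  have hx' : R ≤ ‖x‖ := hx
  have hr : 0 < ‖x‖ := hRp.trans_le hx'
  set γ : ℝ → Eucl n := fun t => ((R + (‖x‖ - R) * t) / ‖x‖) • x with hγ
  have hnorm : ∀ t ∈ Icc (0 : ℝ) 1, ‖γ t‖ = R + (‖x‖ - R) * t := fun t ht => by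
    have : 0 ≤ R + (‖x‖ - R) * t :=
      add_nonneg hRp.le (mul_nonneg (sub_nonneg.2 hx') ht.1)
    rw [hγ, norm_smul, norm_div, norm_norm, Real.norm_of_nonneg this, div_mul_cancel₀ _ hr.ne']
  have hs : ∀ t ∈ Icc (0 : ℝ) 1, γ t ∈ space n m := fun t ht => by
    change R ≤ ‖γ t‖
    rw [hnorm t ht]
    exact le_add_of_nonneg_right (mul_nonneg (sub_nonneg.2 hx') ht.1)
  have hd : ∀ t, deriv γ t = ((‖x‖ - R) / ‖x‖) • x := fun t => by
    have h1 : HasDerivAt (fun t : ℝ => (R + (‖x‖ - R) * t) / ‖x‖) ((‖x‖ - R) / ‖x‖) t := by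
      simpa using (((hasDerivAt_id t).const_mul (‖x‖ - R)).const_add R).div_const ‖x‖
    exact (h1.smul_const x).deriv
  refine ⟨γ, ContDiff.contDiffOn (by fun_prop), hs, ?_, ?_, ?_⟩
  · change ‖γ 0‖ = R
    rw [hnorm 0 (by simp)]; simp
  · simp [hγ, hr.ne']
  · have h1 : curveLength n m γ =
        ∫ t in (0 : ℝ)..1, (‖x‖ - R) * radialFactor n m (max (R + (‖x‖ - R) * t) R) := by
      refine intervalIntegral.integral_congr fun t ht => ?_
      rw [uIcc_of_le zero_le_one] at ht
      have h2 : R ≤ R + (‖x‖ - R) * t :=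
        le_add_of_nonneg_right (mul_nonneg (sub_nonneg.2 hx') ht.1)
      rw [sqrt_metric hm (hs t ht), hnorm t ht, max_eq_left h2, hd, norm_smul, norm_div, norm_norm,
        Real.norm_of_nonneg (sub_nonneg.2 hx'), div_mul_cancel₀ _ hr.ne', mul_comm]
    rw [h1, intervalIntegral.integral_const_mul, ← smul_eq_mul,
      intervalIntegral.smul_integral_comp_add_mul (fun s => radialFactor n m (max s R)), radialDist,
      mul_zero, add_zero, mul_one, add_sub_cancel]

theorem distHorizon_eq (hn : 3 ≤ n) (hm : 0 < m) {x : Eucl n} (hx : x ∈ space n m) :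
    distHorizon n m x = radialDist n m ‖x‖ := by
  refine IsLeast.csInf_eq ⟨exists_curve_radialDist hm hx, ?_⟩
  rintro _ ⟨γ, h1, h2, h3, rfl, rfl⟩
  exact radialDist_le_curveLength hn hm h1 h2 h3

theorem horizonBall_radialDist (hn : 3 ≤ n) (hm : 0 < m) (R : ℝ) :
    horizonBall n m (radialDist n m R) = space n m ∩ {x | ‖x‖ ≤ R} := by
  ext x
  refine and_congr_right fun hx => ?_
  rw [distHorizon_eq hn hm hx, (strictMono_radialDist hn hm).le_iff_le]
  rfl

end Distance

/-! ### The volume of cones -/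

section ConeParam

open Module Set

variable {K E : Type*} [NormedAddCommGroup K] [InnerProductSpace ℝ K] [FiniteDimensional ℝ K]
  [MeasurableSpace K] [BorelSpace K]
  [NormedAddCommGroup E] [InnerProductSpace ℝ E] [FiniteDimensional ℝ E]
  [MeasurableSpace E] [BorelSpace E]
  {Y : K → E} {Y' : K → K →L[ℝ] E} {D : Set K}

theorem finrank_withLp_prod : finrank ℝ (WithLp 2 (K × ℝ)) = finrank ℝ K + 1 := by
  rw [(WithLp.prodContinuousLinearEquiv 2 ℝ K ℝ).toLinearEquiv.finrank_eq, finrank_prod,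
    finrank_self]

/-- For the map (w, r) ↦ r Y(w) the radial derivative is a unit vector orthogonal to the others, so
the Jacobian is a power of r times that of Y, and Tonelli's theorem separates the variables. -/
theorem lintegral_cone_image (hD : IsOpen D) (hY : ∀ w ∈ D, HasFDerivAt Y (Y' w) w)
    (hc : ContinuousOn Y' D) (himm : ∀ w ∈ D, Function.Injective (Y' w)) (hinj : InjOn Y D)
    (hnorm : ∀ w ∈ D, ‖Y w‖ = 1) (horth : ∀ w ∈ D, ∀ v, inner ℝ (Y' w v) (Y w) = (0 : ℝ))
    {t : Set K} (htD : t ⊆ D) (ht : MeasurableSet t) {I : Set ℝ} (hI0 : I ⊆ Ioi 0)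
    (hI : MeasurableSet I) {f : ℝ → ℝ≥0∞} (hf : AEMeasurable f (volume.restrict I)) :
    ∫⁻ x in (fun z : WithLp 2 (K × ℝ) => z.snd • Y z.fst) '' {z | z.fst ∈ t ∧ z.snd ∈ I},
        f ‖x‖ ∂μHE[finrank ℝ K + 1] =
      μHE[finrank ℝ K] (Y '' t) * ∫⁻ r in I, ENNReal.ofReal (r ^ finrank ℝ K) * f r := by
  set e := WithLp.prodContinuousLinearEquiv 2 ℝ K ℝ
  set p1 : WithLp 2 (K × ℝ) →L[ℝ] K :=
    (ContinuousLinearMap.fst ℝ K ℝ).comp (e : WithLp 2 (K × ℝ) →L[ℝ] K × ℝ)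
  set p2 : WithLp 2 (K × ℝ) →L[ℝ] ℝ :=
    (ContinuousLinearMap.snd ℝ K ℝ).comp (e : WithLp 2 (K × ℝ) →L[ℝ] K × ℝ)
  set Z : WithLp 2 (K × ℝ) → E := fun z => z.snd • Y z.fst
  set s : Set (WithLp 2 (K × ℝ)) := {z | z.fst ∈ D ∧ z.snd ∈ Ioi 0} with hs
  set Z' : WithLp 2 (K × ℝ) → WithLp 2 (K × ℝ) →L[ℝ] E := fun z =>
    p2 z • (Y' (p1 z)).comp p1 + p2.smulRight (Y (p1 z)) with hZ'
  have hso : IsOpen s := (hD.preimage p1.continuous).inter (isOpen_Ioi.preimage p2.continuous)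
  have hZ : ∀ z ∈ s, HasFDerivAt Z (Z' z) z := fun z hz =>
    p2.hasFDerivAt.smul ((hY _ hz.1).comp z p1.hasFDerivAt)
  have hYc : ContinuousOn Y D := fun w hw => (hY w hw).continuousAt.continuousWithinAt
  have hmaps : MapsTo p1 s D := fun z hz => hz.1
  have hZc : ContinuousOn Z' s := by
    refine (p2.continuous.continuousOn.smul ((hc.comp p1.continuous.continuousOn hmaps).clm_comp
      continuousOn_const)).add ?_
    exact ((ContinuousLinearMap.smulRightL ℝ (WithLp 2 (K × ℝ)) E p2).continuous.comp_continuousOn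
      (hYc.comp p1.continuous.continuousOn hmaps))
  have hZ'a : ∀ z y, Z' z y = z.snd • Y' z.fst y.fst + y.snd • Y z.fst := fun z y => rfl
  have hZimm : ∀ z ∈ s, Function.Injective (Z' z) := by
    intro z hz
    refine (injective_iff_map_eq_zero _).2 fun y hy => ?_
    rw [hZ'a] at hy
    have h1 : y.snd = 0 := by
      have := congrArg (fun x => inner ℝ x (Y z.fst)) hy
      simpa [inner_add_left, inner_smul_left, horth _ hz.1, hnorm _ hz.1] using this
    rw [h1, zero_smul, add_zero] at hy
    have h2 : y.fst = 0 := by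
      have h3 := (smul_eq_zero.1 hy).resolve_left (ne_of_gt hz.2)
      exact himm _ hz.1 (h3.trans (map_zero _).symm)
    apply WithLp.ofLp_injective
    exact Prod.ext h2 h1
  have hZn : ∀ z ∈ s, ‖Z z‖ = z.snd := fun z hz => by
    rw [norm_smul, hnorm _ hz.1, mul_one, Real.norm_of_nonneg (le_of_lt hz.2)]
  have hZinj : InjOn Z s := by
    intro z hz y hy hzy
    have h1 : z.snd = y.snd := by rw [← hZn z hz, ← hZn y hy, hzy]
    have h2 : Y z.fst = Y y.fst := by
      have h3 : z.snd • Y z.fst = y.snd • Y y.fst := hzy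
      rw [h1] at h3
      exact smul_right_injective E (ne_of_gt hy.2) h3
    apply WithLp.ofLp_injective
    exact Prod.ext (hinj hz.1 hy.1 h2) h1
  have hdet : ∀ z ∈ s, (Z' z : WithLp 2 (K × ℝ) →ₗ[ℝ] E).normDet =
      z.snd ^ finrank ℝ K * (Y' z.fst : K →ₗ[ℝ] E).normDet := fun z hz => by
    have h1 := normDet_withLp_prod (L := (Z' z : WithLp 2 (K × ℝ) →ₗ[ℝ] E))
      (L₁ := z.snd • (Y' z.fst : K →ₗ[ℝ] E)) (u := Y z.fst) (fun y => rfl) (fun w => by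
        change inner ℝ (z.snd • Y' z.fst w) _ = 0
        rw [real_inner_smul_left, horth _ hz.1, mul_zero])
    rw [h1, hnorm _ hz.1, mul_one, LinearMap.normDet_smul, Real.norm_of_nonneg (le_of_lt hz.2)]
  set T : Set (WithLp 2 (K × ℝ)) := {z | z.fst ∈ t ∧ z.snd ∈ I}
  have hTs : T ⊆ s := fun z hz => ⟨htD hz.1, hI0 hz.2⟩
  have hT : MeasurableSet T :=
    (ht.preimage p1.continuous.measurable).inter (hI.preimage p2.continuous.measurable)
  rw [← finrank_withLp_prod, lintegral_image_eq_normDet hso hZ hZc hZimm hZinj hTs hT,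
    ← (WithLp.volume_preserving_toLp K ℝ).setLIntegral_comp_preimage_emb
      (e.symm.toHomeomorph.measurableEmbedding)]
  have hpre : (WithLp.toLp 2 : K × ℝ → WithLp 2 (K × ℝ)) ⁻¹' T = t ×ˢ I := rfl
  rw [hpre, area_formula hD hY hc himm hinj htD ht, Measure.volume_eq_prod,
    ← Measure.prod_restrict, ← lintegral_prod_mul
      (aemeasurable_normDet hc htD ht).ennreal_ofReal
      (by fun_prop), Measure.prod_restrict]
  refine setLIntegral_congr_fun (ht.prod hI) fun q hq => ?_
  have hqs : WithLp.toLp 2 q ∈ s := hTs hq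
  rw [hZn _ hqs, hdet _ hqs, mul_comm (_ ^ _), ENNReal.ofReal_mul (LinearMap.normDet_nonneg _),
    mul_assoc]
  rfl

theorem setLIntegral_pos_of_ne_zero {α : Type*} [MeasurableSpace α] {μ : Measure α} {s : Set α}
    (hs : MeasurableSet s) (hμ : μ s ≠ 0) {f : α → ℝ≥0∞} (hf : AEMeasurable f (μ.restrict s))
    (hpos : ∀ x ∈ s, f x ≠ 0) : 0 < ∫⁻ x in s, f x ∂μ := by
  rw [pos_iff_ne_zero]
  intro h
  rw [lintegral_eq_zero_iff' hf] at h
  have h1 : ∀ᵐ x ∂μ.restrict s, False := by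
    filter_upwards [h, ae_restrict_mem hs] with x h1 h2 using hpos x h2 h1
  rw [eventually_false_iff_eq_bot, ae_eq_bot, Measure.restrict_eq_zero] at h1
  exact hμ h1

theorem measurableSet_inter_preimage_of_continuousOn (hD : IsOpen D) (hYc : ContinuousOn Y D)
    {A : Set E} (hA : MeasurableSet A) : MeasurableSet (D ∩ Y ⁻¹' A) := by
  have h1 : Measurable (D.domRestrict Y) := hYc.domRestrict.measurable
  have h2 := hD.measurableSet.subtype_image (h1 hA)
  convert h2 using 1
  ext w
  simp [and_comm]

end ConeParam

/-! ### Charts and volume of the link, and the volume of the cone over it. -/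

section ConeVolume

open Module Set IsLevelChart

variable {n : ℕ} {m : ℝ} {Γ : Set (Eucl n)}

theorem inner_sphereProj {x : Eucl n} (hx : ‖x‖ = 1) (v : Eucl n) :
    inner ℝ x (sphereProj n x v) = (0 : ℝ) := by
  simp [sphereProj, inner_sub_right, inner_smul_right, hx]

theorem inner_sphereProj_self {x : Eucl n} (hx : ‖x‖ = 1) (v : Eucl n) :
    inner ℝ v (sphereProj n x v) = ‖sphereProj n x v‖ ^ 2 := by
  rw [← real_inner_self_eq_norm_sq]
  conv_rhs => rw [sphereProj]
  rw [sub_apply, inner_sub_left, ContinuousLinearMap.smulRight_apply, real_inner_smul_left]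
  change _ = _ - _ * inner ℝ x (sphereProj n x v)
  rw [inner_sphereProj hx, mul_zero, sub_zero]
  rfl

/-- The chart is the slice at radius one of a polar chart, with the spherical gradient as transverse
angular direction. It is shrunk to a ball where the Jacobian is bounded, which gives the finite
volume. -/
theorem IsClosedMinimalInSphere.exists_chart (hn : 3 ≤ n) (hΓ : IsClosedMinimalInSphere n Γ)
    {q : Eucl n} (hq : q ∈ Γ) :
    ∃ (K : Submodule ℝ (Eucl n)) (V : Set (Eucl n)) (D : Set K) (Y : K → Eucl n)
      (Y' : K → K →L[ℝ] Eucl n), finrank ℝ K = n - 2 ∧ IsOpen V ∧ q ∈ V ∧ IsOpen D ∧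
      (∀ w ∈ D, HasFDerivAt Y (Y' w) w) ∧ ContinuousOn Y' D ∧
      (∀ w ∈ D, Function.Injective (Y' w)) ∧ InjOn Y D ∧ (∀ w ∈ D, ‖Y w‖ = 1) ∧
      (∀ w ∈ D, ∀ v, inner ℝ (Y' w v) (Y w) = (0 : ℝ)) ∧ Y '' D = Γ ∩ V ∧
      μHE[n - 2] (Γ ∩ V) < ⊤ := by
  obtain ⟨U, φ, hU, hqU, hφ, hgrad, hΓU, -⟩ := hΓ.locally_minimal q hq
  have hq1 : ‖q‖ = 1 := by simpa using hΓ.subset hq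
  have hq0 : q ≠ 0 := norm_ne_zero_iff.1 (by rw [hq1]; exact one_ne_zero)
  have hne : fderiv ℝ φ q (sphereGrad n φ q) ≠ 0 := by
    rw [← inner_gradient, sphereGrad, inner_sphereProj_self hq1]
    exact pow_ne_zero _ (norm_ne_zero_iff.2 (hgrad q ⟨hqU, hΓ.subset hq⟩))
  obtain ⟨K, V, D, X, hK, hqV, hVU, hX⟩ :=
    exists_polarChart hU hqU hφ hq0 (inner_sphereProj hq1 _) hne
  rw [finrank_euclideanSpace, Fintype.card_fin] at hK
  have hKn : finrank ℝ K = n - 2 := by omega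
  have hΓV : Γ ∩ V = {x ∈ V | ‖x‖ = 1 ∧ φ x = 0} := by
    ext x
    have h1 := Set.ext_iff.1 hΓU x
    simp only [mem_inter_iff, mem_ofPred_eq, mem_sphere_zero_iff_norm] at h1 ⊢
    constructor
    · rintro ⟨hx, hxV⟩
      exact ⟨hxV, (h1.1 ⟨hx, (hVU hxV).1⟩).2⟩
    · rintro ⟨hxV, hx⟩
      exact ⟨(h1.2 ⟨(hVU hxV).1, hx⟩).1, hxV⟩
  obtain ⟨w₀, hw₀, hw₀q⟩ : q ∈ (fun w => X (slice K 1 w)) '' (slice K 1 ⁻¹' D) := by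
    rw [hX.image_slice, ← hΓV]; exact ⟨hq, hqV⟩
  set Y : K → Eucl n := fun w => X (slice K 1 w)
  set Y' : K → K →L[ℝ] Eucl n := fun w => (fderiv ℝ X (slice K 1 w)).comp (sliceL K)
  set J : K → ℝ := fun w => (Y' w : K →ₗ[ℝ] Eucl n).normDet
  have hJc : ContinuousOn J (slice K 1 ⁻¹' D) :=
    continuous_normDet.comp_continuousOn (hX.continuousOn_fderiv_slice 1)
  have hDn := (hX.isOpen_slice 1).mem_nhds hw₀
  have hJn : {w | J w < J w₀ + 1} ∈ 𝓝 w₀ :=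
    (hJc.continuousAt hDn).eventually (gt_mem_nhds (lt_add_one _))
  obtain ⟨ε, hε, hball⟩ := Metric.mem_nhds_iff.1 (inter_mem hDn hJn)
  have hbD : Metric.ball w₀ ε ⊆ slice K 1 ⁻¹' D := fun w hw => (hball hw).1
  have hfst : ContinuousOn (fun x => (polarCoord K x).fst) V :=
    ((WithLp.prodContinuousLinearEquiv 2 ℝ K ℝ).continuous.fst).comp_continuousOn
      hX.contDiffOn_coord.continuousOn
  have hYfst : ∀ w ∈ slice K 1 ⁻¹' D, (polarCoord K (Y w)).fst = w := fun w hw =>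
    congrArg WithLp.fst (hX.coord_apply _ hw)
  have himg : Y '' Metric.ball w₀ ε =
      Γ ∩ (V ∩ (fun x => (polarCoord K x).fst) ⁻¹' Metric.ball w₀ ε) := by
    rw [← inter_assoc, hΓV, ← hX.image_slice]
    ext x
    constructor
    · rintro ⟨w, hw, rfl⟩
      refine ⟨⟨w, hbD hw, rfl⟩, ?_⟩
      change (polarCoord K (Y w)).fst ∈ Metric.ball w₀ ε
      rwa [hYfst w (hbD hw)]
    · rintro ⟨⟨w, hw, rfl⟩, h2⟩
      change (polarCoord K (Y w)).fst ∈ Metric.ball w₀ ε at h2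
      rw [hYfst w hw] at h2
      exact ⟨w, h2, rfl⟩
  refine ⟨K, V ∩ (fun x => (polarCoord K x).fst) ⁻¹' Metric.ball w₀ ε, Metric.ball w₀ ε, Y, Y',
    hKn, hfst.isOpen_inter_preimage hX.isOpen_source Metric.isOpen_ball, ⟨hqV, ?_⟩,
    Metric.isOpen_ball, fun w hw => hX.hasFDerivAt_comp_slice 1 w (hbD hw),
    (hX.continuousOn_fderiv_slice 1).mono hbD,
    fun w hw => hX.injective_fderiv_slice 1 w (hbD hw), (hX.injOn_slice 1).mono hbD,
    fun w hw => hX.norm_apply (hbD hw), fun w hw v => ?_, himg, ?_⟩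
  · change (polarCoord K q).fst ∈ Metric.ball w₀ ε
    rw [← hw₀q]
    rw [hYfst w₀ hw₀]
    exact Metric.mem_ball_self hε
  · have := hX.inner_fderiv_apply (hbD hw) (hVU (hX.map_mem _ (hbD hw))).2 (sliceL K v)
    rw [real_inner_comm]
    refine this.trans ?_
    rw [sliceL_apply]; simp
  · rw [← himg, ← hKn, area_formula (hX.isOpen_slice 1) (hX.hasFDerivAt_comp_slice 1)
      (hX.continuousOn_fderiv_slice 1) (hX.injective_fderiv_slice 1) (hX.injOn_slice 1) hbD
      measurableSet_ball]
    calc _ ≤ ∫⁻ _ in Metric.ball w₀ ε, ENNReal.ofReal (J w₀ + 1) :=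
          setLIntegral_mono' measurableSet_ball fun w hw =>
            ENNReal.ofReal_le_ofReal (le_of_lt (hball hw).2)
      _ < ⊤ := by
          rw [setLIntegral_const]
          exact ENNReal.mul_lt_top ENNReal.ofReal_lt_top measure_ball_lt_top

theorem IsClosedMinimalInSphere.sphereVol_lt_top (hn : 3 ≤ n)
    (hΓ : IsClosedMinimalInSphere n Γ) : sphereVol n Γ < ⊤ := by
  refine hΓ.isCompact.induction_on (p := fun s => μHE[n - 2] s < ⊤) (by simp)
    (fun s t hst ht => (measure_mono hst).trans_lt ht)
    (fun s t hs ht => (measure_union_le s t).trans_lt (ENNReal.add_lt_top.2 ⟨hs, ht⟩))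
    fun q hq => ?_
  obtain ⟨K, V, -, -, -, -, hV, hqV, -, -, -, -, -, -, -, -, hfin⟩ := hΓ.exists_chart hn hq
  exact ⟨Γ ∩ V, inter_mem_nhdsWithin Γ (hV.mem_nhds hqV), hfin⟩

theorem IsClosedMinimalInSphere.sphereVol_pos (hn : 3 ≤ n)
    (hΓ : IsClosedMinimalInSphere n Γ) : 0 < sphereVol n Γ := by
  obtain ⟨q, hq⟩ := hΓ.nonempty
  obtain ⟨K, V, D, Y, Y', hK, hV, hqV, hD, hY, hc, himm, hinj, -, -, himg, -⟩ :=
    hΓ.exists_chart hn hq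
  refine lt_of_lt_of_le ?_ (measure_mono (inter_subset_left (s := Γ) (t := V)))
  rw [← himg, ← hK, area_formula hD hY hc himm hinj subset_rfl hD.measurableSet]
  have hDne : D.Nonempty := by
    have : (Y '' D).Nonempty := by rw [himg]; exact ⟨q, hq, hqV⟩
    exact this.of_image
  exact setLIntegral_pos_of_ne_zero hD.measurableSet (hD.measure_pos volume hDne).ne'
    (aemeasurable_normDet hc subset_rfl hD.measurableSet).ennreal_ofReal fun w hw =>
    (ENNReal.ofReal_pos.2 (normDet_pos_of_injective (himm w hw))).ne'

theorem cone_eq {A : Set (Eucl n)} (hm : 0 < m) (hA : A ⊆ Metric.sphere 0 1) :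
    cone n m A = {x | ‖x‖⁻¹ • x ∈ A} ∩ space n m := by
  ext x
  refine and_congr_left fun hx => ?_
  have hx0 : 0 < ‖x‖ := (horizonRadius_pos hm).trans_le hx
  constructor
  · rintro ⟨y, hy, l, hl, rfl⟩
    have hy1 : ‖y‖ = 1 := by simpa using hA hy
    change ‖l • y‖⁻¹ • l • y ∈ A
    rwa [norm_smul, hy1, mul_one, Real.norm_of_nonneg hl.le, smul_smul, inv_mul_cancel₀ hl.ne',
      one_smul]
  · intro h
    exact ⟨_, h, ‖x‖, hx0, by rw [smul_smul, mul_inv_cancel₀ hx0.ne', one_smul]⟩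

theorem lintegral_coneDensity (hn : 3 ≤ n) (hm : 0 < m) {R : ℝ} (hR : horizonRadius n m ≤ R) :
    ∫⁻ r in Icc (horizonRadius n m) R, ENNReal.ofReal (r ^ (n - 2)) *
      ENNReal.ofReal (radialFactor n m r ^ (n - 1)) = ENNReal.ofReal (coneVolume n m R) := by
  rw [coneVolume, intervalIntegral.integral_of_le hR, ← integral_Icc_eq_integral_Ioc,
    ofReal_integral_eq_lintegral_ofReal
      ((continuous_coneDensity hn hm).integrableOn_Icc)
      (Eventually.of_forall fun r => (coneDensity_pos hm r).le)]
  refine setLIntegral_congr_fun measurableSet_Icc fun r hr => ?_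
  rw [coneDensity_of_le hr.1, ENNReal.ofReal_mul (pow_nonneg
    ((horizonRadius_pos hm).le.trans hr.1) _)]

/-- The Schwarzschild volume of the part of a cone in a ball about the horizon. -/
theorem area_cone (hn : 3 ≤ n) (hm : 0 < m) (hΓ : IsClosedMinimalInSphere n Γ) {R : ℝ}
    (hR : horizonRadius n m ≤ R) :
    area n m (n - 1) (cone n m Γ ∩ {x | ‖x‖ ≤ R}) =
      sphereVol n Γ * ENNReal.ofReal (coneVolume n m R) := by
  have hR0 := horizonRadius_pos (n := n) hm
  set C : Set (Eucl n) → Set (Eucl n) := fun A => cone n m A ∩ {x | ‖x‖ ≤ R} with hC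
  have hΓm : MeasurableSet Γ := hΓ.isCompact.measurableSet
  -- The claim is strengthened to all measurable subsets of the link, so that in the compactness
  -- induction a union of two neighbourhoods is handled by cutting `A` into disjoint pieces.
  suffices h : ∃ W, MeasurableSet W ∧ Γ ⊆ W ∧ ∀ A, MeasurableSet A → A ⊆ Γ ∩ W →
      area n m (n - 1) (C A) = μHE[n - 2] A * ENNReal.ofReal (coneVolume n m R) by
    obtain ⟨W, -, hΓW, h⟩ := h
    exact h Γ hΓm (subset_inter subset_rfl hΓW)
  have hCm : ∀ A, MeasurableSet A → A ⊆ Γ → MeasurableSet (C A) := fun A hA hAΓ => by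
    have h1 : Measurable fun x : Eucl n => ‖x‖⁻¹ • x := by fun_prop
    rw [hC]
    simp only
    rw [cone_eq hm (hAΓ.trans hΓ.subset)]
    exact ((h1 hA).inter (isClosed_le continuous_const continuous_norm).measurableSet).inter
      (isClosed_le continuous_norm continuous_const).measurableSet
  refine hΓ.isCompact.induction_on (p := fun s => ∃ W, MeasurableSet W ∧ s ⊆ W ∧
    ∀ A, MeasurableSet A → A ⊆ Γ ∩ W →
      area n m (n - 1) (C A) = μHE[n - 2] A * ENNReal.ofReal (coneVolume n m R)) ?_ ?_ ?_ ?_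
  · refine ⟨∅, MeasurableSet.empty, subset_rfl, fun A _ hA => ?_⟩
    have hA0 : A = ∅ := by simpa using hA
    simp [hA0, hC, cone, area]
  · rintro s t hst ⟨W, hW, htW, h⟩
    exact ⟨W, hW, hst.trans htW, h⟩
  · rintro s t ⟨W, hW, hsW, h⟩ ⟨W', hW', htW', h'⟩
    refine ⟨W ∪ W', hW.union hW', union_subset_union hsW htW', fun A hA hAW => ?_⟩
    have h1 := h (A ∩ W) (hA.inter hW) fun x hx => ⟨(hAW hx.1).1, hx.2⟩
    have h2 := h' (A \ W) (hA.diff hW) fun x hx => ⟨(hAW hx.1).1, (hAW hx.1).2.resolve_left hx.2⟩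
    have hAs : A ⊆ Metric.sphere 0 1 := fun x hx => hΓ.subset (hAW hx).1
    have hsplit : C A = C (A ∩ W) ∪ C (A \ W) := by
      simp only [hC]
      rw [cone_eq hm hAs, cone_eq hm (inter_subset_left.trans hAs), cone_eq hm
        (sdiff_subset.trans hAs)]
      ext x
      by_cases hx : ‖x‖⁻¹ • x ∈ W <;> simp [hx]
    have hdisj : Disjoint (C (A ∩ W)) (C (A \ W)) := by
      simp only [hC]
      rw [cone_eq hm (inter_subset_left.trans hAs), cone_eq hm (sdiff_subset.trans hAs)]
      rw [Set.disjoint_left]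
      rintro x ⟨⟨hx, -⟩, -⟩ ⟨⟨hx', -⟩, -⟩
      exact hx'.2 hx.2
    rw [← measure_inter_add_sdiff A hW, add_mul, ← h1, ← h2, area, area, area, hsplit,
      lintegral_union (hCm _ (hA.diff hW) (sdiff_subset.trans fun x hx => (hAW hx).1)) hdisj]
  · intro q hq
    obtain ⟨K, V, D, Y, Y', hK, hV, hqV, hD, hY, hc, himm, hinj, hnorm, horth, himg, -⟩ :=
      hΓ.exists_chart hn hq
    refine ⟨Γ ∩ V, inter_mem_nhdsWithin Γ (hV.mem_nhds hqV), V, hV.measurableSet,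
      inter_subset_right, fun A hA hAV => ?_⟩
    have hYc : ContinuousOn Y D := fun w hw => (hY w hw).continuousAt.continuousWithinAt
    set t := D ∩ Y ⁻¹' A with ht
    have htm : MeasurableSet t := measurableSet_inter_preimage_of_continuousOn hD hYc hA
    have hYt : Y '' t = A := by
      rw [ht, image_inter_preimage, himg, inter_eq_right]
      exact hAV
    have hCA : C A = (fun z : WithLp 2 (K × ℝ) => z.snd • Y z.fst) ''
        {z | z.fst ∈ t ∧ z.snd ∈ Icc (horizonRadius n m) R} := by
      ext x
      constructor
      · rintro ⟨⟨⟨y, hy, l, hl, rfl⟩, hx⟩, hxR⟩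
        rw [← hYt] at hy
        obtain ⟨w, hw, rfl⟩ := hy
        have hln : ‖l • Y w‖ = l := by
          rw [norm_smul, hnorm w hw.1, mul_one, Real.norm_of_nonneg hl.le]
        have hx1 : horizonRadius n m ≤ ‖l • Y w‖ := hx
        have hx2 : ‖l • Y w‖ ≤ R := hxR
        rw [hln] at hx1 hx2
        exact ⟨WithLp.toLp 2 (w, l), ⟨hw, hx1, hx2⟩, rfl⟩
      · rintro ⟨z, ⟨hz1, hz2⟩, rfl⟩
        have hl : 0 < z.snd := hR0.trans_le hz2.1
        have hln : ‖z.snd • Y z.fst‖ = z.snd := by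
          rw [norm_smul, hnorm _ hz1.1, mul_one, Real.norm_of_nonneg hl.le]
        refine ⟨⟨⟨Y z.fst, hz1.2, z.snd, hl, rfl⟩, ?_⟩, ?_⟩
        · change _ ≤ ‖z.snd • Y z.fst‖
          rw [hln]; exact hz2.1
        · change ‖z.snd • Y z.fst‖ ≤ _
          rw [hln]; exact hz2.2
    have hI0 : Icc (horizonRadius n m) R ⊆ Ioi 0 := fun r hr => hR0.trans_le hr.1
    have key := lintegral_cone_image hD hY hc himm hinj hnorm horth inter_subset_left htm hI0
      measurableSet_Icc (f := fun r => ENNReal.ofReal (radialFactor n m r ^ (n - 1)))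
      ((((continuousOn_radialFactor hn hm).mono hI0).pow _).aemeasurable
        measurableSet_Icc).ennreal_ofReal
    rw [hYt, ← hCA, hK, lintegral_coneDensity hn hm hR, show n - 2 + 1 = n - 1 by omega] at key
    exact key

end ConeVolume

/-! ### Rigidity -/

section Rigidity

open Module Set

variable {n : ℕ} {m : ℝ} {S : Set (Eucl n)}

/-- The radial direction is tangent to `S`. -/
def IsRadial (n : ℕ) (m : ℝ) (S : Set (Eucl n)) : Prop :=
  ∀ U φ, IsLocalEquation n m S U φ → ∀ x ∈ S ∩ U, inner ℝ (gradient φ x) x = 0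

theorem measurable_decayRate : Measurable (decayRate n m) := by
  unfold decayRate; fun_prop

/-- If the radial direction were transverse at an exterior point, it would be so nearby, inside a
shell where 1 - h > 0. The defect integrand would be positive on a nonempty open piece of `S`, which
has positive area. On the horizon, tangency is the free boundary condition. -/
theorem isRadial_of_defectIntegral_eq_zero (hn : 3 ≤ n) (hm : 0 < m)
    (hS : IsFreeBoundaryMinimal n m S)
    (h0 : ∀ a b, horizonRadius n m < a → defectIntegral n m S a b = 0) : IsRadial n m S := by
  rintro U φ hU p ⟨hpS, hpU⟩
  rcases (show horizonRadius n m ≤ ‖p‖ from hS.subset hpS).eq_or_lt with hp | hp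
  · exact hU.orthogonal p ⟨⟨hpS, hpU⟩, hp.symm⟩
  by_contra hne
  set e := euclNormal φ p with he'
  have he : ‖e‖ = 1 := norm_euclNormal (hU.gradient_ne p hpU)
  have hfe : fderiv ℝ φ p e ≠ 0 := by
    rw [← inner_gradient, gradient_eq_smul_euclNormal, real_inner_smul_left, ← he',
      real_inner_self_eq_norm_sq, he, one_pow, mul_one]
    exact norm_ne_zero_iff.2 (hU.gradient_ne p hpU)
  set a := (horizonRadius n m + ‖p‖) / 2 with ha
  have ha1 : horizonRadius n m < a := by rw [ha]; linarith
  have ha2 : a < ‖p‖ := by rw [ha]; linarith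
  set b := ‖p‖ + 1 with hb
  have hfc : ContinuousOn (fun x => inner ℝ (gradient φ x) x) U :=
    (contDiffOn_gradient hU.isOpen hU.contDiffOn).continuousOn.inner continuousOn_id
  set O : Set (Eucl n) := (U ∩ (fun x => inner ℝ (gradient φ x) x) ⁻¹' {0}ᶜ) ∩
    (norm ⁻¹' Ioo a b) with hO
  have hOo : IsOpen O := (hfc.isOpen_inter_preimage hU.isOpen isOpen_compl_singleton).inter
    (isOpen_Ioo.preimage continuous_norm)
  obtain ⟨V, D, X, hpV, hVO, hX⟩ := exists_graphChart hOo (p := p)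
    ⟨⟨hpU, hne⟩, ha2, lt_add_one _⟩ (hU.contDiffOn.mono fun x hx => hx.1.1) he hfe
  have hmem : ∀ z ∈ D, X z ∈ O := fun z hz => hVO (hX.map_mem z hz)
  have hext : ∀ z ∈ D, horizonRadius n m < ‖X z‖ := fun z hz => ha1.trans (hmem z hz).2.1
  have hmemS : ∀ z ∈ D, X z ∈ S := fun z hz =>
    (hU.mem_iff (hmem z hz).1.1 (hext z hz).le).2 (hX.fun_apply z hz)
  have hfin : finrank ℝ (ℝ ∙ e)ᗮ = n - 1 := by
    have := finrank_hyperplane he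
    rw [finrank_euclideanSpace, Fintype.card_fin] at this
    omega
  have hDne : D.Nonempty := ⟨_, hX.coord_mem p hpV ((hU.mem_iff hpU hp.le).1 hpS)⟩
  have hDm := hX.isOpen_target.measurableSet
  set P : Eucl n → ℝ := fun x => inner ℝ x (euclNormal φ x) ^ 2 / ‖x‖ ^ 2 with hP
  set q : Eucl n → ℝ := fun x => ((n : ℝ) - 1) / ‖x‖ ^ (n - 1) * (1 - decayRate n m ‖x‖) with hq
  have hdef : ∀ z ∈ D, radialDefect n m S (X z) = P (X z) := fun z hz => by
    obtain ⟨c, hc, hN⟩ := hU.normalAt_eq (hmemS z hz) (hmem z hz).1.1 (hext z hz)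
    rw [radialDefect, hN, real_inner_smul_right, mul_pow, hc, one_mul]
  have hle : ∫⁻ z in D, ENNReal.ofReal (fderiv ℝ X z : (ℝ ∙ e)ᗮ →ₗ[ℝ] Eucl n).normDet *
      ENNReal.ofReal (q (X z) * P (X z)) ≤ defectIntegral n m S a b := by
    have h1 := lintegral_image_eq_normDet hX.isOpen_target hX.hasFDerivAt hX.continuousOn_fderiv
      hX.injective_fderiv hX.injOn subset_rfl hDm
      (fun x => ENNReal.ofReal (q x * radialDefect n m S x))
    rw [hfin] at h1
    rw [setLIntegral_congr_fun hDm fun z hz => by rw [← hdef z hz], ← h1]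
    refine lintegral_mono_set ?_
    rintro _ ⟨z, hz, rfl⟩
    exact ⟨hmemS z hz, (hmem z hz).2.1.le, (hmem z hz).2.2.le⟩
  rw [h0 a b ha1] at hle
  refine hle.not_gt (setLIntegral_pos_of_ne_zero hDm
    (hX.isOpen_target.measure_pos volume hDne).ne' ?_ fun z hz => ?_)
  · have hXc : ContinuousOn X D := hX.contDiffOn.continuousOn
    have hqm : Measurable q := by
      have := measurable_decayRate (n := n) (m := m)
      simp only [hq]; fun_prop
    have hNc : ContinuousOn (fun z => inner ℝ (X z) (euclNormal φ (X z))) D :=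
      hXc.inner ((contDiffOn_euclNormal hU.isOpen hU.contDiffOn hU.gradient_ne).continuousOn.comp
        hXc fun z hz => (hmem z hz).1.1)
    exact (aemeasurable_normDet hX.continuousOn_fderiv subset_rfl hDm).ennreal_ofReal.mul
      ((hqm.comp_aemeasurable (hXc.aemeasurable hDm)).mul
        (((hNc.aemeasurable hDm).pow_const 2).div
          ((hXc.aemeasurable hDm).norm.pow_const 2))).ennreal_ofReal
  · have hr : 0 < ‖X z‖ := (horizonRadius_pos hm).trans (hext z hz)
    have h1 := normDet_pos_of_injective (hX.injective_fderiv z hz)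
    have h2 : 0 < (n : ℝ) - 1 := by
      have : (3 : ℝ) ≤ n := by exact_mod_cast hn
      linarith
    have h3 := sub_pos.2 (decayRate_lt_one hn hm (hext z hz))
    have h4 : inner ℝ (X z) (euclNormal φ (X z)) ≠ (0 : ℝ) := fun h => by
      refine (hmem z hz).1.2 ?_
      change inner ℝ (gradient φ (X z)) (X z) = 0
      rw [gradient_eq_smul_euclNormal, real_inner_smul_left, real_inner_comm, h, mul_zero]
    have h5 : 0 < q (X z) * P (X z) := by
      simp only [hq, hP]
      positivity
    exact mul_ne_zero (ENNReal.ofReal_pos.2 h1).ne' (ENNReal.ofReal_pos.2 h5).ne'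

/-- With the angular coordinate fixed, a polar chart satisfies X' = X/|X| and |X| = s wherever it
lies in `S`, so X/s is constant and the coordinate line follows the ray. The chart extends across
the horizon, so this works at the endpoint radius too. -/
theorem IsRadial.exists_smul_mem_nhds (h : IsRadial n m S) (hm : 0 < m)
    (hS : IsFreeBoundaryMinimal n m S) {u : Eucl n} (hu : ‖u‖ = 1) {r : ℝ}
    (hr : horizonRadius n m ≤ r) (hru : r • u ∈ S) :
    ∃ ε > 0, ∀ s, horizonRadius n m ≤ s → s ∈ Metric.ball r ε → s • u ∈ S := by
  have hR := horizonRadius_pos (n := n) hm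
  have hr0 : 0 < r := hR.trans_le hr
  set p := r • u with hp
  have hpr : ‖p‖ = r := by rw [hp, norm_smul, hu, mul_one, Real.norm_of_nonneg hr0.le]
  obtain ⟨U, φ, hpU, hU⟩ := hS.exists_localEquation hru
  have hp0 : p ≠ 0 := norm_pos_iff.1 (by rw [hpr]; exact hr0)
  have hne : fderiv ℝ φ p (gradient φ p) ≠ 0 := by
    rw [← inner_gradient]
    exact inner_self_ne_zero.2 (hU.gradient_ne p hpU)
  obtain ⟨K, V, D, X, -, hpV, hVU, hX⟩ := exists_polarChart hU.isOpen hpU hU.contDiffOn hp0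
    (by rw [real_inner_comm]; exact h U φ hU p ⟨hru, hpU⟩) hne
  have hφp : φ p = 0 := (hU.mem_iff hpU (hS.subset hru)).1 hru
  set w := (polarCoord K p).fst
  have hpw : polarCoord K p = WithLp.toLp 2 (w, r) := by
    apply WithLp.ofLp_injective
    exact Prod.ext rfl hpr
  set l : ℝ → WithLp 2 (K × ℝ) := fun s => WithLp.toLp 2 (w, s)
  have hl : ∀ s, HasDerivAt l (WithLp.toLp 2 (0, 1)) s := fun s => by
    have h1 : HasDerivAt (fun s : ℝ => (w, s)) ((0 : K), (1 : ℝ)) s :=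
      (hasDerivAt_const s w).prodMk (hasDerivAt_id s)
    exact (WithLp.prodContinuousLinearEquiv 2 ℝ K ℝ).symm.hasFDerivAt.comp_hasDerivAt s h1
  have hlr : l r ∈ D := by
    change WithLp.toLp 2 (w, r) ∈ D
    rw [← hpw]; exact hX.coord_mem p hpV hφp
  have hlc : Continuous l := continuous_iff_continuousAt.2 fun s => (hl s).continuousAt
  obtain ⟨ε, hε, hball⟩ := Metric.isOpen_iff.1 (hX.isOpen_target.preimage hlc) r hlr
  refine ⟨ε, hε, fun s hs hsr => ?_⟩
  have hsub : Icc (min s r) (max s r) ⊆ Metric.ball r ε := by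
    rw [← uIcc]
    exact (convex_ball r ε).ordConnected.uIcc_subset hsr (Metric.mem_ball_self hε)
  have hXS : ∀ σ ∈ Metric.ball r ε, horizonRadius n m ≤ σ → X (l σ) ∈ S := fun σ hσ hRσ => by
    have h1 : ‖X (l σ)‖ = σ := hX.norm_apply (hball hσ)
    exact (hU.mem_iff (hVU (hX.map_mem _ (hball hσ))).1 (by
      change _ ≤ ‖X (l σ)‖; rwa [h1])).2 (hX.fun_apply _ (hball hσ))
  set f : ℝ → Eucl n := fun σ => σ⁻¹ • X (l σ) with hf
  have hfd : ∀ σ ∈ Icc (min s r) (max s r), HasDerivAt f 0 σ := fun σ hσ => by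
    have hσb := hsub hσ
    have hRσ : horizonRadius n m ≤ σ := (le_min hs hr).trans hσ.1
    have hσ0 : σ ≠ 0 := (hR.trans_le hRσ).ne'
    have hn1 : ‖X (l σ)‖ = σ := hX.norm_apply (hball hσb)
    have hXU := hVU (hX.map_mem _ (hball hσb))
    have h1 := hX.fderiv_apply_radial (hball hσb) hXU.2 (by
      rw [← inner_gradient]; exact h U φ hU _ ⟨hXS σ hσb hRσ, hXU.1⟩)
    have h2 : HasDerivAt (fun σ => X (l σ)) (‖X (l σ)‖⁻¹ • X (l σ)) σ := by
      have := (hX.hasFDerivAt _ (hball hσb)).comp_hasDerivAt σ (hl σ)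
      rwa [h1] at this
    refine ((hasDerivAt_inv hσ0).smul h2).congr_deriv ?_
    rw [hn1, smul_smul, ← add_smul]
    have : σ⁻¹ * σ⁻¹ + -(σ ^ 2)⁻¹ = 0 := by field_simp; ring
    rw [this, zero_smul]
  have hconst := constant_of_has_deriv_right_zero
    (fun σ hσ => (hfd σ hσ).continuousAt.continuousWithinAt)
    (fun σ hσ => (hfd σ (Ico_subset_Icc_self hσ)).hasDerivWithinAt)
  have h1 : f s = f r := (hconst s ⟨min_le_left _ _, le_max_left _ _⟩).trans
    (hconst r ⟨min_le_right _ _, le_max_right _ _⟩).symm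
  have h2 : X (l r) = p := by
    change X (WithLp.toLp 2 (w, r)) = p
    rw [← hpw]; exact hX.apply_coord p hpV hφp
  have hs0 : s ≠ 0 := (hR.trans_le hs).ne'
  simp only [hf] at h1
  rw [h2, hp, smul_smul, inv_mul_cancel₀ hr0.ne', one_smul] at h1
  rw [← h1, smul_smul, mul_inv_cancel₀ hs0, one_smul]
  exact hXS s hsr hs

/-- The radii at which the ray meets `S` form a nonempty closed and open subset of a half-line. -/
theorem IsRadial.smul_mem (h : IsRadial n m S) (hm : 0 < m)
    (hS : IsFreeBoundaryMinimal n m S) {u : Eucl n} (hu : ‖u‖ = 1) {r s : ℝ}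
    (hr : horizonRadius n m ≤ r) (hru : r • u ∈ S) (hs : horizonRadius n m ≤ s) : s • u ∈ S := by
  set T : Set (Ici (horizonRadius n m)) := {σ | (σ : ℝ) • u ∈ S} with hT
  have hclosed : IsClosed T := hS.isClosed.preimage (by fun_prop)
  have hopen : IsOpen T := by
    rw [Metric.isOpen_iff]
    rintro ⟨σ, hσ⟩ hσS
    obtain ⟨ε, hε, H⟩ := h.exists_smul_mem_nhds hm hS hu hσ hσS
    exact ⟨ε, hε, fun τ hτ => H τ τ.2 hτ⟩
  have : PreconnectedSpace (Ici (horizonRadius n m)) :=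
    Subtype.preconnectedSpace isPreconnected_Ici
  have huniv : T = univ := IsClopen.eq_univ ⟨hclosed, hopen⟩ ⟨⟨r, hr⟩, hru⟩
  exact (huniv ▸ mem_univ _ : (⟨s, hs⟩ : Ici (horizonRadius n m)) ∈ T)

end Rigidity

/-! ### The link of a radial minimal hypersurface -/

section Link

open Module Set

variable {n : ℕ} {m : ℝ} {S : Set (Eucl n)}

theorem tr_sphereProj_comp {x : Eucl n} (hx : ‖x‖ = 1) (L : Eucl n →L[ℝ] Eucl n) :
    tr (sphereProj n x ∘L L ∘L sphereProj n x) = tr L - inner ℝ x (L x) := by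
  have hPP : sphereProj n x ∘L sphereProj n x = sphereProj n x := by
    ext1 v
    have h := inner_sphereProj hx v
    rw [ContinuousLinearMap.comp_apply]
    set w := sphereProj n x v
    rw [sphereProj, sub_apply, ContinuousLinearMap.smulRight_apply, innerSL_apply_apply, h,
      zero_smul, sub_zero]
    rfl
  have h1 : tr (sphereProj n x ∘L L ∘L sphereProj n x) =
      tr ((L ∘L sphereProj n x) ∘L sphereProj n x) :=
    LinearMap.trace_comp_comm' _ _
  rw [h1, ContinuousLinearMap.comp_assoc, hPP, sphereProj, ContinuousLinearMap.comp_sub,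
    tr_sub, ContinuousLinearMap.comp_id]
  have h2 : L ∘L (innerSL ℝ x).smulRight x = (innerSL ℝ x).smulRight (L x) := by
    ext1 v; simp
  rw [h2, tr_smulRight, innerSL_apply_apply]

theorem sphereNormal_eq {ψ : Eucl n → ℝ} {y : Eucl n} (hy : gradient ψ y ≠ 0) :
    sphereNormal n ψ y = ‖sphereProj n y (euclNormal ψ y)‖⁻¹ •
      sphereProj n y (euclNormal ψ y) := by
  have h0 : ‖gradient ψ y‖ ≠ 0 := norm_ne_zero_iff.2 hy
  rw [sphereNormal, sphereGrad, gradient_eq_smul_euclNormal ψ y, map_smul, norm_smul, norm_norm,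
    smul_smul, mul_inv, mul_assoc, mul_comm ‖sphereProj n y _‖⁻¹, ← mul_assoc,
    inv_mul_cancel₀ h0, one_mul]

/-- At `x` the field is already tangent to the sphere, of unit length, with derivative orthogonal to
it. Normalizing therefore changes nothing to first order, and projecting changes the derivative only
by a multiple of `x`. -/
theorem hasFDerivAt_sphereProj_field {M : Eucl n → Eucl n} {M' : Eucl n →L[ℝ] Eucl n}
    {x : Eucl n} (hM : HasFDerivAt M M' x) (hMn : ‖M x‖ = 1) (hMx : inner ℝ x (M x) = (0 : ℝ))
    (hMM' : ∀ v, inner ℝ (M' v) (M x) = (0 : ℝ)) :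
    ∃ l : Eucl n →L[ℝ] ℝ,
      HasFDerivAt (fun y => ‖sphereProj n y (M y)‖⁻¹ • sphereProj n y (M y))
        (M' - l.smulRight x) x := by
  set l : Eucl n →L[ℝ] ℝ := (fderivInnerCLM ℝ (x, M x)).comp
    ((ContinuousLinearMap.id ℝ (Eucl n)).prod M')
  have hl : HasFDerivAt (fun y => inner ℝ y (M y)) l x := (hasFDerivAt_id x).inner ℝ hM
  have hQ : HasFDerivAt (fun y => sphereProj n y (M y)) (M' - l.smulRight x) x := by
    have h1 := hM.sub (hl.smul (hasFDerivAt_id x))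
    rw [hMx, zero_smul, zero_add] at h1
    exact h1
  have hQx : sphereProj n x (M x) = M x := by
    simp [sphereProj, hMx]
  have hQ0 : sphereProj n x (M x) ≠ 0 := by
    rw [hQx]; exact norm_ne_zero_iff.1 (by rw [hMn]; exact one_ne_zero)
  have hinv : HasFDerivAt (fun y => ‖sphereProj n y (M y)‖⁻¹) (0 : Eucl n →L[ℝ] ℝ) x := by
    have h1 := (hasFDerivAt_norm_comp (b := fun r => r⁻¹) hQ0
      (hasDerivAt_inv (norm_ne_zero_iff.2 hQ0))).comp x hQ
    refine h1.congr_fderiv ?_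
    ext v
    have h2 : inner ℝ (M x) ((M' - l.smulRight x) v) = (0 : ℝ) := by
      rw [sub_apply, inner_sub_right, real_inner_comm, hMM', ContinuousLinearMap.smulRight_apply,
        real_inner_smul_right, real_inner_comm, hMx, mul_zero, sub_zero]
    rw [ContinuousLinearMap.comp_apply, smul_apply, innerSL_apply_apply, hQx, h2, smul_zero]
    rfl
  refine ⟨l, ?_⟩
  have h2 := hinv.smul hQ
  rw [hQx, hMn, inv_one, one_smul] at h2
  refine h2.congr_fderiv ?_
  ext1 v
  simp

theorem gradient_comp_smul {φ : Eucl n → ℝ} {ρ : ℝ} {y : Eucl n}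
    (hφ : DifferentiableAt ℝ φ (ρ • y)) :
    gradient (fun y => φ (ρ • y)) y = ρ • gradient φ (ρ • y) := by
  refine ext_inner_right ℝ fun v => ?_
  rw [inner_gradient, real_inner_smul_left, inner_gradient]
  have h1 : HasFDerivAt (fun y : Eucl n => ρ • y) (ρ • ContinuousLinearMap.id ℝ (Eucl n)) y :=
    (hasFDerivAt_id y).const_smul ρ
  have h2 : HasFDerivAt (fun y => φ (ρ • y)) _ y := hφ.hasFDerivAt.comp y h1
  rw [h2.fderiv]
  simp

/-- On a cone ⟨x,N⟩ = 0, so the Schwarzschild equation makes the Euclidean mean curvature vanish as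
well. Passing to the trace on the tangent space of the sphere removes ⟨x, DN x⟩, which is also zero.
-/
theorem IsLocalEquation.sphereMeanCurvature_eq_zero (hn : 3 ≤ n) (hm : 0 < m)
    (hrad : IsRadial n m S) (hcone : ∀ u : Eucl n, ‖u‖ = 1 → ∀ r s, horizonRadius n m ≤ r →
      r • u ∈ S → horizonRadius n m ≤ s → s • u ∈ S) {U : Set (Eucl n)} {φ : Eucl n → ℝ}
    (hU : IsLocalEquation n m S U φ) {ρ : ℝ} (hρ : horizonRadius n m < ρ) {x : Eucl n}
    (hx : ‖x‖ = 1) (hxU : ρ • x ∈ U) (hxS : ρ • x ∈ S) :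
    sphereMeanCurvature n (fun y => φ (ρ • y)) x = 0 := by
  have hρ0 : 0 < ρ := (horizonRadius_pos hm).trans hρ
  have hx0 : x ≠ 0 := norm_ne_zero_iff.1 (by rw [hx]; exact one_ne_zero)
  have hdφ : ∀ y, ρ • y ∈ U → DifferentiableAt ℝ φ (ρ • y) := fun y hy =>
    (hU.contDiffOn.contDiffAt (hU.isOpen.mem_nhds hy)).differentiableAt (by simp)
  have hg : ∀ y, ρ • y ∈ U → gradient (fun y => φ (ρ • y)) y = ρ • gradient φ (ρ • y) :=
    fun y hy => gradient_comp_smul (hdφ y hy)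
  have hN : ∀ y, ρ • y ∈ U → euclNormal (fun y => φ (ρ • y)) y = euclNormal φ (ρ • y) := by
    intro y hy
    rw [euclNormal, hg y hy, norm_smul, Real.norm_of_nonneg hρ0.le, smul_smul, mul_inv, mul_comm,
      ← mul_assoc, mul_inv_cancel₀ hρ0.ne', one_mul, euclNormal]
  set M : Eucl n → Eucl n := fun y => euclNormal φ (ρ • y) with hMdef
  set N' := fderiv ℝ (euclNormal φ) (ρ • x) with hN'
  have hNd : HasFDerivAt (euclNormal φ) N' (ρ • x) :=
    (((contDiffOn_euclNormal hU.isOpen hU.contDiffOn hU.gradient_ne).contDiffAt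
      (hU.isOpen.mem_nhds hxU)).differentiableAt (by simp)).hasFDerivAt
  have hsm : HasFDerivAt (fun y : Eucl n => ρ • y) (ρ • ContinuousLinearMap.id ℝ (Eucl n)) x :=
    (hasFDerivAt_id x).const_smul ρ
  have hM : HasFDerivAt M (ρ • N') x := by
    refine (hNd.comp x hsm).congr_fderiv ?_
    ext1 v; simp
  have hrad' : ∀ r, horizonRadius n m ≤ r → r • x ∈ U →
      inner ℝ x (euclNormal φ (r • x)) = (0 : ℝ) := fun r hr hrU => by
    have h1 := hrad U φ hU (r • x) ⟨hcone x hx ρ r hρ.le hxS hr, hrU⟩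
    rw [real_inner_smul_right] at h1
    have h2 := (mul_eq_zero.1 h1).resolve_left ((horizonRadius_pos hm).trans_le hr).ne'
    rw [euclNormal, real_inner_smul_right, real_inner_comm, h2, mul_zero]
  have hMx : inner ℝ x (M x) = (0 : ℝ) := hrad' ρ hρ.le hxU
  obtain ⟨l, hl⟩ := hasFDerivAt_sphereProj_field hM
    (norm_euclNormal (hU.gradient_ne _ hxU)) hMx (fun v => by
      rw [smul_apply, real_inner_smul_left, inner_fderiv_euclNormal_self hU.isOpen hU.contDiffOn
        hU.gradient_ne hxU, mul_zero])
  have hpre : (fun y : Eucl n => ρ • y) ⁻¹' U ∈ 𝓝 x :=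
    (hU.isOpen.preimage (continuous_const_smul ρ)).mem_nhds hxU
  have hev : sphereNormal n (fun y => φ (ρ • y)) =ᶠ[𝓝 x]
      fun y => ‖sphereProj n y (M y)‖⁻¹ • sphereProj n y (M y) := by
    filter_upwards [hpre] with y hy
    rw [sphereNormal_eq, hN y hy]
    rw [hg y hy]
    exact smul_ne_zero hρ0.ne' (hU.gradient_ne _ hy)
  have hfd := (hl.congr_of_eventuallyEq hev).fderiv
  have htr : tr N' = 0 := by
    rw [hN', tr_fderiv_euclNormal hn hm hU.isOpen hU.contDiffOn hU.gradient_ne hxU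
      (smul_ne_zero hρ0.ne' hx0) (hU.meanCurvature_eq _ ⟨hxS, hxU⟩), real_inner_smul_left]
    change _ * (_ * (ρ * inner ℝ x (M x)) / _) = _
    rw [hMx]; simp
  -- ⟨x,N⟩ = 0 is differentiated along the ray; the strict inequality for `ρ` makes the ray stay in
  -- M on both sides.
  have hNx : inner ℝ x (N' x) = (0 : ℝ) := by
    have h1 : HasDerivAt (fun r : ℝ => r • x) x ρ := by
      simpa using (hasDerivAt_id ρ).smul_const x
    have h2 : HasDerivAt (fun r : ℝ => inner ℝ x (euclNormal φ (r • x))) (inner ℝ x (N' x)) ρ :=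
      (innerSL ℝ x).hasFDerivAt.comp_hasDerivAt ρ
        (HasFDerivAt.comp_hasDerivAt (f := fun r : ℝ => r • x) ρ hNd h1)
    have h3 : (fun r : ℝ => (inner ℝ x (euclNormal φ (r • x)) : ℝ)) =ᶠ[𝓝 ρ] fun _ => 0 := by
      have h4 : (fun r : ℝ => r • x) ⁻¹' U ∈ 𝓝 ρ :=
        (hU.isOpen.preimage (by fun_prop)).mem_nhds hxU
      filter_upwards [h4, lt_mem_nhds hρ] with r hr hr' using hrad' r hr'.le hr
    exact h2.unique ((hasDerivAt_const ρ (0 : ℝ)).congr_of_eventuallyEq h3)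
  rw [sphereMeanCurvature]
  change tr _ = 0
  rw [hfd, tr_sphereProj_comp hx, tr_sub, tr_smul, htr, tr_smulRight, sub_apply, smul_apply,
    inner_sub_right, real_inner_smul_right, hNx, ContinuousLinearMap.smulRight_apply,
    real_inner_smul_right, real_inner_self_eq_norm_sq, hx]
  ring

theorem mem_link_iff (hm : 0 < m) {x : Eucl n} :
    x ∈ (horizonRadius n m)⁻¹ • boundary n m S ↔ ‖x‖ = 1 ∧ horizonRadius n m • x ∈ S := by
  have hR := horizonRadius_pos (n := n) hm
  rw [Set.mem_inv_smul_set_iff₀ hR.ne']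
  have : horizonRadius n m • x ∈ horizon n m ↔ ‖x‖ = 1 := by
    change ‖horizonRadius n m • x‖ = _ ↔ _
    rw [norm_smul, Real.norm_of_nonneg hR.le, mul_eq_left₀ hR.ne']
  rw [boundary, Set.mem_inter_iff, this, and_comm]

theorem IsRadial.isMinimalCone (hn : 3 ≤ n) (hm : 0 < m) (hS : IsFreeBoundaryMinimal n m S)
    (hrad : IsRadial n m S) : IsMinimalCone n m S := by
  set R := horizonRadius n m with hRdef
  have hR : 0 < R := horizonRadius_pos hm
  have hcone : ∀ u : Eucl n, ‖u‖ = 1 → ∀ r s, R ≤ r → r • u ∈ S → R ≤ s → s • u ∈ S :=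
    fun u hu r s hr hru hs => hrad.smul_mem hm hS hu hr hru hs
  have hunit : ∀ x ∈ S, ‖‖x‖⁻¹ • x‖ = 1 ∧ ‖x‖ • ‖x‖⁻¹ • x = x := fun x hx => by
    have h : ‖x‖ ≠ 0 := (hR.trans_le (hS.subset hx)).ne'
    rw [norm_smul, norm_inv, norm_norm, inv_mul_cancel₀ h, smul_smul, mul_inv_cancel₀ h, one_smul]
    exact ⟨rfl, rfl⟩
  have hlink : ∀ x ∈ S, ‖x‖⁻¹ • x ∈ R⁻¹ • boundary n m S := fun x hx => by
    obtain ⟨h1, h2⟩ := hunit x hx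
    exact (mem_link_iff hm).2 ⟨h1, hcone _ h1 ‖x‖ R (hS.subset hx) (by rwa [h2]) le_rfl⟩
  refine ⟨R⁻¹ • boundary n m S, ⟨?_, ?_, ?_, ?_⟩, ?_⟩
  · obtain ⟨x, hx⟩ := hS.nonempty
    exact ⟨_, hlink x hx⟩
  · exact hS.isCompact_boundary.smul _
  · intro x hx
    simpa using ((mem_link_iff hm).1 hx).1
  · intro p hp
    obtain ⟨hp1, hpR⟩ := (mem_link_iff hm).1 hp
    -- Any radius beyond the horizon would do: the link is described by the equation of `S` pulled
    -- back from an exterior sphere.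
    set ρ := 2 * R with hρ
    have hρR : R < ρ := by rw [hρ]; linarith
    have hρ0 : 0 < ρ := hR.trans hρR
    obtain ⟨U, φ, hpU, hU⟩ := hS.exists_localEquation (hcone p hp1 R ρ le_rfl hpR hρR.le)
    have hdφ : ∀ y, ρ • y ∈ U → DifferentiableAt ℝ φ (ρ • y) := fun y hy =>
      (hU.contDiffOn.contDiffAt (hU.isOpen.mem_nhds hy)).differentiableAt (by simp)
    set ψ : Eucl n → ℝ := fun y => φ (ρ • y) with hψ
    set U' : Set (Eucl n) := (fun y => ρ • y) ⁻¹' U with hU'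
    have hU'o : IsOpen U' := hU.isOpen.preimage (continuous_const_smul ρ)
    have hψs : ContDiffOn ℝ ∞ ψ U' :=
      hU.contDiffOn.comp (contDiff_const_smul ρ).contDiffOn fun y hy => hy
    have hsg : ContinuousOn (sphereGrad n ψ) U' := by
      have h1 := (contDiffOn_gradient hU'o hψs).continuousOn
      have h2 : ContinuousOn (fun y : Eucl n => (inner ℝ y (gradient ψ y) : ℝ)) U' :=
        continuousOn_id.inner h1
      exact h1.sub (ContinuousOn.smul (g := fun y => y) h2 continuousOn_id)
    have hmemS : ∀ y : Eucl n, ‖y‖ = 1 → (y ∈ R⁻¹ • boundary n m S ↔ ρ • y ∈ S) := fun y hy => by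
      rw [mem_link_iff hm]
      exact ⟨fun h => hcone y hy R ρ le_rfl h.2 hρR.le,
        fun h => ⟨hy, hcone y hy ρ R hρR.le h le_rfl⟩⟩
    have hspace : ∀ y : Eucl n, ‖y‖ = 1 → ρ • y ∈ space n m := fun y hy => by
      change R ≤ ‖ρ • y‖
      rw [norm_smul, hy, mul_one, Real.norm_of_nonneg hρ0.le]; exact hρR.le
    have hpS := (hmemS p hp1).1 hp
    have hp0 : sphereGrad n ψ p ≠ 0 := by
      have h1 := hrad U φ hU (ρ • p) ⟨hpS, hpU⟩
      rw [real_inner_smul_right] at h1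
      have h2 := (mul_eq_zero.1 h1).resolve_left hρ0.ne'
      have h3 : gradient ψ p = ρ • gradient φ (ρ • p) := gradient_comp_smul (hdφ p hpU)
      rw [sphereGrad, h3, sphereProj, sub_apply, ContinuousLinearMap.smulRight_apply,
        innerSL_apply_apply, real_inner_smul_right, real_inner_comm, h2, mul_zero, zero_smul,
        sub_zero]
      exact smul_ne_zero hρ0.ne' (hU.gradient_ne _ hpU)
    refine ⟨U' ∩ sphereGrad n ψ ⁻¹' {0}ᶜ, ψ,
      hsg.isOpen_inter_preimage hU'o isOpen_compl_singleton, ⟨hpU, hp0⟩,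
      hψs.mono inter_subset_left, fun x hx => hx.1.2, ?_, ?_⟩
    · ext x
      constructor
      · rintro ⟨hx, hxU⟩
        have hx1 := ((mem_link_iff hm).1 hx).1
        exact ⟨hxU, by simpa using hx1,
          (hU.mem_iff hxU.1 (hspace x hx1)).1 ((hmemS x hx1).1 hx)⟩
      · rintro ⟨hxU, hx1, hx0⟩
        have hx1' : ‖x‖ = 1 := by simpa using hx1
        exact ⟨(hmemS x hx1').2 ((hU.mem_iff hxU.1 (hspace x hx1')).2 hx0), hxU⟩
    · rintro x ⟨hx, hxU⟩
      have hx1 := ((mem_link_iff hm).1 hx).1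
      exact hU.sphereMeanCurvature_eq_zero hn hm hrad hcone hρR hx1 hxU.1 ((hmemS x hx1).1 hx)
  · ext x
    constructor
    · intro hx
      exact ⟨⟨_, hlink x hx, ‖x‖, hR.trans_le (hS.subset hx), (hunit x hx).2.symm⟩, hS.subset hx⟩
    · rintro ⟨⟨y, hy, r, hr, rfl⟩, hx⟩
      obtain ⟨hy1, hyR⟩ := (mem_link_iff hm).1 hy
      have h1 : R ≤ ‖r • y‖ := hx
      rw [norm_smul, hy1, mul_one, Real.norm_of_nonneg hr.le] at h1
      exact hcone y hy1 R r le_rfl hyR h1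

end Link

/-! ### The density at infinity -/

section Density

open Set

variable {n : ℕ} {m : ℝ} {S Γ : Set (Eucl n)} {Θ : ℝ≥0∞}

/-- On the horizon the base 1 + m/(2r^(n-2)) equals 2, and the total exponent is 2. -/
theorem radialFactor_horizonRadius_pow (hn : 3 ≤ n) (hm : 0 < m) :
    radialFactor n m (horizonRadius n m) ^ (n - 2) = 4 := by
  have h2 : ((n - 2 : ℕ) : ℝ) = (n : ℝ) - 2 := by
    rw [Nat.cast_sub (by omega)]; norm_num
  have h3 : (n : ℝ) - 2 ≠ 0 := by
    rw [← h2]; exact_mod_cast (by omega : n - 2 ≠ 0)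
  have h4 : 1 + m / (2 * (m / 2)) = 2 := by field_simp; norm_num
  rw [radialFactor, horizonRadius_pow hn hm, h4, ← Real.rpow_natCast, ← Real.rpow_mul (by norm_num),
    h2, div_mul_cancel₀ _ h3]
  norm_num

theorem sphereVol_link (hm : 0 < m) : sphereVol n ((horizonRadius n m)⁻¹ • boundary n m S) =
    ENNReal.ofReal (1 / horizonRadius n m ^ (n - 2)) * μHE[n - 2] (boundary n m S) := by
  have hR := horizonRadius_pos (n := n) hm
  rw [sphereVol, Measure.euclideanHausdorffMeasure_smul₀ _ (inv_ne_zero hR.ne'), ENNReal.smul_def,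
    smul_eq_mul, one_div, ← inv_pow, ENNReal.ofReal_pow (by positivity), ENNReal.coe_pow,
    ← enorm_eq_nnnorm, ← ofReal_norm, Real.norm_of_nonneg (by positivity)]

theorem area_boundary (hn : 3 ≤ n) (hm : 0 < m) (hS : IsFreeBoundaryMinimal n m S) :
    area n m (n - 2) (boundary n m S) = ENNReal.ofReal (2 * m) *
      sphereVol n ((horizonRadius n m)⁻¹ • boundary n m S) := by
  have h1 : area n m (n - 2) (boundary n m S) =
      ENNReal.ofReal 4 * μHE[n - 2] (boundary n m S) := by
    rw [area, setLIntegral_congr_fun (g := fun _ => ENNReal.ofReal 4)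
      hS.isCompact_boundary.measurableSet, setLIntegral_const]
    intro x hx
    simp only
    rw [confFactor_eq, show ‖x‖ = horizonRadius n m from hx.2,
      radialFactor_horizonRadius_pow hn hm]
  rw [h1, sphereVol_link hm, ← mul_assoc, ← ENNReal.ofReal_mul (by positivity),
    horizonRadius_pow hn hm]
  congr 2
  field_simp
  norm_num

theorem area_inter_horizonBall (hn : 3 ≤ n) (hm : 0 < m) (hS : S ⊆ space n m) (k : ℕ) (R : ℝ) :
    area n m k (S ∩ horizonBall n m (radialDist n m R)) = area n m k (S ∩ {x | ‖x‖ ≤ R}) := by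
  rw [horizonBall_radialDist hn hm, ← inter_assoc, inter_eq_left.2 hS]

theorem cone_subset : cone n m Γ ⊆ space n m := inter_subset_right

/-- In terms of the isotropic radius, distance balls are coordinate balls and the denominator is |Γ|
V(R); the factor |Γ| cancels since it is positive and finite. -/
theorem HasDensityAtInfinity.tendsto (hn : 3 ≤ n) (hm : 0 < m) (hΓ : IsClosedMinimalInSphere n Γ)
    (hS : S ⊆ space n m) (hΘ : HasDensityAtInfinity n m Γ S Θ) :
    Tendsto (fun R => area n m (n - 1) (S ∩ {x | ‖x‖ ≤ R}) / ENNReal.ofReal (coneVolume n m R))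
      atTop (𝓝 (sphereVol n Γ * Θ)) := by
  have hγ0 := (hΓ.sphereVol_pos hn).ne'
  have hγ := (hΓ.sphereVol_lt_top hn).ne
  have h1 := ENNReal.Tendsto.const_mul (a := sphereVol n Γ)
    (hΘ.2.comp (tendsto_radialDist (n := n) hn hm)) (Or.inr hγ)
  refine h1.congr' ?_
  filter_upwards [eventually_ge_atTop (horizonRadius n m)] with R hR
  simp only [Function.comp_apply]
  rw [area_inter_horizonBall hn hm hS,
    area_inter_horizonBall hn hm cone_subset,
    area_cone hn hm hΓ hR, ← mul_div_assoc, ENNReal.mul_div_mul_left _ _ hγ0 hγ]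

theorem tendsto_sub_div_coneVolume (hn : 3 ≤ n) (hm : 0 < m) (c : ℝ) :
    Tendsto (fun R => (coneVolume n m R - c) / coneVolume n m R) atTop (𝓝 1) := by
  have hV := tendsto_coneVolume hn hm
  have h1 : Tendsto (fun R => 1 - c * (coneVolume n m R)⁻¹) atTop (𝓝 1) := by
    simpa using (hV.inv_tendsto_atTop.const_mul c).const_sub 1
  refine h1.congr' ?_
  filter_upwards [hV.eventually_gt_atTop 0] with R hR
  field_simp

/-- `boundary_add_defect_le` is divided by V(R); as R → ∞ the bounded losses 1 and V(b) + 1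
disappear. -/
theorem sphereVol_link_add_defect_le (hn : 3 ≤ n) (hm : 0 < m)
    (hΓ : IsClosedMinimalInSphere n Γ) (hS : IsFreeBoundaryMinimal n m S)
    (hΘ : HasDensityAtInfinity n m Γ S Θ) {a b : ℝ} (ha : horizonRadius n m < a) :
    sphereVol n ((horizonRadius n m)⁻¹ • boundary n m S) + defectIntegral n m S a b ≤
      sphereVol n Γ * Θ := by
  set V := coneVolume n m
  set q := horizonRadius n m ^ (n - 2) with hq
  have hq0 : 0 < q := pow_pos (horizonRadius_pos hm) _
  have h1 : Tendsto (fun R => ENNReal.ofReal ((V R - 1) / V R * (1 / q)) *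
      μHE[n - 2] (boundary n m S) + ENNReal.ofReal ((V R - (V b + 1)) / V R) *
      defectIntegral n m S a b) atTop
      (𝓝 (ENNReal.ofReal (1 * (1 / q)) * μHE[n - 2] (boundary n m S) +
        ENNReal.ofReal 1 * defectIntegral n m S a b)) := by
    refine Tendsto.add (ENNReal.Tendsto.mul_const (ENNReal.tendsto_ofReal
      ((tendsto_sub_div_coneVolume hn hm 1).mul_const _)) (Or.inl ?_))
      (ENNReal.Tendsto.mul_const (ENNReal.tendsto_ofReal
      (tendsto_sub_div_coneVolume hn hm _)) (Or.inl ?_))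
    · exact (ENNReal.ofReal_pos.2 (by positivity)).ne'
    · simp
  rw [one_mul, ENNReal.ofReal_one, one_mul, ← sphereVol_link hm] at h1
  refine le_of_tendsto_of_tendsto h1 (hΘ.tendsto hn hm hΓ hS.subset) ?_
  filter_upwards [(tendsto_coneVolume hn hm).eventually_gt_atTop 0] with R hR
  have hR' : 0 < V R := hR
  have key := boundary_add_defect_le hn hm hS (b := b) ha R
  rw [ENNReal.le_div_iff_mul_le (Or.inl (ENNReal.ofReal_pos.2 hR).ne')
    (Or.inl ENNReal.ofReal_ne_top)]
  refine le_trans (le_of_eq ?_) key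
  rw [add_mul, mul_right_comm, ← ENNReal.ofReal_mul' hR.le, mul_right_comm _ _ (ENNReal.ofReal _),
    ← ENNReal.ofReal_mul' hR.le]
  congr 3
  · change (V R - 1) / V R * (1 / q) * V R = (V R - 1) / q
    field_simp
  · change (V R - (V b + 1)) / V R * V R = V R - V b - 1
    field_simp
    ring

/-- By `area_cone` the normalized volume of a cone is eventually constant, equal to the volume of
its link. -/
theorem sphereVol_link_eq_of_isMinimalCone (hn : 3 ≤ n) (hm : 0 < m)
    (hΓ : IsClosedMinimalInSphere n Γ) (hΘ : HasDensityAtInfinity n m Γ S Θ)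
    (hS : IsMinimalCone n m S) :
    sphereVol n ((horizonRadius n m)⁻¹ • boundary n m S) = sphereVol n Γ * Θ := by
  obtain ⟨Γ', hΓ', rfl⟩ := hS
  have hR := horizonRadius_pos (n := n) hm
  have hlink : (horizonRadius n m)⁻¹ • boundary n m (cone n m Γ') = Γ' := by
    ext x
    rw [mem_link_iff hm]
    constructor
    · rintro ⟨hx, h⟩
      rw [cone_eq hm hΓ'.subset] at h
      have h1 : ‖horizonRadius n m • x‖⁻¹ • horizonRadius n m • x ∈ Γ' := h.1
      rwa [norm_smul, hx, mul_one, Real.norm_of_nonneg hR.le, smul_smul, inv_mul_cancel₀ hR.ne',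
        one_smul] at h1
    · intro hx
      have hx1 : ‖x‖ = 1 := by simpa using hΓ'.subset hx
      refine ⟨hx1, ⟨x, hx, _, hR, rfl⟩, ?_⟩
      change _ ≤ ‖horizonRadius n m • x‖
      rw [norm_smul, hx1, mul_one, Real.norm_of_nonneg hR.le]
  rw [hlink]
  refine tendsto_nhds_unique (tendsto_const_nhds.congr' ?_)
    (hΘ.tendsto hn hm hΓ cone_subset)
  filter_upwards [eventually_ge_atTop (horizonRadius n m),
    (tendsto_coneVolume hn hm).eventually_gt_atTop 0] with R hR1 hR2
  rw [area_cone hn hm hΓ' hR1, ENNReal.mul_div_cancel_right (ENNReal.ofReal_pos.2 hR2).ne'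
    ENNReal.ofReal_ne_top]

end Density

end Schwarzschild

theorem mainTheorem7 (n : ℕ) (hn : 3 ≤ n) (m : ℝ) (hm : 0 < m)
    (Γ S : Set (Schwarzschild.Eucl n))
    (hΓ : Schwarzschild.IsClosedMinimalInSphere n Γ)
    (hS : Schwarzschild.IsFreeBoundaryMinimal n m S)
    (Θ : ℝ≥0∞) (hΘ : Schwarzschild.HasDensityAtInfinity n m Γ S Θ) :
    Schwarzschild.area n m (n - 2) (Schwarzschild.boundary n m S)
        ≤ ENNReal.ofReal (2 * m) * Schwarzschild.sphereVol n Γ * Θ ∧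
    (Schwarzschild.area n m (n - 2) (Schwarzschild.boundary n m S)
        = ENNReal.ofReal (2 * m) * Schwarzschild.sphereVol n Γ * Θ ↔
      Schwarzschild.IsMinimalCone n m S) ∧
    (Schwarzschild.area n m (n - 2) (Schwarzschild.boundary n m S)
        = ENNReal.ofReal (2 * m) * Schwarzschild.sphereVol n Γ * Θ →
      Schwarzschild.sphereVol n Γ * Θ = Schwarzschild.sphereVol n
        ((Schwarzschild.horizonRadius n m)⁻¹ • Schwarzschild.boundary n m S)) := by
  have h2m0 : ENNReal.ofReal (2 * m) ≠ 0 := (ENNReal.ofReal_pos.2 (by positivity)).ne'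
  have hfin : Schwarzschild.sphereVol n Γ * Θ ≠ ⊤ :=
    ENNReal.mul_ne_top (hΓ.sphereVol_lt_top hn).ne hΘ.1
  have hle := fun a b (ha : Schwarzschild.horizonRadius n m < a) =>
    Schwarzschild.sphereVol_link_add_defect_le hn hm hΓ hS hΘ (b := b) ha
  rw [Schwarzschild.area_boundary hn hm hS, mul_assoc,
    ENNReal.mul_right_inj h2m0 ENNReal.ofReal_ne_top]
  -- For the inequality the defect is discarded, so the choice of shell, here `b = 0`, does not
  -- matter.
  refine ⟨mul_le_mul_right (le_self_add.trans (hle _ 0 (lt_add_one _))) _, ⟨fun h => ?_, fun h =>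
    Schwarzschild.sphereVol_link_eq_of_isMinimalCone hn hm hΓ hΘ h⟩, Eq.symm⟩
  refine (Schwarzschild.isRadial_of_defectIntegral_eq_zero hn hm hS fun a b ha => ?_).isMinimalCone
    hn hm hS
  have h1 := hle a b ha
  rw [h] at h1
  -- Under equality the link already exhausts |Γ| Θ; cancelling this finite quantity leaves no room
  -- for the defect.
  exact nonpos_iff_eq_zero.1 (ENNReal.le_of_add_le_add_left hfin (by rwa [add_zero]))
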